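/- Let $\mathcal{L}=\mathbb{Z}\times\mathbb{Z}$ be the integer lattice in the Euclidean plane. For a convex polygon $P$ (closed, with non-empty interior), let $P^0=\mathrm{conv}(P\cap\mathcal{L})$ be its discrete hull, $|P^0|$ the number of vertices (extreme points) of $P^0$, and $\delta(P)$ the diameter of $P$. The model of computation is the unit-cost real RAM with the floor function: a program is finite and uses only integer constants, it works on registers and arrays of real numbers, and the exact operations $+,-,\times,/$, $\lfloor\cdot\rfloor$, comparisons, and reads and writes of registers and of array cells (with indirect addressing) cost one unit of time each. There are a single program and an absolute constant $K$ such that, for every $n\ge 3$ and every convex polygon $P$ with $n$ edges, given by the coordinates of its $n$ vertices (real numbers) in counterclockwise order, the program outputs the vertices of $P^0$, each exactly once and in counterclockwise order, and halts within $$K\bigl(n+\max\{1,|P^0|\}\cdot\max\{1,\log\delta(P)\}\cdot\log n\bigr)$$ units of time. That is, the discrete hull $P^0$ of a convex $n$-gon $P$ can be computed in $O(n+|P^0|\log\delta(P)\log n)$ time. (If $P$ contains no lattice point, the output is the empty list and $|P^0|=0$ is read as $1$ in the bound; $\log\delta(P)$ is read as $1$ when it is smaller than $1$.) -/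

import Mathlib

noncomputable section

/-! ## Planar geometry -/

/-- The Euclidean plane. -/
abbrev Plane : Type := EuclideanSpace ℝ (Fin 2)

/-- The planar integer lattice `ℤ × ℤ`. -/
def integerLattice : Set Plane := {p | ∃ a b : ℤ, p = !₂[(a : ℝ), (b : ℝ)]}

/-- The discrete hull of `C`: the convex hull of the lattice points of `C`. -/
def discreteHull (C : Set Plane) : Set Plane := convexHull ℝ (C ∩ integerLattice)

/-- The vertices of a convex set are its extreme points; this is their number. -/
def numVertices (S : Set Plane) : ℕ := (S.extremePoints ℝ).ncard

/-- Twice the signed area of the triangle `p q r`; it is positive exactly when `p, q, r` make a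
strict left turn. -/
def orientation (p q r : Plane) : ℝ :=
  (q 0 - p 0) * (r 1 - p 1) - (q 1 - p 1) * (r 0 - p 0)

/-- The points `v 0, …, v (n - 1)` are in strictly convex position and are listed in
counterclockwise order. For `n ≥ 3` this says that they are the successive vertices of a convex
polygon with `n` vertices and `n` edges. -/
def IsCounterclockwise {n : ℕ} (v : Fin n → Plane) : Prop :=
  ∀ i j k : Fin n, i < j → j < k → 0 < orientation (v i) (v j) (v k)

/-- The (closed, two-dimensional) polygon with the vertices `v`. -/
def polygon {n : ℕ} (v : Fin n → Plane) : Set Plane := convexHull ℝ (Set.range v)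

/-- `w` lists the vertices of `S`, each exactly once, in counterclockwise order.
(A set with at most two vertices imposes no condition on the order.) -/
def IsVertexList {m : ℕ} (w : Fin m → Plane) (S : Set Plane) : Prop :=
  Function.Injective w ∧ Set.range w = S.extremePoints ℝ ∧ IsCounterclockwise w

/-! ## The model of computation: a real RAM with the floor function

A program is a finite object, it mentions only integer constants, and it works on registers and
arrays of real numbers. Arithmetic operations, the floor function, comparisons and accesses to
registers and to array cells (indirect addressing) are exact and cost one unit of time each. -/

namespace RealRAM

/-- The store: registers `reg r`, and cells `arr a i` (cell number `i` of the array `a`). -/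
structure State where
  reg : ℕ → ℝ
  arr : ℕ → ℕ → ℝ

/-- Expressions. `read a e` is the content of the cell of array `a` whose number is the value
of `e`. -/
inductive Expr : Type
  | const (z : ℤ)
  | reg (r : ℕ)
  | read (a : ℕ) (e : Expr)
  | add (e f : Expr)
  | sub (e f : Expr)
  | mul (e f : Expr)
  | div (e f : Expr)
  | floor (e : Expr)

/-- The value of an expression. Addresses are rounded down to natural numbers (negative ones
to `0`), and a division by zero gives `0`. -/
def Expr.eval (s : State) : Expr → ℝ
  | .const z => z
  | .reg r => s.reg r
  | .read a e => s.arr a ⌊e.eval s⌋₊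
  | .add e f => e.eval s + f.eval s
  | .sub e f => e.eval s - f.eval s
  | .mul e f => e.eval s * f.eval s
  | .div e f => e.eval s / f.eval s
  | .floor e => (⌊e.eval s⌋ : ℤ)

/-- The time needed to evaluate an expression: one unit for each operation, constant, register
access and cell access in it. -/
def Expr.cost : Expr → ℕ
  | .const _ => 1
  | .reg _ => 1
  | .read _ e => e.cost + 1
  | .add e f => e.cost + f.cost + 1
  | .sub e f => e.cost + f.cost + 1
  | .mul e f => e.cost + f.cost + 1
  | .div e f => e.cost + f.cost + 1
  | .floor e => e.cost + 1

/-- Conditions: Boolean combinations of comparisons. -/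
inductive Cond : Type
  | le (e f : Expr)
  | not (b : Cond)
  | and (b c : Cond)

/-- The truth value of a condition. -/
def Cond.Holds (s : State) : Cond → Prop
  | .le e f => e.eval s ≤ f.eval s
  | .not b => ¬ b.Holds s
  | .and b c => b.Holds s ∧ c.Holds s

/-- The time needed to evaluate a condition. -/
def Cond.cost : Cond → ℕ
  | .le e f => e.cost + f.cost + 1
  | .not b => b.cost + 1
  | .and b c => b.cost + c.cost + 1

/-- Programs. `assign r e` puts the value of `e` into the register `r`, and `write a e f` puts the
value of `f` into the cell of array `a` whose number is the value of `e`. -/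
inductive Program : Type
  | skip
  | assign (r : ℕ) (e : Expr)
  | write (a : ℕ) (e f : Expr)
  | seq (p q : Program)
  | ite (b : Cond) (p q : Program)
  | loop (b : Cond) (p : Program)

/-- The store after an assignment to a register. -/
def State.setReg (s : State) (r : ℕ) (x : ℝ) : State :=
  { s with reg := Function.update s.reg r x }

/-- The store after writing to a cell of an array. -/
def State.setArr (s : State) (a i : ℕ) (x : ℝ) : State :=
  { s with arr := Function.update s.arr a (Function.update (s.arr a) i x) }

/-- `Runs p s t s'`: the program `p`, started in the store `s`, halts after exactly `t` units of
time, in the store `s'`. (`loop b p` is "while `b` do `p`".) -/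
inductive Runs : Program → State → ℕ → State → Prop
  | skip (s : State) : Runs .skip s 1 s
  | assign (r : ℕ) (e : Expr) (s : State) :
      Runs (.assign r e) s (e.cost + 1) (s.setReg r (e.eval s))
  | write (a : ℕ) (e f : Expr) (s : State) :
      Runs (.write a e f) s (e.cost + f.cost + 1) (s.setArr a ⌊e.eval s⌋₊ (f.eval s))
  | seq {p q : Program} {s s' s'' : State} {t t' : ℕ} :
      Runs p s t s' → Runs q s' t' s'' → Runs (.seq p q) s (t + t') s''
  | ite_true {b : Cond} {p q : Program} {s s' : State} {t : ℕ} :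
      b.Holds s → Runs p s t s' → Runs (.ite b p q) s (b.cost + t) s'
  | ite_false {b : Cond} {p q : Program} {s s' : State} {t : ℕ} :
      ¬ b.Holds s → Runs q s t s' → Runs (.ite b p q) s (b.cost + t) s'
  | loop_done {b : Cond} {p : Program} {s : State} :
      ¬ b.Holds s → Runs (.loop b p) s b.cost s
  | loop_step {b : Cond} {p : Program} {s s' s'' : State} {t t' : ℕ} :
      b.Holds s → Runs p s t s' → Runs (.loop b p) s' t' s'' →
      Runs (.loop b p) s (b.cost + t + t') s''

/-- The initial store for the input `v`: register `0` holds the number `n` of points, arrays `0`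
and `1` hold their first and second coordinates in the cells `0, …, n - 1`, and everything else
is `0`. -/
def inputState {n : ℕ} (v : Fin n → Plane) : State where
  reg r := if r = 0 then n else 0
  arr a i := if h : i < n then
      if a = 0 then v ⟨i, h⟩ 0 else if a = 1 then v ⟨i, h⟩ 1 else 0
    else 0

/-- The store `s` presents the list `w` as output: register `0` holds its length `m`, and arrays
`2` and `3` hold the first and second coordinates of its points in the cells `0, …, m - 1`. -/
def State.Outputs (s : State) {m : ℕ} (w : Fin m → Plane) : Prop :=
  s.reg 0 = m ∧ ∀ i : Fin m, s.arr 2 i = w i 0 ∧ s.arr 3 i = w i 1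

end RealRAM

end

/-! ## Reasoning about programs -/

namespace RealRAM

-- The hull of the lattice points is found by gift wrapping: from a vertex p of the hull one turns
-- to the clockwise-most direction b in which a lattice point of P is seen, goes as far as possible
-- along b, and repeats until the starting vertex returns. With a cost of O(log δ log n) per vertex,
-- and O(n) plus one more such term for finding a first vertex, the bound follows.
--
-- The clockwise-most direction is found by a search of Stern-Brocot type. A basis a, b of
-- determinant 1 is kept such that b is a direction towards a lattice point and every direction
-- before b comes after a (`SearchInv`). A round finds the least t with p + a + tb in P, replaces a
-- and b by a + (t-1)b and a + tb, and then adds the new a to the new b as often as P permits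
-- (`SearchInv.step`); if there is no such t, b is the required direction (`SearchInv.final`).
-- Rounding inside a lattice-convex set (`LatConvex.level_one`) makes a search at level one
-- sufficient, and `Pointed.eq_zero` replaces arguments about angles. Both numbers in a round are
-- found by exponential search on a line, at a cost logarithmic in the result. A linear functional
-- `cross g`, positive on the cone of a and b and polynomially bounded on P, grows in the round by a
-- factor c ≥ 2 that pays for these logarithms (`log_add_log_le`). The costs therefore telescope to
-- O(log δ) probes per vertex, instead of O(log δ) searches of O(log δ) probes each.
--
-- A probe is the location of a point in P by bisection in the fan of triangles at one vertex, in
-- O(log n) time (`runs_locate`). When the point is outside, an edge is returned whose inequality it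
-- violates; the slope of this inequality along the line tells on which side P has to be looked for
-- (`Violated.lt`). This makes exponential search possible before any point of P on the line is
-- known.
--
-- The walk closes up at its start because an edge of the hull is determined by its second end
-- (`IsHullEdge.left_unique`), so that the first repetition can only be the starting vertex. All
-- visited points are extreme (`mem_extremePoints_of_pointed`), which bounds the number of steps,
-- and a closed walk encloses all lattice points (`isVertexList_of_walk`).
--
-- For the first vertex, the polygon is made round by lattice reduction. The longest arm u from a
-- vertex and the arm w farthest from the line of u give a quadratic form comparable to the squared
-- width of P in every direction (`sq_le_of_parallelogram`), and Gauss reduction of this form yields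
-- a basis y, z of integer functionals with y short. If P has many columns y = c, then it contains a
-- triangle of large area, and all columns away from the ends have chords long enough for two
-- consecutive lattice points (`exists_pair_of_wide`). Hence at most 200 columns, each searched with
-- O(log δ) probes, either show that P has at most one lattice point or yield the lexicographically
-- first one and a primitive vector to a second one. Its short y-coordinate allows it to be
-- completed to a basis by trial, and the walk can begin.

infixr:60 " ;; " => Program.seq

instance : Add Expr := ⟨Expr.add⟩
instance : Sub Expr := ⟨Expr.sub⟩
instance : Mul Expr := ⟨Expr.mul⟩
instance : Div Expr := ⟨Expr.div⟩

@[simp] theorem Expr.eval_hadd (s : State) (e f : Expr) : (e + f).eval s = e.eval s + f.eval s := rfl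
@[simp] theorem Expr.eval_hsub (s : State) (e f : Expr) : (e - f).eval s = e.eval s - f.eval s := rfl
@[simp] theorem Expr.eval_hmul (s : State) (e f : Expr) : (e * f).eval s = e.eval s * f.eval s := rfl
@[simp] theorem Expr.eval_hdiv (s : State) (e f : Expr) : (e / f).eval s = e.eval s / f.eval s := rfl
@[simp] theorem Expr.eval_const (s : State) (z : ℤ) : (Expr.const z).eval s = z := rfl
@[simp] theorem Expr.eval_reg (s : State) (r : ℕ) : (Expr.reg r).eval s = s.reg r := rfl
@[simp] theorem Expr.eval_read (s : State) (a : ℕ) (e : Expr) :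
    (Expr.read a e).eval s = s.arr a ⌊e.eval s⌋₊ := rfl
@[simp] theorem Expr.eval_floor (s : State) (e : Expr) :
    (Expr.floor e).eval s = (⌊e.eval s⌋ : ℤ) := rfl

/-- The condition `e < f`. -/
def Cond.lt (e f : Expr) : Cond := .not (.le f e)

/-- The condition `e = f`. -/
def Cond.eq (e f : Expr) : Cond := .and (.le e f) (.le f e)

@[simp] theorem Cond.holds_le (s : State) (e f : Expr) :
    (Cond.le e f).Holds s ↔ e.eval s ≤ f.eval s := Iff.rfl
@[simp] theorem Cond.holds_lt (s : State) (e f : Expr) :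
    (Cond.lt e f).Holds s ↔ e.eval s < f.eval s := by simp [Cond.lt, Cond.Holds]
@[simp] theorem Cond.holds_eq (s : State) (e f : Expr) :
    (Cond.eq e f).Holds s ↔ e.eval s = f.eval s := by
  simp [Cond.eq, Cond.Holds, le_antisymm_iff]
@[simp] theorem Cond.holds_not (s : State) (b : Cond) :
    (Cond.not b).Holds s ↔ ¬ b.Holds s := Iff.rfl
@[simp] theorem Cond.holds_and (s : State) (b c : Cond) :
    (Cond.and b c).Holds s ↔ b.Holds s ∧ c.Holds s := Iff.rfl

@[simp] theorem State.reg_setReg (s : State) (r r' : ℕ) (x : ℝ) :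
    (s.setReg r x).reg r' = if r' = r then x else s.reg r' := by
  simp [State.setReg, Function.update_apply]
@[simp] theorem State.arr_setReg (s : State) (r : ℕ) (x : ℝ) : (s.setReg r x).arr = s.arr := rfl
@[simp] theorem State.reg_setArr (s : State) (a i : ℕ) (x : ℝ) : (s.setArr a i x).reg = s.reg := rfl
theorem State.arr_setArr (s : State) (a i : ℕ) (x : ℝ) (b j : ℕ) :
    (s.setArr a i x).arr b j = if b = a ∧ j = i then x else s.arr b j := by
  by_cases hb : b = a
  · subst hb; by_cases hj : j = i <;> simp [State.setArr, hj]
  · simp [State.setArr, hb]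

/-! ### Loop-free blocks, frames and time bounds for loops. -/

/-- Programs without loops. -/
def Program.LoopFree : Program → Bool
  | .skip => true
  | .assign _ _ => true
  | .write _ _ _ => true
  | .seq p q => p.LoopFree && q.LoopFree
  | .ite _ p q => p.LoopFree && q.LoopFree
  | .loop _ _ => false

/-- The final store of a loop-free program. -/
noncomputable def Program.exec : Program → State → State
  | .skip, s => s
  | .assign r e, s => s.setReg r (e.eval s)
  | .write a e f, s => s.setArr a ⌊e.eval s⌋₊ (f.eval s)
  | .seq p q, s => q.exec (p.exec s)
  | .ite b p q, s => open Classical in if b.Holds s then p.exec s else q.exec s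
  | .loop _ _, s => s

/-- An upper bound for the running time of a loop-free program. -/
def Program.maxCost : Program → ℕ
  | .skip => 1
  | .assign _ e => e.cost + 1
  | .write _ e f => e.cost + f.cost + 1
  | .seq p q => p.maxCost + q.maxCost
  | .ite b p q => b.cost + max p.maxCost q.maxCost
  | .loop _ _ => 0

theorem Program.runs_exec {p : Program} (h : p.LoopFree = true) (s : State) :
    ∃ t, Runs p s t (p.exec s) ∧ t ≤ p.maxCost := by
  induction p generalizing s with
  | skip => exact ⟨_, .skip s, le_rfl⟩
  | assign r e => exact ⟨_, .assign r e s, le_rfl⟩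
  | write a e f => exact ⟨_, .write a e f s, le_rfl⟩
  | seq p q ihp ihq =>
    simp only [LoopFree, Bool.and_eq_true] at h
    obtain ⟨t, hr, ht⟩ := ihp h.1 s
    obtain ⟨t', hr', ht'⟩ := ihq h.2 (p.exec s)
    exact ⟨_, .seq hr hr', by simp only [maxCost]; omega⟩
  | ite b p q ihp ihq =>
    simp only [LoopFree, Bool.and_eq_true] at h
    by_cases hb : b.Holds s
    · obtain ⟨t, hr, ht⟩ := ihp h.1 s
      refine ⟨b.cost + t, ?_, ?_⟩
      · simpa [exec, hb] using Runs.ite_true (q := q) hb hr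
      · simp only [maxCost]; omega
    · obtain ⟨t, hr, ht⟩ := ihq h.2 s
      refine ⟨b.cost + t, ?_, ?_⟩
      · simpa [exec, hb] using Runs.ite_false (p := p) hb hr
      · simp only [maxCost]; omega
  | loop b p => simp [LoopFree] at h

/-- A loop-free program whose cost bound is known. -/
theorem Program.runs_block {p : Program} (c : ℕ) (s : State) (h : p.LoopFree = true)
    (hc : p.maxCost ≤ c) : ∃ t s', Runs p s t s' ∧ t ≤ c ∧ s' = p.exec s := by
  obtain ⟨t, hr, ht⟩ := Program.runs_exec h s
  exact ⟨t, _, hr, ht.trans hc, rfl⟩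

/-- The program writes to no register below `k` and to no array. -/
def Program.Above (k : ℕ) : Program → Bool
  | .skip => true
  | .assign r _ => decide (k ≤ r)
  | .write _ _ _ => false
  | .seq p q => p.Above k && q.Above k
  | .ite _ p q => p.Above k && q.Above k
  | .loop _ p => p.Above k

/-- Registers are allocated by nesting: the inner a routine, the higher the registers it writes to.
The data of a caller then survive a call by a syntactic check, and nothing about the values computed
inside has to be known. -/
theorem Runs.frame {p : Program} {s s' : State} {t : ℕ} (h : Runs p s t s') {k : ℕ}
    (hk : p.Above k = true) : (∀ r < k, s'.reg r = s.reg r) ∧ s'.arr = s.arr := by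
  induction h with
  | skip s => simp
  | assign r e s =>
    simp only [Program.Above, decide_eq_true_eq] at hk
    refine ⟨fun r' hr' => ?_, rfl⟩
    simp only [State.reg_setReg]
    rw [if_neg (by omega)]
  | write a e f s => simp [Program.Above] at hk
  | seq _ _ ih1 ih2 =>
    simp only [Program.Above, Bool.and_eq_true] at hk
    obtain ⟨a1, a2⟩ := ih1 hk.1
    obtain ⟨b1, b2⟩ := ih2 hk.2
    exact ⟨fun r hr => (b1 r hr).trans (a1 r hr), b2.trans a2⟩
  | ite_true _ _ ih => 
    simp only [Program.Above, Bool.and_eq_true] at hk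
    exact ih hk.1
  | ite_false _ _ ih =>
    simp only [Program.Above, Bool.and_eq_true] at hk
    exact ih hk.2
  | loop_done _ => simp
  | loop_step _ _ _ ih1 ih2 =>
    obtain ⟨a1, a2⟩ := ih1 (by simpa [Program.Above] using hk)
    obtain ⟨b1, b2⟩ := ih2 hk
    exact ⟨fun r hr => (b1 r hr).trans (a1 r hr), b2.trans a2⟩

theorem Cond.one_le_cost (b : Cond) : 1 ≤ b.cost := by
  cases b <;> simp [Cond.cost]

/-- Amortized analysis of a loop: `I x s` is the invariant, with a ghost parameter `x`, and `Φ` is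
the potential that pays for the running time. -/
theorem Runs.loop_rule {α : Type*} {b : Cond} {p : Program} (c : ℕ) (hc : b.cost ≤ c)
    (I : α → State → Prop) (Φ : α → ℝ)
    (hstep : ∀ x s, I x s → b.Holds s →
      ∃ t s' x', Runs p s t s' ∧ I x' s' ∧ Φ x' + t + c ≤ Φ x)
    (hpos : ∀ x s, I x s → (c : ℝ) ≤ Φ x) {x : α} {s : State} (hs : I x s) :
    ∃ t s' x', Runs (.loop b p) s t s' ∧ I x' s' ∧ ¬ b.Holds s' ∧ (t : ℝ) ≤ Φ x := by
  have hc1 : (1 : ℝ) ≤ c := by exact_mod_cast b.one_le_cost.trans hc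
  have hc2 : (b.cost : ℝ) ≤ c := by exact_mod_cast hc
  -- A round lowers Φ by at least c ≥ 1 and Φ never falls below c, so induction on a natural upper
  -- bound of the real number Φ proves termination along with the time bound.
  have key : ∀ N : ℕ, ∀ x s, I x s → Φ x ≤ N →
      ∃ t s' x', Runs (.loop b p) s t s' ∧ I x' s' ∧ ¬ b.Holds s' ∧ (t : ℝ) ≤ Φ x := by
    intro N
    induction N with
    | zero =>
      intro x s hs hN
      have := hpos x s hs
      push_cast at hN
      linarith
    | succ N ih =>
      intro x s hs hN
      by_cases hb : b.Holds s
      · obtain ⟨t, s', x', hr, hI, hΦ⟩ := hstep x s hs hb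
        have ht : (0 : ℝ) ≤ t := t.cast_nonneg
        push_cast at hN
        obtain ⟨t', s'', x'', hr', hI', hb', hΦ'⟩ := ih x' s' hI (by linarith)
        exact ⟨_, s'', x'', .loop_step hb hr hr', hI', hb', by push_cast; linarith⟩
      · exact ⟨_, s, x, .loop_done hb, hs, hb, hc2.trans (hpos x s hs)⟩
  exact key ⌈Φ x⌉₊ x s hs (Nat.le_ceil _)

/-- A loop that runs at most `k` times. -/
theorem Runs.loop_count {b : Cond} {p : Program} (c : ℕ) (hc : b.cost ≤ c)
    (I : ℕ → State → Prop) (T : ℝ) (hT : 0 ≤ T)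
    (hstep : ∀ k s, I k s → b.Holds s →
      ∃ t s' k', Runs p s t s' ∧ I k' s' ∧ k' < k ∧ (t : ℝ) ≤ T)
    {k : ℕ} {s : State} (hs : I k s) :
    ∃ t s' k', Runs (.loop b p) s t s' ∧ I k' s' ∧ ¬ b.Holds s' ∧
      (t : ℝ) ≤ k * (T + c) + c := by
  have hc0 : (0 : ℝ) ≤ c := Nat.cast_nonneg _
  refine Runs.loop_rule c hc I (fun k => k * (T + c) + c) ?_ ?_ hs
  · intro k s hs hb
    obtain ⟨t, s', k', hr, hI, hk, ht⟩ := hstep k s hs hb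
    refine ⟨t, s', k', hr, hI, ?_⟩
    have : (k' : ℝ) + 1 ≤ k := by exact_mod_cast hk
    nlinarith
  · intro k s _
    have : (0 : ℝ) ≤ k * (T + c) := by positivity
    linarith

/-- A loop whose number of rounds is only known at its end. -/
theorem Runs.loop_up {b : Cond} {p : Program} (c : ℕ) (hc : b.cost ≤ c)
    (I : ℕ → State → Prop) (T : ℝ) (B : ℕ)
    (hstep : ∀ k s, I k s → b.Holds s →
      k < B ∧ ∃ t s', Runs p s t s' ∧ I (k + 1) s' ∧ (t : ℝ) ≤ T)
    {k : ℕ} {s : State} (hs : I k s) :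
    ∃ t s' k', Runs (.loop b p) s t s' ∧ k ≤ k' ∧ I k' s' ∧ ¬ b.Holds s' ∧
      (t : ℝ) ≤ (k' - k) * (T + c) + c := by
  have hc2 : (b.cost : ℝ) ≤ c := by exact_mod_cast hc
  by_cases hb : b.Holds s
  · obtain ⟨hk, t, s', hr, hI, ht⟩ := hstep k s hs hb
    obtain ⟨t', s'', k', hr', hk', hI', hb', ht'⟩ := Runs.loop_up c hc I T B hstep hI
    refine ⟨_, s'', k', .loop_step hb hr hr', by omega, hI', hb', ?_⟩
    push_cast at ht' ⊢
    linarith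
  · exact ⟨_, s, k, .loop_done hb, le_rfl, hs, hb, by linarith⟩
-- The number `B` serves for termination only and does not enter the time bound.
termination_by B - k

end RealRAM

/-! ## Lattice vectors and the search in a Stern-Brocot tree -/

namespace LatticeHull

/-- The determinant of two lattice vectors. -/
def cross (a b : ℤ × ℤ) : ℤ := a.1 * b.2 - a.2 * b.1

/-- The scalar product of two lattice vectors. -/
def dot (a b : ℤ × ℤ) : ℤ := a.1 * b.1 + a.2 * b.2

/-- A set of lattice points that contains the lattice points of all triangles with vertices in
the set. -/
def LatConvex (S : Set (ℤ × ℤ)) : Prop :=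
  ∀ x ∈ S, ∀ y ∈ S, ∀ z ∈ S, ∀ (a b c : ℤ) (w : ℤ × ℤ), 0 ≤ a → 0 ≤ b → 0 ≤ c → 0 < a + b + c →
    (a + b + c) • w = a • x + b • y + c • z → w ∈ S

/-- The set `S`, seen from the point `p`. -/
def shift (S : Set (ℤ × ℤ)) (p : ℤ × ℤ) : Set (ℤ × ℤ) := {z | p + z ∈ S}

theorem LatConvex.shift {S : Set (ℤ × ℤ)} (h : LatConvex S) (p : ℤ × ℤ) :
    LatConvex (shift S p) := by
  intro x hx y hy z hz a b c w ha hb hc habc hw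
  refine h _ hx _ hy _ hz a b c _ ha hb hc habc ?_
  rw [smul_add, hw]
  module

/-- Positivity in a lexicographic order: `z` lies to the left of the direction `f`, or on the ray
opposite to `f`. -/
def LexPos (f z : ℤ × ℤ) : Prop := 0 < cross f z ∨ (cross f z = 0 ∧ dot f z < 0)

/-- All nonzero vectors of `D` are positive. -/
def Pointed (f : ℤ × ℤ) (D : Set (ℤ × ℤ)) : Prop := ∀ z ∈ D, z ≠ 0 → LexPos f z

/-- On D the form `cross f` is nonnegative, and where it vanishes `dot f` is nonpositive; at nonzero
points one of the two is strict. A vanishing combination therefore cannot give positive weight to a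
nonzero point. This says that the cone of D contains no line. -/
theorem Pointed.eq_zero {f : ℤ × ℤ} {D : Set (ℤ × ℤ)} (h : Pointed f D) {x y z : ℤ × ℤ}
    (hx : x ∈ D) (hy : y ∈ D) (hz : z ∈ D) {a b c : ℤ} (ha : 0 < a) (hb : 0 ≤ b) (hc : 0 ≤ c)
    (hs : a • x + b • y + c • z = 0) : x = 0 := by
  by_contra hne
  have weak : ∀ w ∈ D, 0 ≤ cross f w ∧ (cross f w = 0 → dot f w ≤ 0) := by
    intro w hw
    by_cases h0 : w = 0
    · subst h0; simp [cross, dot]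
    · rcases h w hw h0 with h1 | h1
      · exact ⟨h1.le, fun h2 => by omega⟩
      · exact ⟨h1.1.ge, fun _ => h1.2.le⟩
  obtain ⟨y1, y2⟩ := weak y hy
  obtain ⟨z1, z2⟩ := weak z hz
  have e1 : a * cross f x + b * cross f y + c * cross f z = 0 := by
    have h1 := congrArg Prod.fst hs
    have h2 := congrArg Prod.snd hs
    simp at h1 h2
    simp only [cross]
    linear_combination f.1 * h2 - f.2 * h1
  have e2 : a * dot f x + b * dot f y + c * dot f z = 0 := by
    have h1 := congrArg Prod.fst hs
    have h2 := congrArg Prod.snd hs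
    simp at h1 h2
    simp only [dot]
    linear_combination f.1 * h1 + f.2 * h2
  have hby := mul_nonneg hb y1
  have hcz := mul_nonneg hc z1
  rcases h x hx hne with h1 | ⟨h1, h3⟩
  · have := mul_pos ha h1
    linarith
  · rw [h1] at e1
    have hby0 : b * cross f y = 0 := by linarith
    have hcz0 : c * cross f z = 0 := by linarith
    have hby' : b * dot f y ≤ 0 := by
      rcases mul_eq_zero.1 hby0 with h0 | h0
      · simp [h0]
      · exact mul_nonpos_of_nonneg_of_nonpos hb (y2 h0)
    have hcz' : c * dot f z ≤ 0 := by
      rcases mul_eq_zero.1 hcz0 with h0 | h0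
      · simp [h0]
      · exact mul_nonpos_of_nonneg_of_nonpos hc (z2 h0)
    have := mul_neg_of_pos_of_neg ha h3
    linarith

/-- If a lattice-convex set contains `0`, `b` and a point at level `i ≥ 1` over `b`, then it
contains a point at level one. -/
theorem LatConvex.level_one {D : Set (ℤ × ℤ)} (h : LatConvex D) (h0 : (0 : ℤ × ℤ) ∈ D)
    {a b : ℤ × ℤ} (hb : b ∈ D) {i j : ℤ} (hi : 0 < i) (hz : i • a + j • b ∈ D) :
    a + (-((-j) / i)) • b ∈ D := by
  have h1 := Int.emod_add_mul_ediv (-j) i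
  have h2 := Int.emod_nonneg (-j) hi.ne'
  have h3 := Int.emod_lt_of_pos (-j) hi
  -- The point is (z + r b) / i, where z is the given point at level i and r = (-j) mod i rounds j
  -- up to a multiple of i. The weight i - 1 - r left for 0 is nonnegative, and -((-j) / i) is the
  -- ceiling of j / i.
  refine h _ hz _ hb _ h0 1 ((-j) % i) (i - 1 - (-j) % i) _ (by norm_num) h2 (by omega)
    (by omega) ?_
  have h4 : (-j) % i = -j - i * ((-j) / i) := by linarith
  rw [h4]
  module

theorem decomp {a b : ℤ × ℤ} (h : cross a b = 1) (z : ℤ × ℤ) :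
    z = (-cross b z) • a + cross a z • b := by
  simp only [cross] at h ⊢
  ext
  · simp; linear_combination (-z.1) * h
  · simp; linear_combination (-z.2) * h

/-! ### The clockwise-most direction of a pointed lattice-convex set. -/

/-- The invariant of the search for the clockwise-most direction of `D`: the vectors `a`, `b` form
a positive basis, `b` is a direction of `D`, and the directions of `D` that come before `b` come
after `a`. -/
structure SearchInv (D : Set (ℤ × ℤ)) (a b : ℤ × ℤ) : Prop where
  det : cross a b = 1
  mem : b ∈ D
  add : a + b ∉ D
  pos : ∀ z ∈ D, cross b z < 0 → 0 < cross a z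

/-- A point z of D that comes before -d has positive level over -d, so `level_one` yields a point e
+ s d of D, and s ≤ M - 2. Seen from a = e + M d this point uses -d at least twice, which forces
`cross a z` to be positive. -/
theorem SearchInv.init {D : Set (ℤ × ℤ)} (hD : LatConvex D) (h0 : (0 : ℤ × ℤ) ∈ D)
    {d e : ℤ × ℤ} (hde : cross d e = 1) (hd : -d ∈ D) {M : ℤ}
    (hM : ∀ s : ℤ, e + s • d ∈ D → s ≤ M - 2) : SearchInv D (e + M • d) (-d) := by
  have hdet : cross (e + M • d) (-d) = 1 := by
    simp only [cross] at hde ⊢; simp; linear_combination hde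
  refine ⟨hdet, hd, ?_, ?_⟩
  · intro h
    have := hM (M - 1) (by convert h using 1; module)
    omega
  · intro z hz hneg
    have hz' := hz
    rw [decomp hdet z] at hz'
    have := hD.level_one h0 hd (by omega) hz'
    set i := -cross (-d) z with hi
    set j := cross (e + M • d) z with hj
    have h2 := hM (M + (-j) / i) (by convert this using 1; module)
    by_contra hcon
    have : 0 ≤ (-j) / i := Int.ediv_nonneg (by omega) (by omega)
    omega

/-- Two runs of Stern-Brocot moves. The first moves a along b to just before D is reached;
minimality of t and `level_one` keep the relevant directions of D after the new a. The second moves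
b towards the new a as far as D permits, and the maximality of k restores `add`. Directions in any
other place would make 0 a positive combination of points of D. -/
theorem SearchInv.step {D : Set (ℤ × ℤ)} (hD : LatConvex D) (h0 : (0 : ℤ × ℤ) ∈ D)
    {f : ℤ × ℤ} (hf : Pointed f D) {a b : ℤ × ℤ} (h : SearchInv D a b) {t : ℤ}
    (hmem : a + t • b ∈ D) (hmin : ∀ t', 0 ≤ t' → t' < t → a + t' • b ∉ D) {k : ℤ} (hk : 0 ≤ k)
    (hkmem : (a + t • b) + k • (a + (t - 1) • b) ∈ D)
    (hkmax : (a + t • b) + (k + 1) • (a + (t - 1) • b) ∉ D) :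
    SearchInv D (a + (t - 1) • b) ((a + t • b) + k • (a + (t - 1) • b)) := by
  have hdet := h.det
  have hbne : b ≠ 0 := by
    rintro rfl; simp [cross] at hdet
  -- the first half of the step
  have key : ∀ z ∈ D, cross (a + t • b) z < 0 → 0 < cross (a + (t - 1) • b) z := by
    intro z hz hneg
    have hz' := hz
    rw [decomp hdet z] at hz'
    have hzd := decomp hdet z
    set i := -cross b z with hi
    set j := cross a z with hj
    have e1 : cross (a + t • b) z = j - t * i := by
      simp only [hi, hj, cross]; simp; ring
    have e2 : cross (a + (t - 1) • b) z = j - (t - 1) * i := by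
      simp only [hi, hj, cross]; simp; ring
    rw [e1] at hneg
    rw [e2]
    rcases le_or_gt i 0 with hi0 | hi0
    · exfalso
      -- Here z is not before b but is before a + tb. Then b has positive weight in a vanishing
      -- combination of b, z and a + tb with nonnegative coefficients.
      refine hbne (hf.eq_zero h.mem hz hmem (a := -(j - t * i)) (b := 1) (c := -i) (by omega)
        (by norm_num) (by omega) ?_)
      nth_rewrite 1 [hzd]
      module
    · have hj0 := h.pos z hz (by omega)
      by_contra hcon
      -- If z were not after a + (t-1)b, then j ≤ (t-1) i, and the point at level one would have a
      -- number below t.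
      have h1 := hD.level_one h0 h.mem hi0 hz'
      have h2 : 0 ≤ -((-j) / i) := by
        have : (-j) / i ≤ 0 := Int.ediv_nonpos_of_nonpos_of_neg (by omega) (by omega)
        omega
      refine hmin _ h2 ?_ h1
      have : -t < (-j) / i := by
        have h3 : -(t - 1) ≤ (-j) / i := by
          rw [Int.le_ediv_iff_mul_le hi0]
          linarith
        omega
      omega
  have hdet' : cross (a + (t - 1) • b) (a + t • b) = 1 := by
    simp only [cross] at hdet ⊢; simp; linear_combination hdet
  have hdet'' : cross (a + (t - 1) • b) ((a + t • b) + k • (a + (t - 1) • b)) = 1 := by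
    simp only [cross] at hdet ⊢; simp; linear_combination hdet
  have hb'ne : a + t • b ≠ 0 := by
    intro h0; rw [h0] at hdet'; simp [cross] at hdet'
  generalize hA : a + (t - 1) • b = A at *
  generalize hB : a + t • b = B at *
  refine ⟨hdet'', hkmem, ?_, ?_⟩
  · convert hkmax using 2
    module
  · intro z hz hneg
    have hzd := decomp hdet' z
    by_contra hcon
    have hi : -cross B z ≤ 0 := by
      by_contra hi
      exact hcon (key z hz (by omega))
    set i := -cross B z with hi'
    set j := cross A z with hj'
    have e1 : cross (B + k • A) z = -i + k * j := by
      simp only [hi', hj', cross]; simp; ring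
    rw [e1] at hneg
    have hkpos : 0 < k := by
      rcases hk.lt_or_eq with h1 | h1
      · exact h1
      · exfalso; rw [← h1] at hneg; omega
    -- The same contradiction for the second run: z is not before B but is before B + kA, so B, z
    -- and B + kA have a vanishing combination with positive weight on B.
    refine hb'ne (hf.eq_zero hmem hz hkmem (a := -(-i + k * j)) (b := k) (c := -i) (by omega)
      (by omega) (by omega) ?_)
    conv_lhs => enter [1, 2, 2]; rw [hzd]
    module

/-- A point of D before b would give, by `level_one`, a point a + tb of D with t ≥ 0. The failure of
a single line search thus certifies the direction. -/
theorem SearchInv.final {D : Set (ℤ × ℤ)} (hD : LatConvex D) (h0 : (0 : ℤ × ℤ) ∈ D)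
    {a b : ℤ × ℤ} (h : SearchInv D a b) (hnone : ∀ t : ℤ, 0 ≤ t → a + t • b ∉ D) :
    ∀ z ∈ D, 0 ≤ cross b z := by
  intro z hz
  by_contra hneg
  have hj := h.pos z hz (by omega)
  have hz' := hz
  rw [decomp h.det z] at hz'
  refine hnone _ ?_ (hD.level_one h0 h.mem (by omega) hz')
  have : (-cross a z) / (-cross b z) ≤ 0 :=
    Int.ediv_nonpos_of_nonpos_of_neg (by omega) (by omega)
  omega

/-- Together with `SearchInv.add` this makes the first hit a + tb have t ≥ 2, which is the source of
the geometric progress of the search. -/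
theorem SearchInv.not_mem {D : Set (ℤ × ℤ)} {a b : ℤ × ℤ} (h : SearchInv D a b) : a ∉ D := by
  intro ha
  have := h.pos a ha (by have := h.det; simp only [cross] at this ⊢; linarith)
  simp [cross, mul_comm] at this

/-! ### Edges of the hull of a set of lattice points. -/

/-- The points `p` and `q` of `S` are the ends of an edge of the hull of `S`, which lies to the
left of `p q`. -/
structure IsHullEdge (S : Set (ℤ × ℤ)) (p q : ℤ × ℤ) : Prop where
  left_mem : p ∈ S
  right_mem : q ∈ S
  ne : p ≠ q
  nonneg : ∀ z ∈ S, 0 ≤ cross (q - p) (z - p)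
  between : ∀ z ∈ S, cross (q - p) (z - p) = 0 →
    0 ≤ dot (q - p) (z - p) ∧ dot (q - p) (z - p) ≤ dot (q - p) (q - p)

theorem dot_self_pos {a : ℤ × ℤ} (h : a ≠ 0) : 0 < dot a a := by
  have : a.1 ≠ 0 ∨ a.2 ≠ 0 := by
    by_contra hc
    push Not at hc
    exact h (Prod.ext hc.1 hc.2)
  simp only [dot]
  rcases this with h | h
  · have := mul_self_pos.2 h; have := mul_self_nonneg a.2; omega
  · have := mul_self_pos.2 h; have := mul_self_nonneg a.1; omega

/-- As a member of a basis, b is primitive, so the points of S on the line through p along b are of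
the form p + jb. Pointedness at p excludes j < 0, and lattice convexity excludes j > k because p +
(k+1)b is missing. -/
theorem isHullEdge_of_direction {S : Set (ℤ × ℤ)} (hS : LatConvex S) {p a b f : ℤ × ℤ}
    (hp : p ∈ S) (hf : Pointed f (shift S p)) (hdet : cross a b = 1) (hb : b ∈ shift S p)
    (hleft : ∀ z ∈ shift S p, 0 ≤ cross b z) {k : ℤ} (hk : 0 < k)
    (hkmem : k • b ∈ shift S p) (hkmax : (k + 1) • b ∉ shift S p) :
    IsHullEdge S p (p + k • b) := by
  have hbne : b ≠ 0 := by rintro rfl; simp [cross] at hdet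
  have h0 : (0 : ℤ × ℤ) ∈ shift S p := by simpa [shift] using hp
  have hD := hS.shift p
  have hbb := dot_self_pos hbne
  have hkb : k • b ≠ 0 := smul_ne_zero hk.ne' hbne
  have e1 : ∀ z, cross (k • b) z = k * cross b z := by
    intro z; simp only [cross]; simp; ring
  refine ⟨hp, hkmem, by rw [Ne, left_eq_add]; exact hkb, ?_, ?_⟩
  · intro z hz
    rw [add_sub_cancel_left, e1]
    exact mul_nonneg hk.le (hleft _ (by simpa [shift] using hz))
  · intro z hz hc
    rw [add_sub_cancel_left, e1] at hc
    rw [add_sub_cancel_left]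
    have hz' : z - p ∈ shift S p := by simpa [shift] using hz
    have hc' : cross b (z - p) = 0 := by
      rcases mul_eq_zero.1 hc with h | h
      · omega
      · exact h
    have hzd := decomp hdet (z - p)
    rw [hc'] at hzd
    set j := cross a (z - p)
    have hzj : z - p = j • b := by rw [hzd]; simp
    rw [hzj] at hz' ⊢
    have hj0 : 0 ≤ j := by
      by_contra hj
      refine hbne (hf.eq_zero hb hz' h0 (a := -j) (b := 1) (c := 0) (by omega) (by norm_num)
        le_rfl ?_)
      module
    have hjk : j ≤ k := by
      by_contra hj
      refine hkmax (hD _ hz' _ h0 _ h0 (k + 1) (j - (k + 1)) 0 _ (by omega) (by omega) le_rfl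
        (by omega) ?_)
      simp only [smul_smul, smul_zero, add_zero]
      congr 1
      ring
    have e2 : dot (k • b) (j • b) = k * j * dot b b := by simp only [dot]; simp; ring
    have e3 : dot (k • b) (k • b) = k * k * dot b b := by simp only [dot]; simp; ring
    rw [e2, e3]
    constructor
    · positivity
    · gcongr

/-- The direction of the edge just traversed serves as the functional at its end: the rest of S lies
to the left of it, or back on the edge. No other memory of the walk is needed to continue. -/
theorem IsHullEdge.pointed {S : Set (ℤ × ℤ)} {p b : ℤ × ℤ} {k : ℤ} (hk : 0 < k)
    (h : IsHullEdge S p (p + k • b)) : Pointed b (shift S (p + k • b)) := by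
  intro z hz hz0
  have e1 : cross (k • b) (p + k • b + z - p) = k * cross b z := by
    simp only [cross]; simp; ring
  have e2 : dot (k • b) (p + k • b + z - p) = k * dot b z + dot (k • b) (k • b) := by
    simp only [dot]; simp; ring
  have h1 := h.nonneg _ hz
  have h2 := h.between _ hz
  rw [add_sub_cancel_left] at h1 h2
  rw [e1] at h1 h2
  rw [e2] at h2
  rcases h1.lt_or_eq with h3 | h3
  · exact Or.inl (pos_of_mul_pos_right h3 hk.le)
  · obtain ⟨h4, h5⟩ := h2 h3.symm
    have h6 : cross b z = 0 := by
      rcases mul_eq_zero.1 h3.symm with h | h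
      · omega
      · exact h
    refine Or.inr ⟨h6, ?_⟩
    have h7 : dot b z ≤ 0 := by
      by_contra hc
      push Not at hc
      have := mul_pos hk hc
      omega
    refine lt_of_le_of_ne h7 fun h8 => hz0 ?_
    have hb : b ≠ 0 := by
      rintro rfl
      exact h.ne (by simp)
    have hbb := dot_self_pos hb
    have h9 : dot b b * z.1 = 0 := by
      simp only [dot, cross] at *
      linear_combination b.1 * h8 - b.2 * h6
    have h10 : dot b b * z.2 = 0 := by
      simp only [dot, cross] at *
      linear_combination b.2 * h8 + b.1 * h6
    ext
    · simpa [hbb.ne'] using h9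
    · simpa [hbb.ne'] using h10

/-- The first end of an edge is determined by the second one. -/
theorem IsHullEdge.left_unique {S : Set (ℤ × ℤ)} {p p' q : ℤ × ℤ} (h : IsHullEdge S p q)
    (h' : IsHullEdge S p' q) : p = p' := by
  have a1 := h.nonneg p' h'.left_mem
  have a2 := h'.nonneg p h.left_mem
  have a3 := h.between p' h'.left_mem
  have a4 := h'.between p h.left_mem
  have e : cross (q - p') (p - p') = - cross (q - p) (p' - p) := by
    simp only [cross]; simp; ring
  have c1 : cross (q - p) (p' - p) = 0 := by omega
  obtain ⟨b1, b2⟩ := a3 c1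
  obtain ⟨b3, b4⟩ := a4 (by omega)
  by_contra hne
  have hpos := dot_self_pos (sub_ne_zero.2 hne)
  have hq := dot_self_pos (sub_ne_zero.2 h.ne.symm)
  have f1 : dot (p - p') (p - p') = -(dot (q - p) (p' - p)) + - (dot (q - p') (p - p'))
      + 2 * dot (p - p') (p - p') := by
    simp only [dot]; simp; ring
  have hq' := dot_self_pos (sub_ne_zero.2 h'.ne.symm)
  -- the three points are collinear, and each of `p`, `p'` lies between the other one and `q`
  have f2 : dot (q - p) (p' - p) * dot (q - p') (p - p') ≤ 0 := by
    have : dot (q - p) (p' - p) * dot (q - p') (p - p')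
      = - (dot (q - p) (q - p') * dot (p - p') (p - p')) := by
      have c1' := c1
      simp only [cross, dot] at c1' ⊢
      simp at c1' ⊢
      linear_combination -((q.1 - p.1) * (q.2 - p'.2) - (q.2 - p.2) * (q.1 - p'.1)) * c1'
    rw [this]
    have : dot (q - p) (q - p') = dot (q - p) (q - p) - dot (q - p) (p' - p) := by
      simp only [dot]; simp; ring
    have : 0 ≤ dot (q - p) (q - p') := by omega
    have := mul_nonneg this hpos.le
    omega
  have f3 : dot (q - p) (p' - p) * dot (q - p') (p - p') = 0 :=
    le_antisymm f2 (mul_nonneg b1 b3)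
  rcases mul_eq_zero.1 f3 with f4 | f4
  · have : dot (q - p) (q - p) * dot (p' - p) (p' - p) = 0 := by
      simp only [cross, dot] at c1 f4 ⊢
      linear_combination (((q - p).1 * (p' - p).1 + (q - p).2 * (p' - p).2)) * f4
        + ((q - p).1 * (p' - p).2 - (q - p).2 * (p' - p).1) * c1
    have := mul_pos hq (dot_self_pos (sub_ne_zero.2 (Ne.symm hne)))
    omega
  · have : dot (q - p') (q - p') * dot (p - p') (p - p') = 0 := by
      have c2 : cross (q - p') (p - p') = 0 := by omega
      simp only [cross, dot] at c2 f4 ⊢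
      linear_combination (((q - p').1 * (p - p').1 + (q - p').2 * (p - p').2)) * f4
        + ((q - p').1 * (p - p').2 - (q - p').2 * (p - p').1) * c2
    have := mul_pos hq' hpos
    omega

end LatticeHull

/-! ## The boundary walk around the hull of a set of lattice points -/

namespace LatticeHull

/-- A lattice vector as a point of the Euclidean plane. -/
noncomputable def toPlane (z : ℤ × ℤ) : Plane := !₂[(z.1 : ℝ), (z.2 : ℝ)]

@[simp] theorem toPlane_zero (z : ℤ × ℤ) : toPlane z 0 = z.1 := by simp [toPlane]
@[simp] theorem toPlane_one (z : ℤ × ℤ) : toPlane z 1 = z.2 := by simp [toPlane]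

theorem Plane.ext {x y : Plane} (h0 : x 0 = y 0) (h1 : x 1 = y 1) : x = y := by
  ext i; fin_cases i <;> assumption

theorem toPlane_injective : Function.Injective toPlane := by
  intro x y h
  have h0 := congrArg (fun z : Plane => z 0) h
  have h1 := congrArg (fun z : Plane => z 1) h
  simp at h0 h1
  exact Prod.ext h0 h1

theorem orientation_toPlane (p q r : ℤ × ℤ) :
    orientation (toPlane p) (toPlane q) (toPlane r) = (cross (q - p) (r - p) : ℤ) := by
  simp [orientation, cross]

theorem orientation_rotate (p q r : Plane) : orientation p q r = orientation q r p := by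
  simp only [orientation]; ring

/-- A point on the left of all three sides of a triangle belongs to it. -/
theorem mem_triangle {a b c z : Plane} (h : 0 < orientation a b c) (hab : 0 ≤ orientation a b z)
    (hbc : 0 ≤ orientation b c z) (hca : 0 ≤ orientation c a z) :
    z ∈ convexHull ℝ ({a, b, c} : Set Plane) := by
  have hsum : orientation b c z + orientation c a z + orientation a b z = orientation a b c := by
    simp only [orientation]; ring
  have hz : z = (orientation b c z / orientation a b c) • a
      + (orientation c a z / orientation a b c) • b
      + (orientation a b z / orientation a b c) • c := by
    apply Plane.ext
    · simp; field_simp; simp only [orientation]; ring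
    · simp; field_simp; simp only [orientation]; ring
  have hconv := convex_convexHull ℝ ({a, b, c} : Set Plane)
  rw [hz]
  have := hconv.sum_mem (t := Finset.univ) (w := ![orientation b c z / orientation a b c,
    orientation c a z / orientation a b c, orientation a b z / orientation a b c])
    (z := ![a, b, c]) ?_ ?_ ?_
  · simpa [Fin.sum_univ_three] using this
  · intro i _; fin_cases i <;> simp <;> positivity
  · simp [Fin.sum_univ_three]; field_simp; exact hsum
  · intro i _
    apply subset_convexHull
    fin_cases i <;> simp

/-- With A and B the affine extensions of `cross f` and `dot f` based at p, the set where A > 0, or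
A = 0 and B ≤ 0, is convex and contains the hull. In it p is the only point with A = B = 0, so p is
not inside a segment of the hull. -/
theorem mem_extremePoints_of_pointed {S : Set (ℤ × ℤ)} {p f : ℤ × ℤ} (hp : p ∈ S) (hf0 : f ≠ 0)
    (hf : Pointed f (shift S p)) :
    toPlane p ∈ (convexHull ℝ (toPlane '' S)).extremePoints ℝ := by
  let A : Plane → ℝ := fun z => f.1 * (z 1 - p.2) - f.2 * (z 0 - p.1)
  let B : Plane → ℝ := fun z => f.1 * (z 0 - p.1) + f.2 * (z 1 - p.2)
  have hA : ∀ (x y : Plane) (s t : ℝ), s + t = 1 → A (s • x + t • y) = s * A x + t * A y := by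
    intro x y s t h
    simp only [A]; simp
    linear_combination ((f.1 * p.2 : ℝ) - f.2 * p.1) * h
  have hB : ∀ (x y : Plane) (s t : ℝ), s + t = 1 → B (s • x + t • y) = s * B x + t * B y := by
    intro x y s t h
    simp only [B]; simp
    linear_combination ((f.1 * p.1 : ℝ) + f.2 * p.2) * h
  have hsub : convexHull ℝ (toPlane '' S) ⊆ {z | 0 < A z ∨ (A z = 0 ∧ B z ≤ 0)} := by
    apply convexHull_min
    · rintro _ ⟨z, hz, rfl⟩
      by_cases hzp : z = p
      · subst hzp; right; simp [A, B]
      · have h1 := hf (z - p) (by simpa [shift] using hz) (sub_ne_zero.2 hzp)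
        have e1 : A (toPlane z) = (cross f (z - p) : ℤ) := by simp [A, cross]
        have e2 : B (toPlane z) = (dot f (z - p) : ℤ) := by simp [B, dot]
        simp only [Set.mem_ofPred_eq, e1, e2]
        rcases h1 with h1 | h1
        · left; exact_mod_cast h1
        · right; exact ⟨by exact_mod_cast h1.1, by exact_mod_cast h1.2.le⟩
    · intro x hx y hy s t hs ht hst
      simp only [Set.mem_ofPred_eq] at hx hy ⊢
      rw [hA x y s t hst, hB x y s t hst]
      rcases hs.eq_or_lt with h0 | hs'
      · have : t = 1 := by linarith
        subst this; rw [← h0]; simpa using hy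
      rcases ht.eq_or_lt with h0 | ht'
      · have : s = 1 := by linarith
        subst this; rw [← h0]; simpa using hx
      rcases hx with hx | ⟨hx, hx'⟩
      · left
        have : 0 ≤ A y := by rcases hy with hy | hy <;> linarith
        positivity
      · rcases hy with hy | ⟨hy, hy'⟩
        · left; rw [hx]; simp; positivity
        · right; rw [hx, hy]
          refine ⟨by simp, ?_⟩
          nlinarith
  have hff : (0 : ℝ) < f.1 ^ 2 + f.2 ^ 2 := by
    have := dot_self_pos hf0
    simp only [dot] at this
    have h2 : (0 : ℝ) < ((f.1 * f.1 + f.2 * f.2 : ℤ) : ℝ) := by exact_mod_cast this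
    push_cast at h2
    nlinarith
  have huniq : ∀ z : Plane, A z = 0 → B z = 0 → z = toPlane p := by
    intro z h1 h2
    simp only [A, B] at h1 h2
    apply Plane.ext
    · have : (f.1 ^ 2 + f.2 ^ 2 : ℝ) * (z 0 - p.1) = 0 := by
        linear_combination f.1 * h2 - f.2 * h1
      rcases mul_eq_zero.1 this with h | h
      · exact absurd h hff.ne'
      · simp; linarith
    · have : (f.1 ^ 2 + f.2 ^ 2 : ℝ) * (z 1 - p.2) = 0 := by
        linear_combination f.2 * h2 + f.1 * h1
      rcases mul_eq_zero.1 this with h | h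
      · exact absurd h hff.ne'
      · simp; linarith
  rw [mem_extremePoints]
  refine ⟨subset_convexHull _ _ ⟨p, hp, rfl⟩, ?_⟩
  rintro x hx y hy ⟨s, t, hs, ht, hst, hxy⟩
  have hx' := hsub hx
  have hy' := hsub hy
  simp only [Set.mem_ofPred_eq] at hx' hy'
  have a1 := hA x y s t hst
  have b1 := hB x y s t hst
  rw [hxy] at a1 b1
  have a0 : A (toPlane p) = 0 := by simp [A]
  have b0 : B (toPlane p) = 0 := by simp [B]
  rw [a0] at a1
  rw [b0] at b1
  have hAx : 0 ≤ A x := by rcases hx' with h | h <;> linarith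
  have hAy : 0 ≤ A y := by rcases hy' with h | h <;> linarith
  have p1 := mul_nonneg hs.le hAx
  have p2 := mul_nonneg ht.le hAy
  have hAx0 : A x = 0 := by
    have : s * A x = 0 := by linarith
    simpa [hs.ne'] using this
  have hAy0 : A y = 0 := by
    have : t * A y = 0 := by linarith
    simpa [ht.ne'] using this
  have hBx : B x ≤ 0 := by rcases hx' with h | h <;> linarith
  have hBy : B y ≤ 0 := by rcases hy' with h | h <;> linarith
  have q1 := mul_nonneg hs.le (neg_nonneg.2 hBx)
  have q2 := mul_nonneg ht.le (neg_nonneg.2 hBy)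
  have hBx0 : B x = 0 := by
    have : s * B x = 0 := by linarith
    simpa [hs.ne'] using this
  have hBy0 : B y = 0 := by
    have : t * B y = 0 := by linarith
    simpa [ht.ne'] using this
  exact ⟨huniq x hAx0 hBx0, huniq y hAy0 hBy0⟩

/-- A walk along edges of the hull that has not returned to its start has not met any point
twice. -/
theorem walk_injective {S : Set (ℤ × ℤ)} {p : ℕ → ℤ × ℤ} {m : ℕ}
    (hE : ∀ j, j + 1 < m → IsHullEdge S (p j) (p (j + 1)))
    (hp : ∀ j, 1 ≤ j → j < m → p j ≠ p 0) {i j : ℕ} (hij : i < j) (hj : j < m) : p i ≠ p j := by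
  induction i generalizing j with
  | zero => exact (hp j (by omega) hj).symm
  -- Uniqueness of predecessors pulls a coincidence back along the walk, until it becomes an early
  -- return to `p 0`.
  | succ i ih =>
    intro h
    obtain ⟨j, rfl⟩ : ∃ j', j = j' + 1 := ⟨j - 1, by omega⟩
    have h1 := hE i (by omega)
    have h2 := hE j (by omega)
    rw [← h] at h2
    exact ih (by omega) (by omega) (h1.left_unique h2)

/-- A Plücker relation: among vectors to the left of d, turning left is transitive. -/
theorem cross_pos_trans {d a b c : ℤ × ℤ} (hb : 0 < cross d b) (ha : 0 ≤ cross d a)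
    (hc : 0 < cross d c) (hab : 0 < cross a b) (hbc : 0 ≤ cross b c) : 0 < cross a c := by
  have h : cross a c * cross d b = cross a b * cross d c + cross b c * cross d a := by
    simp only [cross]; ring
  have h1 := mul_pos hab hc
  have h2 := mul_nonneg hbc ha
  exact pos_of_mul_pos_left (by rw [h]; omega) hb.le

/-- If z were on the line of the edge, it would lie between p and q, and the weights of this convex
combination, cleared of denominators, give a vanishing combination of p - z and q - z. Pointedness
at z leaves only z = p or z = q. -/
theorem IsHullEdge.cross_pos {S : Set (ℤ × ℤ)} {p q z f : ℤ × ℤ} (h : IsHullEdge S p q)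
    (hz : z ∈ S) (hf : Pointed f (shift S z)) (hp : z ≠ p) (hq : z ≠ q) :
    0 < cross (q - p) (z - p) := by
  refine lt_of_le_of_ne (h.nonneg z hz) fun h0 => ?_
  obtain ⟨h1, h2⟩ := h.between z hz h0.symm
  have hx : p - z ∈ shift S z := by simpa [shift] using h.left_mem
  have hy : q - z ∈ shift S z := by simpa [shift] using h.right_mem
  have hL := dot_self_pos (sub_ne_zero.2 h.ne.symm)
  have h3 : dot (q - p) (z - p) < dot (q - p) (q - p) := by
    refine lt_of_le_of_ne h2 fun h4 => hq ?_
    have e1 : dot (q - p) (q - p) * (q - z).1 = 0 := by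
      simp only [cross, dot, Prod.fst_sub, Prod.snd_sub] at h0 h4 ⊢
      linear_combination (-(q.1 - p.1)) * h4 - (q.2 - p.2) * h0
    have e2 : dot (q - p) (q - p) * (q - z).2 = 0 := by
      simp only [cross, dot, Prod.fst_sub, Prod.snd_sub] at h0 h4 ⊢
      linear_combination (-(q.2 - p.2)) * h4 + (q.1 - p.1) * h0
    have e3 : (q - z).1 = 0 := by simpa [hL.ne'] using e1
    have e4 : (q - z).2 = 0 := by simpa [hL.ne'] using e2
    exact (sub_eq_zero.1 (Prod.ext e3 e4)).symm
  refine hp (sub_eq_zero.1 (hf.eq_zero hx hy hx (a := dot (q - p) (q - p) - dot (q - p) (z - p))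
    (b := dot (q - p) (z - p)) (c := 0) (by omega) h1 le_rfl ?_)).symm
  simp only [cross, dot] at h0 ⊢
  ext
  · simp at h0 ⊢
    linear_combination (-(q.2 - p.2)) * h0
  · simp at h0 ⊢
    linear_combination (q.1 - p.1) * h0

/-- A closed walk along the edges of the hull lists the vertices of the hull in counterclockwise
order. -/
theorem isVertexList_of_walk {S : Set (ℤ × ℤ)} {p f : ℕ → ℤ × ℤ} {m : ℕ}
    (hE : ∀ j, j < m → IsHullEdge S (p j) (p (j + 1)))
    (hp : ∀ j, 1 ≤ j → j < m → p j ≠ p 0) (hm : 1 ≤ m) (hclosed : p m = p 0)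
    (hf0 : ∀ j, j < m → f j ≠ 0) (hf : ∀ j, j < m → Pointed (f j) (shift S (p j))) :
    IsVertexList (fun i : Fin m => toPlane (p i)) (convexHull ℝ (toPlane '' S)) := by
  have hinj : ∀ {i j : ℕ}, i < j → j < m → p i ≠ p j :=
    fun hij hj => walk_injective (fun j hj => hE j (by omega)) hp hij hj
  have hmem : ∀ j, j < m → p j ∈ S := fun j hj => (hE j hj).left_mem
  -- the points are seen from each of them in counterclockwise order
  have hstep : ∀ i j, i < j → j + 1 < m → 0 < cross (p j - p i) (p (j + 1) - p i) := by
    intro i j hij hj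
    have h1 := (hE j (by omega)).cross_pos (hmem i (by omega)) (hf i (by omega))
      (hinj hij (by omega)) (hinj (by omega) hj)
    have e : cross (p j - p i) (p (j + 1) - p i) = cross (p (j + 1) - p j) (p i - p j) := by
      simp only [cross]; simp; ring
    rwa [e]
  have hfirst : ∀ i k, i + 1 < k → k < m → 0 < cross (p (i + 1) - p i) (p k - p i) := by
    intro i k hik hk
    exact (hE i (by omega)).cross_pos (hmem k hk) (hf k hk) (hinj (by omega) hk).symm
      (hinj hik hk).symm
  -- All later points lie to the left of the edge leaving `p i`, and consecutive ones turn left when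
  -- seen from `p i`. Transitivity then orders them by angle.
  have hccw : ∀ i j k, i < j → j < k → k < m → 0 < cross (p j - p i) (p k - p i) := by
    intro i j k hij hjk hk
    rcases eq_or_lt_of_le (show i + 1 ≤ j from hij) with h1 | h1
    · subst h1; exact hfirst i k hjk hk
    · induction k with
      | zero => omega
      | succ k ih =>
        rcases eq_or_lt_of_le (show j ≤ k by omega) with h2 | h2
        · subst h2; exact hstep i j hij hk
        · exact cross_pos_trans (hfirst i k (by omega) (by omega)) (hfirst i j h1 (by omega)).le
            (hfirst i (k + 1) (by omega) hk) (ih h2 (by omega)) (hstep i k (by omega) hk).le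
  have hm2 : 2 ≤ m := by
    by_contra hcon
    obtain rfl : m = 1 := by omega
    exact (hE 0 (by omega)).ne hclosed.symm
  have hlast : IsHullEdge S (p (m - 1)) (p 0) := by
    have := hE (m - 1) (by omega)
    rwa [show m - 1 + 1 = m by omega, hclosed] at this
  -- the walk encloses all points
  have hcover : ∀ z ∈ S, toPlane z ∈ convexHull ℝ (Set.range fun i : Fin m => toPlane (p i)) := by
    intro z hz
    have hin : ∀ j, j < m → toPlane (p j) ∈ Set.range fun i : Fin m => toPlane (p i) :=
      fun j hj => ⟨⟨j, hj⟩, rfl⟩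
    rcases eq_or_lt_of_le hm2 with h2 | h2
    -- With two vertices the hull is a segment, traversed once in each direction; the two edge
    -- inequalities put all of S on its line.
    · subst h2
      have h1 := hE 0 (by omega)
      have h3 : IsHullEdge S (p 1) (p 0) := hlast
      have e1 : 0 ≤ cross (p 1 - p 0) (z - p 0) := h1.nonneg z hz
      have e2 := h3.nonneg z hz
      have e3 : cross (p 0 - p 1) (z - p 1) = - cross (p 1 - p 0) (z - p 0) := by
        simp only [cross]; simp; ring
      have e4 : cross (p 1 - p 0) (z - p 0) = 0 := by omega
      obtain ⟨e5, e6⟩ := h1.between z hz e4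
      have hL := dot_self_pos (sub_ne_zero.2 h1.ne.symm)
      refine (convex_convexHull ℝ _).segment_subset (subset_convexHull _ _ (hin 0 (by omega)))
        (subset_convexHull _ _ (hin 1 (by omega))) ?_
      have hL' : (0 : ℝ) < (dot (p 1 - p 0) (p 1 - p 0) : ℤ) := by exact_mod_cast hL
      have e5' : (0 : ℝ) ≤ (dot (p 1 - p 0) (z - p 0) : ℤ) := by exact_mod_cast e5
      have e6' : ((dot (p 1 - p 0) (z - p 0) : ℤ) : ℝ) ≤ (dot (p 1 - p 0) (p 1 - p 0) : ℤ) := by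
        exact_mod_cast e6
      refine ⟨1 - (dot (p 1 - p 0) (z - p 0) : ℤ) / (dot (p 1 - p 0) (p 1 - p 0) : ℤ),
        (dot (p 1 - p 0) (z - p 0) : ℤ) / (dot (p 1 - p 0) (p 1 - p 0) : ℤ), ?_, by positivity,
        by ring, ?_⟩
      · rw [sub_nonneg, div_le_one hL']; exact e6'
      · have e4' : ((cross (p 1 - p 0) (z - p 0) : ℤ) : ℝ) = 0 := by exact_mod_cast e4
        apply Plane.ext
        · simp; field_simp
          simp only [dot, cross] at e4' ⊢
          push_cast at e4' ⊢
          simp at e4' ⊢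
          linear_combination ((p 1).2 - (p 0).2 : ℝ) * e4'
        · simp; field_simp
          simp only [dot, cross] at e4' ⊢
          push_cast at e4' ⊢
          simp at e4' ⊢
          linear_combination (-((p 1).1 - (p 0).1 : ℝ)) * e4'
    · -- a triangle of the fan with apex `p 0` contains `z`
      have hfan : ∀ k, k + 2 < m → cross (p (k + 2) - p 0) (z - p 0) ≤ 0 →
          ∃ j, 1 ≤ j ∧ j + 1 < m ∧ 0 ≤ cross (p j - p 0) (z - p 0) ∧
            cross (p (j + 1) - p 0) (z - p 0) ≤ 0 := by
        intro k
        induction k with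
        | zero =>
          intro hk h
          exact ⟨1, le_rfl, hk, (hE 0 (by omega)).nonneg z hz, h⟩
        | succ k ih =>
          intro hk h
          rcases le_total (cross (p (k + 2) - p 0) (z - p 0)) 0 with h4 | h4
          · exact ih (by omega) h4
          · exact ⟨k + 2, by omega, hk, h4, h⟩
      have hend : cross (p (m - 3 + 2) - p 0) (z - p 0) ≤ 0 := by
        have h1 := hlast.nonneg z hz
        rw [show m - 3 + 2 = m - 1 by omega]
        have e : cross (p (m - 1) - p 0) (z - p 0) = - cross (p 0 - p (m - 1)) (z - p (m - 1)) := by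
          simp only [cross]; simp; ring
        omega
      obtain ⟨j, hj1, hjm, hA, hB⟩ := hfan (m - 3) (by omega) hend
      have htri : toPlane z ∈ convexHull ℝ
          ({toPlane (p 0), toPlane (p j), toPlane (p (j + 1))} : Set Plane) := by
        apply mem_triangle
        · rw [orientation_toPlane]
          exact_mod_cast hccw 0 j (j + 1) (by omega) (by omega) hjm
        · rw [orientation_toPlane]; exact_mod_cast hA
        · rw [orientation_toPlane]; exact_mod_cast (hE j (by omega)).nonneg z hz
        · rw [orientation_rotate, orientation_rotate]
          have : orientation (toPlane z) (toPlane (p (j + 1))) (toPlane (p 0))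
            = - orientation (toPlane (p 0)) (toPlane (p (j + 1))) (toPlane z) := by
            simp only [orientation]; ring
          rw [this, orientation_toPlane]
          have : (0 : ℤ) ≤ - cross (p (j + 1) - p 0) (z - p 0) := by omega
          exact_mod_cast this
      refine convexHull_mono ?_ htri
      intro x hx
      simp only [Set.mem_insert_iff, Set.mem_singleton_iff] at hx
      rcases hx with rfl | rfl | rfl
      · exact hin 0 (by omega)
      · exact hin j (by omega)
      · exact hin (j + 1) hjm
  have hhull : convexHull ℝ (toPlane '' S) =
      convexHull ℝ (Set.range fun i : Fin m => toPlane (p i)) := by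
    apply Set.Subset.antisymm
    · apply convexHull_min _ (convex_convexHull ℝ _)
      rintro _ ⟨z, hz, rfl⟩
      exact hcover z hz
    · apply convexHull_mono
      rintro _ ⟨i, rfl⟩
      exact ⟨p i, hmem i i.2, rfl⟩
  refine ⟨?_, ?_, ?_⟩
  · intro i j hij
    have h1 := toPlane_injective hij
    by_contra hne
    rcases lt_or_gt_of_ne (fun h => hne (Fin.ext h) : (i : ℕ) ≠ j) with h2 | h2
    · exact hinj h2 j.2 h1
    · exact hinj h2 i.2 h1.symm
  · apply Set.Subset.antisymm
    · rintro _ ⟨i, rfl⟩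
      exact mem_extremePoints_of_pointed (hmem i i.2) (hf0 i i.2) (hf i i.2)
    · rw [hhull]
      exact extremePoints_convexHull_subset
  · intro i j k hij hjk
    rw [orientation_toPlane]
    exact_mod_cast hccw i j k hij hjk k.2

end LatticeHull

/-! ## Point location in a convex polygon -/

namespace LatticeHull

open RealRAM

/-- Vertex number `i` of the polygon, for a natural number `i`. -/
noncomputable def vertex {n : ℕ} (v : Fin n → Plane) (i : ℕ) : Plane :=
  !₂[(inputState v).arr 0 i, (inputState v).arr 1 i]

theorem vertex_eq {n : ℕ} (v : Fin n → Plane) {i : ℕ} (h : i < n) : vertex v i = v ⟨i, h⟩ := by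
  apply Plane.ext <;> simp [vertex, inputState, h]

theorem vertex_mem {n : ℕ} (v : Fin n → Plane) {i : ℕ} (h : i < n) : vertex v i ∈ polygon v := by
  rw [vertex_eq v h]
  exact subset_convexHull _ _ ⟨_, rfl⟩

theorem convex_orientation_nonneg (a b : Plane) : Convex ℝ {z | 0 ≤ orientation a b z} := by
  intro x hx y hy s t hs ht hst
  simp only [Set.mem_ofPred_eq] at hx hy ⊢
  have e : orientation a b (s • x + t • y) = s * orientation a b x + t * orientation a b y := by
    simp only [orientation]; simp
    linear_combination ((b 0 - a 0) * a 1 - (b 1 - a 1) * a 0) * hst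
  rw [e]
  positivity

/-- The numbers `i`, `j` are those of the ends of an edge of an `n`-gon. -/
def IsEdge (n i j : ℕ) : Prop := (j = i + 1 ∧ j < n) ∨ (i = n - 1 ∧ j = 0)

theorem IsEdge.nonneg {n : ℕ} {v : Fin n → Plane} (hn : 3 ≤ n) (hv : IsCounterclockwise v)
    {i j : ℕ} (h : IsEdge n i j) {z : Plane} (hz : z ∈ polygon v) :
    0 ≤ orientation (vertex v i) (vertex v j) z := by
  refine convexHull_min ?_ (convex_orientation_nonneg _ _) hz
  rintro _ ⟨k, rfl⟩
  have hdeg : ∀ a b : Plane, orientation a b a = 0 ∧ orientation a b b = 0 := by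
    intro a b; simp only [orientation]; constructor <;> ring
  rw [Set.mem_ofPred_eq]
  rcases h with ⟨rfl, hj⟩ | ⟨rfl, rfl⟩
  · rw [vertex_eq v hj, vertex_eq v (show i < n by omega)]
    rcases lt_trichotomy (k : ℕ) i with h1 | h1 | h1
    · rw [← orientation_rotate]
      exact (hv _ _ _ (Fin.mk_lt_mk.2 h1) (by simp)).le
    · rw [show k = ⟨i, by omega⟩ from Fin.ext h1, (hdeg _ _).1]
    · rcases eq_or_lt_of_le (show i + 1 ≤ k from h1) with h2 | h2
      · rw [show k = ⟨i + 1, hj⟩ from Fin.ext h2.symm, (hdeg _ _).2]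
      · exact (hv _ _ _ (by simp) (Fin.mk_lt_mk.2 h2)).le
  · rw [vertex_eq v (show n - 1 < n by omega), vertex_eq v (show 0 < n by omega)]
    rcases Nat.eq_zero_or_pos (k : ℕ) with h1 | h1
    · rw [show k = ⟨0, by omega⟩ from Fin.ext h1, (hdeg _ _).2]
    · rcases eq_or_lt_of_le (show (k : ℕ) ≤ n - 1 by omega) with h2 | h2
      · rw [show k = ⟨n - 1, by omega⟩ from Fin.ext h2, (hdeg _ _).1]
      · rw [orientation_rotate]
        exact (hv _ _ _ (Fin.mk_lt_mk.2 h1) (Fin.mk_lt_mk.2 h2)).le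

/-- The store holds the polygon `v`: register `1` holds the number of vertices. -/
structure HoldsPolygon {n : ℕ} (v : Fin n → Plane) (s : State) : Prop where
  num : s.reg 1 = n
  xs : s.arr 0 = (inputState v).arr 0
  ys : s.arr 1 = (inputState v).arr 1

/-- An expression for `orientation (vertex v i) (vertex v j) q`, where `q` is the point in the
registers `50`, `51`. -/
def orientationExpr (i j : Expr) : Expr :=
  (.read 0 j - .read 0 i) * (.reg 51 - .read 1 i) - (.read 1 j - .read 1 i) * (.reg 50 - .read 0 i)

theorem eval_orientationExpr {n : ℕ} {v : Fin n → Plane} {s : State} (hs : HoldsPolygon v s)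
    {i j : Expr} {a b : ℕ} (hi : ⌊i.eval s⌋₊ = a) (hj : ⌊j.eval s⌋₊ = b) :
    (orientationExpr i j).eval s =
      orientation (vertex v a) (vertex v b) !₂[s.reg 50, s.reg 51] := by
  simp [orientationExpr, orientation, vertex, hs.xs, hs.ys, hi, hj]

/-- The binary search for the triangle of the fan with apex `vertex v 0` that may contain `q`. -/
def fanStep : Program :=
  .assign 62 (.floor ((.reg 60 + .reg 61) / .const 2)) ;;
  .ite (.le (.const 0) (orientationExpr (.const 0) (.reg 62)))
    (.assign 60 (.reg 62)) (.assign 61 (.reg 62))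

def fanStart : Program :=
  .assign 60 (.const 1) ;; .assign 61 (.reg 1 - .const 1)

def fanEnd : Program :=
  .ite (.lt (orientationExpr (.const 0) (.const 1)) (.const 0))
    (.assign 63 (.const 0) ;; .assign 64 (.const 1) ;; .assign 65 (.const 1))
    (.ite (.lt (orientationExpr (.reg 1 - .const 1) (.const 0)) (.const 0))
      (.assign 63 (.reg 1 - .const 1) ;; .assign 64 (.const 0) ;; .assign 65 (.const 1))
      (.ite (.lt (orientationExpr (.reg 60) (.reg 61)) (.const 0))
        (.assign 63 (.reg 60) ;; .assign 64 (.reg 61) ;; .assign 65 (.const 1))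
        (.assign 63 (.const 0) ;; .assign 64 (.const 1) ;; .assign 65 (.const 0)))) ;;
  .assign 66 ((.read 0 (.reg 64) - .read 0 (.reg 63)) * .reg 53
    - (.read 1 (.reg 64) - .read 1 (.reg 63)) * .reg 52)

/-- Point location: register `65` is set to `0` if the point in the registers `50`, `51` belongs
to the polygon, and to `1` otherwise. In the second case the point violates the inequality of an
edge, and register `66` is set to the slope of this inequality in the direction in the registers
`52`, `53`. -/
def locate : Program :=
  fanStart ;; .loop (.lt (.reg 60 + .const 1) (.reg 61)) fanStep ;; fanEnd

theorem floor_half (a b : ℕ) : ((⌊((a : ℝ) + b) / 2⌋ : ℤ) : ℝ) = ((a + b) / 2 : ℕ) := by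
  have : ⌊((a : ℝ) + b) / 2⌋ = (((a + b) / 2 : ℕ) : ℤ) := by
    rw [Int.floor_eq_iff]
    have h1 : 2 * ((a + b) / 2) ≤ a + b := Nat.mul_div_le _ _
    have h2 : a + b < 2 * ((a + b) / 2) + 2 := by omega
    have h1' : (2 : ℝ) * ((a + b) / 2 : ℕ) ≤ a + b := by exact_mod_cast h1
    have h2' : (a : ℝ) + b < 2 * ((a + b) / 2 : ℕ) + 2 := by exact_mod_cast h2
    constructor
    · rw [Int.cast_natCast]; linarith
    · rw [Int.cast_natCast]; linarith
  rw [this, Int.cast_natCast]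

/-- The depth of a binary search in the polygon. -/
def depth (n : ℕ) : ℕ := Nat.log 2 n + 1

theorem HoldsPolygon.mono {n : ℕ} {v : Fin n → Plane} {s s' : State} {k : ℕ} (hk : 1 < k)
    (hs : HoldsPolygon v s) (h : (∀ r < k, s'.reg r = s.reg r) ∧ s'.arr = s.arr) :
    HoldsPolygon v s' :=
  ⟨(h.1 1 hk).trans hs.num, by rw [h.2, hs.xs], by rw [h.2, hs.ys]⟩

/-- The bisection keeps q to the left of the ray from vertex 0 to vertex `lo`, and to the right of
the ray to vertex `hi`. The initial exceptions `lo = 1` and `hi = n - 1` concern rays along edges,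
which are tested at the end. If neither these two edges nor the edge from `lo` to `hi` is violated,
q lies in a triangle of the fan; otherwise the violated edge supplies the inequality. -/
theorem runs_locate {n : ℕ} {v : Fin n → Plane} (hn : 3 ≤ n) (hv : IsCounterclockwise v)
    {s : State} (hs : HoldsPolygon v s) :
    ∃ t s', Runs locate s t s' ∧ (t : ℝ) ≤ 200 * depth n ∧
      ((s'.reg 65 = 0 ∧ !₂[s.reg 50, s.reg 51] ∈ polygon v) ∨
       (s'.reg 65 = 1 ∧ ∃ A B C : ℝ, (∀ z ∈ polygon v, 0 ≤ A * z 0 + B * z 1 + C) ∧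
          A * s.reg 50 + B * s.reg 51 + C < 0 ∧
          s'.reg 66 = A * s.reg 52 + B * s.reg 53)) := by
  set q : Plane := !₂[s.reg 50, s.reg 51] with hq
  obtain ⟨t1, s1, r1, ht1, e1⟩ := Program.runs_block (p := fanStart) 6 s (by decide) (by decide)
  have f1 := r1.frame (k := 60) (by decide)
  let I : ℕ → State → Prop := fun k σ => ∃ lo hi : ℕ, σ.reg 60 = lo ∧ σ.reg 61 = hi ∧ 1 ≤ lo ∧
    lo < hi ∧ hi ≤ n - 1 ∧ hi - lo ≤ 2 ^ k ∧
    (lo = 1 ∨ 0 ≤ orientation (vertex v 0) (vertex v lo) q) ∧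
    (hi = n - 1 ∨ orientation (vertex v 0) (vertex v hi) q < 0) ∧
    ((∀ r < 60, σ.reg r = s.reg r) ∧ σ.arr = s.arr)
  have hI1 : I (depth n) s1 := by
    refine ⟨1, n - 1, ?_, ?_, le_rfl, by omega, le_rfl, ?_, Or.inl rfl, Or.inl rfl, f1⟩
    · rw [e1]; simp [fanStart, Program.exec]
    · rw [e1]; simp [fanStart, Program.exec, hs.num]
      rw [Nat.cast_sub (by omega)]; simp
    · have := Nat.lt_pow_succ_log_self (b := 2) (by norm_num) n
      rw [depth]; omega
  obtain ⟨t2, s2, k2, r2, hI2, hb2, ht2⟩ := Runs.loop_count (b := .lt (.reg 60 + .const 1) (.reg 61))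
    (p := fanStep) 6 (by decide) I 45 (by norm_num) (fun k σ hI hb => by
      obtain ⟨lo, hi, h60, h61, hlo, hlt, hhi, hk, hlo', hhi', hfr⟩ := hI
      have hb' : lo + 1 < hi := by
        simp [h60, h61] at hb
        exact_mod_cast hb
      obtain ⟨t, σ', r, ht, e⟩ := Program.runs_block (p := fanStep) 45 σ (by decide) (by decide)
      have hfr' := r.frame (k := 60) (by decide)
      have hpoly := hs.mono (by norm_num) hfr
      have hmid : ((lo : ℝ) + hi) / 2 = (lo + hi) / 2 := rfl
      obtain ⟨k, rfl⟩ : ∃ k', k = k' + 1 := by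
        cases k with
        | zero => simp at hk; omega
        | succ k => exact ⟨k, rfl⟩
      rw [pow_succ] at hk
      set mid := (lo + hi) / 2 with hmid
      have hor : (orientationExpr (.const 0) (.reg 62)).eval (σ.setReg 62 mid)
          = orientation (vertex v 0) (vertex v mid) q := by
        rw [eval_orientationExpr (v := v) (a := 0) (b := mid)]
        · simp [hfr.1 50, hfr.1 51, hq]
        · exact ⟨by simp [hpoly.num], by simp [hpoly.xs], by simp [hpoly.ys]⟩
        · simp
        · simp
      refine ⟨t, σ', k, r, ?_, by omega, by exact_mod_cast ht⟩
      have hfr'' : (∀ r < 60, σ'.reg r = s.reg r) ∧ σ'.arr = s.arr :=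
        ⟨fun r hr => (hfr'.1 r hr).trans (hfr.1 r hr), hfr'.2.trans hfr.2⟩
      by_cases hc : 0 ≤ orientation (vertex v 0) (vertex v mid) q
      · refine ⟨mid, hi, ?_, ?_, by omega, by omega, hhi, by omega, Or.inr hc, hhi', hfr''⟩
        · rw [e]; simp [fanStep, Program.exec, h60, h61, floor_half, ← hmid, hor, hc]
        · rw [e]; simp [fanStep, Program.exec, h60, h61, floor_half, ← hmid, hor, hc]
      · refine ⟨lo, mid, ?_, ?_, hlo, by omega, by omega, by omega, hlo', Or.inr (by simpa using hc),
          hfr''⟩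
        · rw [e]; simp [fanStep, Program.exec, h60, h61, floor_half, ← hmid, hor, hc]
        · rw [e]; simp [fanStep, Program.exec, h60, h61, floor_half, ← hmid, hor, hc]) hI1
  obtain ⟨lo, hi, h60, h61, hlo, hlt, hhi, -, hlo', hhi', hfr⟩ := hI2
  have hpoly := hs.mono (by norm_num) hfr
  obtain ⟨t3, s3, r3, ht3, e3⟩ := Program.runs_block (p := fanEnd) 120 s2 (by decide) (by decide)
  have hhi1 : hi = lo + 1 := by
    have : ¬ (lo + 1 < hi) := by
      intro h
      apply hb2
      simp [h60, h61]
      exact_mod_cast h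
    omega
  refine ⟨_, s3, .seq r1 (.seq r2 r3), ?_, ?_⟩
  · have hd : (1 : ℝ) ≤ depth n := by simp [depth]
    have ht1' : (t1 : ℝ) ≤ 6 := by exact_mod_cast ht1
    have ht3' : (t3 : ℝ) ≤ 120 := by exact_mod_cast ht3
    push_cast at ht2 ⊢
    linarith
  · have h50 := hfr.1 50 (by norm_num)
    have h51 := hfr.1 51 (by norm_num)
    have h52 := hfr.1 52 (by norm_num)
    have h53 := hfr.1 53 (by norm_num)
    have o1 : (orientationExpr (.const 0) (.const 1)).eval s2
        = orientation (vertex v 0) (vertex v 1) q := by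
      rw [eval_orientationExpr hpoly (a := 0) (b := 1) (by simp) (by simp), h50, h51]
    have o2 : (orientationExpr (.reg 1 - .const 1) (.const 0)).eval s2
        = orientation (vertex v (n - 1)) (vertex v 0) q := by
      rw [eval_orientationExpr hpoly (a := n - 1) (b := 0) (by simp [hpoly.num]) (by simp), h50, h51]
    have o3 : (orientationExpr (.reg 60) (.reg 61)).eval s2
        = orientation (vertex v lo) (vertex v hi) q := by
      rw [eval_orientationExpr hpoly (a := lo) (b := hi) (by simp [h60]) (by simp [h61]), h50, h51]
    -- a violated edge gives a violated linear inequality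
    have edge : ∀ i j, IsEdge n i j → orientation (vertex v i) (vertex v j) q < 0 →
        s3.reg 66 = (s2.arr 0 j - s2.arr 0 i) * s2.reg 53 - (s2.arr 1 j - s2.arr 1 i) * s2.reg 52 →
        ∃ A B C : ℝ, (∀ z ∈ polygon v, 0 ≤ A * z 0 + B * z 1 + C) ∧
          A * s.reg 50 + B * s.reg 51 + C < 0 ∧ s3.reg 66 = A * s.reg 52 + B * s.reg 53 := by
      intro i j hij hneg h66
      refine ⟨-(vertex v j 1 - vertex v i 1), vertex v j 0 - vertex v i 0,
        (vertex v j 1 - vertex v i 1) * vertex v i 0 - (vertex v j 0 - vertex v i 0) * vertex v i 1,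
        ?_, ?_, ?_⟩
      · intro z hz
        have := hij.nonneg hn hv hz
        simp only [orientation] at this
        linarith
      · simp [orientation, hq] at hneg
        linarith
      · rw [h66, hpoly.xs, hpoly.ys, h52, h53]
        simp [vertex]
        ring
    by_cases c1 : orientation (vertex v 0) (vertex v 1) q < 0
    · right
      refine ⟨by rw [e3]; simp [fanEnd, Program.exec, o1, c1],
        edge 0 1 (Or.inl ⟨rfl, by omega⟩) c1 ?_⟩
      rw [e3]; simp [fanEnd, Program.exec, o1, c1]
    by_cases c2 : orientation (vertex v (n - 1)) (vertex v 0) q < 0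
    · right
      refine ⟨by rw [e3]; simp [fanEnd, Program.exec, o1, o2, c1, c2],
        edge (n - 1) 0 (Or.inr ⟨rfl, rfl⟩) c2 ?_⟩
      rw [e3]; simp [fanEnd, Program.exec, o1, o2, c1, c2, hpoly.num]
    by_cases c3 : orientation (vertex v lo) (vertex v hi) q < 0
    · right
      refine ⟨by rw [e3]; simp [fanEnd, Program.exec, o1, o2, o3, c1, c2, c3],
        edge lo hi (Or.inl ⟨hhi1, by omega⟩) c3 ?_⟩
      rw [e3]; simp [fanEnd, Program.exec, o1, o2, o3, c1, c2, c3, h60, h61]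
    · left
      refine ⟨by rw [e3]; simp [fanEnd, Program.exec, o1, o2, o3, c1, c2, c3], ?_⟩
      have d1 : 0 ≤ orientation (vertex v 0) (vertex v lo) q := by
        rcases hlo' with h | h
        · rw [h]; linarith
        · exact h
      have d2 : 0 ≤ orientation (vertex v hi) (vertex v 0) q := by
        rcases hhi' with h | h
        · rw [h]; linarith
        · have : orientation (vertex v hi) (vertex v 0) q
              = - orientation (vertex v 0) (vertex v hi) q := by
            simp only [orientation]; ring
          linarith
      have hpos : 0 < orientation (vertex v 0) (vertex v lo) (vertex v hi) := by
        rw [vertex_eq v (show 0 < n by omega), vertex_eq v (show lo < n by omega),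
          vertex_eq v (show hi < n by omega)]
        exact hv _ _ _ (Fin.mk_lt_mk.2 hlo) (Fin.mk_lt_mk.2 hlt)
      have htri := mem_triangle hpos d1 (not_lt.1 c3) d2
      refine convexHull_min ?_ (convex_convexHull ℝ _) htri
      intro x hx
      simp only [Set.mem_insert_iff, Set.mem_singleton_iff] at hx
      rcases hx with rfl | rfl | rfl
      · exact vertex_mem v (by omega)
      · exact vertex_mem v (by omega)
      · exact vertex_mem v (by omega)

theorem above_locate : locate.Above 60 = true := by decide

end LatticeHull

/-! ## Exponential search along a lattice line -/

namespace LatticeHull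

open RealRAM

/-- The stores `s` and `s'` agree in the registers below `k` and in all arrays. -/
def Agree (k : ℕ) (s s' : State) : Prop := (∀ r < k, s'.reg r = s.reg r) ∧ s'.arr = s.arr

theorem Agree.refl (k : ℕ) (s : State) : Agree k s s := ⟨fun _ _ => rfl, rfl⟩

theorem Agree.trans {k k' : ℕ} {s s' s'' : State} (h : Agree k s s') (h' : Agree k' s' s'')
    (hk : k ≤ k') : Agree k s s'' :=
  ⟨fun r hr => (h'.1 r (by omega)).trans (h.1 r hr), h'.2.trans h.2⟩

theorem Agree.mono {k k' : ℕ} {s s' : State} (h : Agree k' s s') (hk : k ≤ k') : Agree k s s' :=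
  ⟨fun r hr => h.1 r (by omega), h.2⟩

theorem _root_.RealRAM.Runs.agree {p : Program} {s s' : State} {t : ℕ} (h : Runs p s t s')
    (k : ℕ) (hk : p.Above k = true) : Agree k s s' := h.frame hk

/-- The point in the registers `40`, `41` plus `t` times the vector in the registers `42`, `43`. -/
noncomputable def linePoint (s : State) (t : ℝ) : Plane :=
  !₂[s.reg 40 + t * s.reg 42, s.reg 41 + t * s.reg 43]

/-- Locate the point number `t` of the line, where `t` is the content of register `44`. -/
def probe : Program :=
  (.assign 50 (.reg 40 + .reg 44 * .reg 42) ;; .assign 51 (.reg 41 + .reg 44 * .reg 43) ;;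
    .assign 52 (.reg 42) ;; .assign 53 (.reg 43)) ;; locate

/-- Set register `48` to `1` if `b` holds after a probe, and to `0` otherwise. -/
def test (b : Cond) : Program :=
  probe ;; .ite b (.assign 48 (.const 1)) (.assign 48 (.const 0))

/-- Exponential and binary search for a positive number at which the test succeeds while it fails
at the preceding number. -/
def search (b : Cond) : Program :=
  .assign 44 (.const 1) ;; test b ;;
  .loop (.eq (.reg 48) (.const 0)) (.assign 44 (.reg 44 * .const 2) ;; test b) ;;
  (.assign 46 (.reg 44) ;; .assign 47 (.floor (.reg 44 / .const 2))) ;;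
  .loop (.lt (.reg 47 + .const 1) (.reg 46))
    (.assign 44 (.floor ((.reg 47 + .reg 46) / .const 2)) ;; test b ;;
      .ite (.eq (.reg 48) (.const 1)) (.assign 46 (.reg 44)) (.assign 47 (.reg 44)))

/-- The linear inequality `0 ≤ A x + B y + C` holds in the polygon, the point number `t` of the line
violates it, and `m` is its slope along the line. -/
def Violated {n : ℕ} (v : Fin n → Plane) (s : State) (t m : ℝ) : Prop :=
  ∃ A B C : ℝ, (∀ z ∈ polygon v, 0 ≤ A * z 0 + B * z 1 + C) ∧
    A * (s.reg 40 + t * s.reg 42) + B * (s.reg 41 + t * s.reg 43) + C < 0 ∧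
    m = A * s.reg 42 + B * s.reg 43

theorem Violated.not_mem {n : ℕ} {v : Fin n → Plane} {s : State} {t m : ℝ}
    (h : Violated v s t m) : linePoint s t ∉ polygon v := by
  obtain ⟨A, B, C, h1, h2, -⟩ := h
  intro h3
  have := h1 _ h3
  simp [linePoint] at this
  linarith

/-- The sign of the slope tells on which side of t the polygon meets the line, if it meets it at
all. This is what directs the search from points outside the polygon. -/
theorem Violated.lt {n : ℕ} {v : Fin n → Plane} {s : State} {t t' m : ℝ}
    (h : Violated v s t m) (h' : linePoint s t' ∈ polygon v) : 0 < m * (t' - t) := by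
  obtain ⟨A, B, C, h1, h2, h3⟩ := h
  have := h1 _ h'
  simp [linePoint] at this
  rw [h3]
  linarith

theorem above_probe : probe.Above 50 = true := by decide

theorem above_test (b : Cond) : (test b).Above 48 = true := by
  simp [test, Program.Above, show probe.Above 48 = true by decide]

theorem above_search (b : Cond) : (search b).Above 44 = true := by
  simp [search, Program.Above, test, show probe.Above 44 = true by decide]

variable {n : ℕ} {v : Fin n → Plane}

theorem runs_probe (hn : 3 ≤ n) (hv : IsCounterclockwise v) {s : State}
    (hs : HoldsPolygon v s) :
    ∃ t s', Runs probe s t s' ∧ (t : ℝ) ≤ 220 * depth n ∧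
      s'.reg 50 = s.reg 40 + s.reg 44 * s.reg 42 ∧ s'.reg 51 = s.reg 41 + s.reg 44 * s.reg 43 ∧
      ((s'.reg 65 = 0 ∧ linePoint s (s.reg 44) ∈ polygon v) ∨
       (s'.reg 65 = 1 ∧ Violated v s (s.reg 44) (s'.reg 66))) := by
  obtain ⟨t1, s1, r1, ht1, e1⟩ := Program.runs_block (p :=
    .assign 50 (.reg 40 + .reg 44 * .reg 42) ;; .assign 51 (.reg 41 + .reg 44 * .reg 43) ;;
    .assign 52 (.reg 42) ;; .assign 53 (.reg 43)) 20 s (by decide) (by decide)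
  have f1 := r1.agree 50 (by decide)
  have hs1 : HoldsPolygon v s1 := hs.mono (by norm_num) f1
  obtain ⟨t2, s2, r2, ht2, h2⟩ := runs_locate hn hv hs1
  have f2 := r2.agree 60 above_locate
  have h50 : s1.reg 50 = s.reg 40 + s.reg 44 * s.reg 42 := by rw [e1]; simp [Program.exec]
  have h51 : s1.reg 51 = s.reg 41 + s.reg 44 * s.reg 43 := by rw [e1]; simp [Program.exec]
  have h52 : s1.reg 52 = s.reg 42 := by rw [e1]; simp [Program.exec]
  have h53 : s1.reg 53 = s.reg 43 := by rw [e1]; simp [Program.exec]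
  rw [h50, h51, h52, h53] at h2
  have hd : (1 : ℝ) ≤ depth n := by simp [depth]
  have ht1' : (t1 : ℝ) ≤ 20 := by exact_mod_cast ht1
  refine ⟨_, s2, .seq r1 r2, by push_cast; linarith, ?_, ?_, h2⟩
  · rw [f2.1 50 (by norm_num), h50]
  · rw [f2.1 51 (by norm_num), h51]

theorem linePoint_congr {s s' : State} {k : ℕ} (hk : 44 ≤ k) (h : Agree k s s') (t : ℝ) :
    linePoint s' t = linePoint s t := by
  simp [linePoint, h.1 40 (by omega), h.1 41 (by omega), h.1 42 (by omega), h.1 43 (by omega)]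

theorem Violated.congr {s s' : State} {k : ℕ} (hk : 44 ≤ k) (h : Agree k s s') {t m : ℝ}
    (hv : Violated v s' t m) : Violated v s t m := by
  simpa [Violated, h.1 40 (by omega), h.1 41 (by omega), h.1 42 (by omega), h.1 43 (by omega)]
    using hv

/-- The search, for a test whose success at `t` implies `Y t`, and whose failure implies `N t`. -/
theorem runs_search {b : Cond} (Y N : ℕ → Prop) (T : ℝ) {s : State} (B : ℕ)
    (htest : ∀ σ, Agree 44 s σ → ∀ t : ℕ, σ.reg 44 = t → ∃ tm σ', Runs (test b) σ tm σ' ∧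
      (tm : ℝ) ≤ T ∧ ((σ'.reg 48 = 1 ∧ Y t) ∨ (σ'.reg 48 = 0 ∧ N t)))
    (hN : ∀ t, N t → t < B) :
    ∃ tm s' r, Runs (search b) s tm s' ∧ s'.reg 46 = (r : ℕ) ∧ 1 ≤ r ∧ Y r ∧
      (r = 1 ∨ N (r - 1)) ∧ (tm : ℝ) ≤ (2 * Nat.log 2 r + 3) * (T + 30) := by
  have hb48 := above_test b
  obtain ⟨t1, s1, r1, ht1, e1⟩ := Program.runs_block (p := .assign 44 (.const 1)) 2 s
    (by decide) (by decide)
  have f1 := r1.agree 44 (by decide)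
  obtain ⟨t2, s2, r2, ht2, h2⟩ := htest s1 f1 1 (by rw [e1]; simp [Program.exec])
  have f2 := r2.agree 48 hb48
  have hT : 0 ≤ T := le_trans (Nat.cast_nonneg _) ht2
  -- doubling
  let I : ℕ → State → Prop := fun k σ => Agree 44 s σ ∧ σ.reg 44 = ((2 ^ k : ℕ) : ℝ) ∧
    ((σ.reg 48 = 1 ∧ Y (2 ^ k)) ∨ (σ.reg 48 = 0 ∧ N (2 ^ k))) ∧ (k = 0 ∨ N (2 ^ (k - 1)))
  have hI2 : I 0 s2 := by
    refine ⟨f1.trans f2 (by norm_num), ?_, by simpa using h2, Or.inl rfl⟩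
    rw [f2.1 44 (by norm_num), e1]; simp [Program.exec]
  obtain ⟨t3, s3, k, r3, -, hI3, hb3, ht3⟩ := Runs.loop_up (b := .eq (.reg 48) (.const 0))
    (p := .assign 44 (.reg 44 * .const 2) ;; test b) 8 (by decide) I (4 + T) B
    (fun k σ hI hb => by
      obtain ⟨g1, g2, g3, g4⟩ := hI
      simp at hb
      have hNk : N (2 ^ k) := by
        rcases g3 with g3 | g3
        · rw [g3.1] at hb; norm_num at hb
        · exact g3.2
      refine ⟨lt_of_lt_of_le Nat.lt_two_pow_self (hN _ hNk).le, ?_⟩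
      obtain ⟨u1, σ1, q1, hu1, d1⟩ := Program.runs_block (p := .assign 44 (.reg 44 * .const 2)) 4 σ
        (by decide) (by decide)
      have k1 := g1.trans (q1.agree 44 (by decide)) le_rfl
      have hσ1 : σ1.reg 44 = ((2 ^ (k + 1) : ℕ) : ℝ) := by
        rw [d1]; simp [Program.exec, g2, pow_succ]
      obtain ⟨u2, σ2, q2, hu2, d2⟩ := htest σ1 k1 _ hσ1
      have k2 := q2.agree 48 hb48
      have hu1' : (u1 : ℝ) ≤ 4 := by exact_mod_cast hu1
      exact ⟨_, σ2, .seq q1 q2, ⟨k1.trans k2 (by norm_num), by rw [k2.1 44 (by norm_num), hσ1],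
        d2, Or.inr hNk⟩, by push_cast; linarith⟩) hI2
  obtain ⟨f3, g44, gY, gN⟩ := hI3
  have hYk : Y (2 ^ k) := by
    rcases gY with h | h
    · exact h.2
    · exact absurd (by simp [h.1]) hb3
  obtain ⟨t4, s4, r4, ht4, e4⟩ := Program.runs_block (p :=
    .assign 46 (.reg 44) ;; .assign 47 (.floor (.reg 44 / .const 2))) 7 s3 (by decide) (by decide)
  have f4 := f3.trans (r4.agree 44 (by decide)) le_rfl
  -- bisection
  let J : ℕ → State → Prop := fun j σ => ∃ lo hi : ℕ, Agree 44 s σ ∧ σ.reg 47 = lo ∧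
    σ.reg 46 = hi ∧ lo < hi ∧ hi - lo ≤ 2 ^ j ∧ Y hi ∧
    ((k = 0 ∧ lo = 0 ∧ hi = 1) ∨ (N lo ∧ 2 ^ (k - 1) ≤ lo))
  have hJ4 : J k s4 := by
    refine ⟨2 ^ k / 2, 2 ^ k, f4, ?_, ?_, Nat.div_lt_self (by positivity) (by norm_num),
      Nat.sub_le _ _, hYk, ?_⟩
    · have := floor_half (2 ^ k) 0
      simp only [Nat.cast_zero, add_zero] at this
      rw [e4]; simpa [Program.exec, g44] using this
    · rw [e4]; simp [Program.exec, g44]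
    · rcases Nat.eq_zero_or_pos k with h | h
      · left; subst h; simp
      -- For k ≥ 1 the bisection starts from the preceding power of two, at which the test has
      -- failed. No monotonicity of the test is assumed: success at `hi` and failure at `lo` are all
      -- that is preserved.
      · right
        obtain ⟨k, rfl⟩ : ∃ k', k = k' + 1 := ⟨k - 1, by omega⟩
        have : 2 ^ (k + 1) / 2 = 2 ^ k := by rw [pow_succ]; simp
        rw [this]
        exact ⟨by simpa using gN, le_rfl⟩
  obtain ⟨t5, s5, k5, r5, hJ5, hb5, ht5⟩ := Runs.loop_count (b := .lt (.reg 47 + .const 1) (.reg 46))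
    (p := .assign 44 (.floor ((.reg 47 + .reg 46) / .const 2)) ;; test b ;;
      .ite (.eq (.reg 48) (.const 1)) (.assign 46 (.reg 44)) (.assign 47 (.reg 44)))
    6 (by decide) J (T + 20) (by linarith) (fun j σ hJ hb => by
      obtain ⟨lo, hi, g1, g2, g3, g4, g5, g6, g7⟩ := hJ
      have hb' : lo + 1 < hi := by
        simp [g2, g3] at hb
        exact_mod_cast hb
      obtain ⟨j, rfl⟩ : ∃ j', j = j' + 1 := by
        cases j with
        | zero => simp at g5; omega
        | succ j => exact ⟨j, rfl⟩
      rw [pow_succ] at g5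
      have g7' : N lo ∧ 2 ^ (k - 1) ≤ lo := by
        rcases g7 with h | h
        · omega
        · exact h
      obtain ⟨u1, σ1, q1, hu1, d1⟩ := Program.runs_block
        (p := .assign 44 (.floor ((.reg 47 + .reg 46) / .const 2))) 7 σ (by decide) (by decide)
      have k1 := q1.agree 44 (by decide)
      have k1' := g1.trans k1 le_rfl
      have hσ1 : σ1.reg 44 = ((lo + hi) / 2 : ℕ) := by
        rw [d1]; simp [Program.exec, g2, g3, floor_half]
      have h46 : σ1.reg 46 = hi := by rw [d1]; simp [Program.exec, g3]
      have h47 : σ1.reg 47 = lo := by rw [d1]; simp [Program.exec, g2]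
      obtain ⟨u2, σ2, q2, hu2, d2⟩ := htest σ1 k1' _ hσ1
      have k2 := q2.agree 48 hb48
      obtain ⟨u3, σ3, q3, hu3, d3⟩ := Program.runs_block
        (p := .ite (.eq (.reg 48) (.const 1)) (.assign 46 (.reg 44)) (.assign 47 (.reg 44))) 10 σ2
        (by decide) (by decide)
      have k3 := (k1'.trans k2 (by norm_num)).trans (q3.agree 44 (by decide)) le_rfl
      have hu1' : (u1 : ℝ) ≤ 7 := by exact_mod_cast hu1
      have hu3' : (u3 : ℝ) ≤ 10 := by exact_mod_cast hu3
      refine ⟨_, σ3, j, .seq q1 (.seq q2 q3), ?_, by omega, by push_cast; linarith⟩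
      rcases d2 with ⟨d2, hY⟩ | ⟨d2, hN⟩
      · refine ⟨lo, (lo + hi) / 2, k3, ?_, ?_, by omega, by omega, hY, Or.inr g7'⟩
        · rw [d3]; simp [Program.exec, d2, k2.1 47, h47]
        · rw [d3]; simp [Program.exec, d2, k2.1 44, hσ1]
      · refine ⟨(lo + hi) / 2, hi, k3, ?_, ?_, by omega, by omega, g6, Or.inr ⟨hN, by omega⟩⟩
        · rw [d3]; simp [Program.exec, d2, k2.1 44, hσ1]
        · rw [d3]; simp [Program.exec, d2, k2.1 46, h46]) hJ4
  obtain ⟨lo, hi, f5, g47, g46, hlt, -, hY, hlo⟩ := hJ5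
  have hhi : hi = lo + 1 := by
    have : ¬ (lo + 1 < hi) := by
      intro h
      apply hb5
      simp [g47, g46]
      exact_mod_cast h
    omega
  refine ⟨_, s5, hi, .seq r1 (.seq r2 (.seq r3 (.seq r4 r5))), g46, by omega, hY, ?_, ?_⟩
  · rcases hlo with h | h
    · left; exact h.2.2
    · right; rw [hhi]; exact h.1
  -- The last failed power 2^(k-1) stays below the result, so the time is logarithmic in the result
  -- itself and not in an a priori bound. The amortization over a whole Stern-Brocot search depends
  -- on this.
  · have hk : k ≤ Nat.log 2 hi + 1 := by
      rcases hlo with h | h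
      · omega
      · have : 2 ^ (k - 1) ≤ hi := by omega
        have := Nat.le_log_of_pow_le (by norm_num) this
        omega
    have hk' : (k : ℝ) ≤ Nat.log 2 hi + 1 := by exact_mod_cast hk
    have ht1' : (t1 : ℝ) ≤ 2 := by exact_mod_cast ht1
    have ht4' : (t4 : ℝ) ≤ 7 := by exact_mod_cast ht4
    have hlog : (0 : ℝ) ≤ Nat.log 2 hi := Nat.cast_nonneg _
    push_cast at ht3 ht5 ⊢
    have e3 : (k : ℝ) * (T + 30) ≤ (Nat.log 2 hi + 1) * (T + 30) := by gcongr
    nlinarith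

/-! ### The first and the last lattice point of a line in the polygon. -/

/-- The condition that stops the search for the first lattice point of a line. -/
def stopFirst : Cond :=
  .not (.and (.eq (.reg 65) (.const 1)) (.and (.lt (.const 0) (.reg 66)) (.lt (.reg 44) (.reg 2))))

/-- Search for the first lattice point of a line in the polygon. If there is one, register `65` is
set to `0`, register `46` to its number, and the registers `50`, `51` to its coordinates. -/
def findFirst : Program := search stopFirst ;; .assign 44 (.reg 46) ;; probe

/-- The condition that stops the search for the last lattice point of a line. -/
def stopLast : Cond := .eq (.reg 65) (.const 1)

/-- Search for the last lattice point of a line in the polygon; register `46` is set to the number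
after it. -/
def findLast : Program := search stopLast

theorem above_findFirst : findFirst.Above 44 = true := by decide
theorem above_findLast : findLast.Above 44 = true := by decide

theorem runs_findLast (hn : 3 ≤ n) (hv : IsCounterclockwise v) {s : State}
    (hs : HoldsPolygon v s) (h0 : linePoint s 0 ∈ polygon v) (B : ℕ)
    (hB : ∀ t : ℕ, linePoint s t ∈ polygon v → t < B) :
    ∃ tm s', ∃ k : ℕ, Runs findLast s tm s' ∧ s'.reg 46 = k + 1 ∧ linePoint s k ∈ polygon v ∧
      linePoint s (k + 1 : ℕ) ∉ polygon v ∧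
      (tm : ℝ) ≤ 1000 * depth n * (Nat.log 2 (k + 1) + 1) := by
  have hd : (1 : ℝ) ≤ depth n := by simp [depth]
  obtain ⟨tm, s', r, hr, h46, hr1, hY, hN, ht⟩ := runs_search (b := stopLast)
    (fun t => linePoint s t ∉ polygon v) (fun t => linePoint s t ∈ polygon v)
    (230 * depth n) B (s := s) (fun σ hσ t h44 => by
      obtain ⟨u1, σ1, q1, hu1, -, -, d1⟩ := runs_probe hn hv (hs.mono (k := 44) (by norm_num) hσ)
      obtain ⟨u2, σ2, q2, hu2, d2⟩ := Program.runs_block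
        (p := .ite stopLast (.assign 48 (.const 1)) (.assign 48 (.const 0))) 10 σ1
        (by decide) (by decide)
      have hu2' : (u2 : ℝ) ≤ 10 := by exact_mod_cast hu2
      refine ⟨_, σ2, .seq q1 q2, by push_cast; linarith, ?_⟩
      rw [h44] at d1
      rcases d1 with ⟨h65, h⟩ | ⟨h65, h⟩
      · right
        refine ⟨by rw [d2]; simp [Program.exec, stopLast, h65], ?_⟩
        rwa [linePoint_congr le_rfl hσ] at h
      · left
        exact ⟨by rw [d2]; simp [Program.exec, stopLast, h65],
          (h.congr le_rfl hσ).not_mem⟩) hB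
  obtain ⟨k, rfl⟩ : ∃ k, r = k + 1 := ⟨r - 1, by omega⟩
  refine ⟨tm, s', k, hr, by rw [h46]; push_cast; rfl, ?_, hY, ?_⟩
  · rcases hN with h | h
    · obtain rfl : k = 0 := by omega
      simpa using h0
    · exact h
  · have hlog : (0 : ℝ) ≤ Nat.log 2 (k + 1) := Nat.cast_nonneg _
    nlinarith

/-- A failed probe with positive slope shows that the polygon can only lie ahead, so no point of it
precedes the index r at which the search stops; one more probe decides about r. If r is outside, the
points beyond it are excluded by a nonpositive slope at r or by the cap. The hypothesis 2 ≤ t covers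
r = 1, where no failure at a preceding index is known. -/
theorem runs_findFirst (hn : 3 ≤ n) (hv : IsCounterclockwise v) {s : State}
    (hs : HoldsPolygon v s) (hcap : 1 ≤ s.reg 2)
    (h : ∀ t : ℕ, linePoint s t ∈ polygon v → 2 ≤ t ∧ (t : ℝ) ≤ s.reg 2) :
    ∃ tm s', Runs findFirst s tm s' ∧
      ((∃ t : ℕ, s'.reg 65 = 0 ∧ s'.reg 46 = t ∧ s'.reg 50 = linePoint s t 0 ∧
          s'.reg 51 = linePoint s t 1 ∧ linePoint s t ∈ polygon v ∧
          (∀ t' : ℕ, t' < t → linePoint s t' ∉ polygon v) ∧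
          (tm : ℝ) ≤ 2000 * depth n * (Nat.log 2 t + 1)) ∨
        (s'.reg 65 = 1 ∧ (∀ t : ℕ, linePoint s t ∉ polygon v) ∧
          (tm : ℝ) ≤ 2000 * depth n * (Nat.log 2 ⌈s.reg 2⌉₊ + 1))) := by
  have hd : (1 : ℝ) ≤ depth n := by simp [depth]
  obtain ⟨t1, s1, r, r1, h46, hr1, hY, hN, ht1⟩ := runs_search (b := stopFirst)
    (fun t => linePoint s t ∈ polygon v ∨ s.reg 2 ≤ t ∨ ∃ m ≤ 0, Violated v s t m)
    (fun t => t < s.reg 2 ∧ ∃ m > 0, Violated v s t m)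
    (250 * depth n) ⌈s.reg 2⌉₊ (s := s) (fun σ hσ t h44 => by
      obtain ⟨u1, σ1, q1, hu1, -, -, d1⟩ := runs_probe hn hv (hs.mono (k := 44) (by norm_num) hσ)
      obtain ⟨u2, σ2, q2, hu2, d2⟩ := Program.runs_block
        (p := .ite stopFirst (.assign 48 (.const 1)) (.assign 48 (.const 0))) 30 σ1
        (by decide) (by decide)
      have hu2' : (u2 : ℝ) ≤ 30 := by exact_mod_cast hu2
      have a1 := q1.agree 50 above_probe
      have h44' : σ1.reg 44 = t := by rw [a1.1 44 (by norm_num), h44]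
      have h2 : σ1.reg 2 = s.reg 2 := by rw [a1.1 2 (by norm_num), hσ.1 2 (by norm_num)]
      refine ⟨_, σ2, .seq q1 q2, by push_cast; linarith, ?_⟩
      rw [h44] at d1
      rcases d1 with ⟨h65, h⟩ | ⟨h65, h⟩
      · left
        refine ⟨by rw [d2]; simp [Program.exec, stopFirst, h65], Or.inl ?_⟩
        rwa [linePoint_congr le_rfl hσ] at h
      · have h' := h.congr le_rfl hσ
        by_cases c1 : 0 < σ1.reg 66
        · by_cases c2 : (t : ℝ) < s.reg 2
          · right
            exact ⟨by rw [d2]; simp [Program.exec, stopFirst, h65, c1, h44', h2, c2], c2, _, c1, h'⟩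
          · left
            exact ⟨by rw [d2]; simp [Program.exec, stopFirst, h65, c1, h44', h2, c2],
              Or.inr (Or.inl (not_lt.1 c2))⟩
        · left
          exact ⟨by rw [d2]; simp [Program.exec, stopFirst, h65, c1],
              Or.inr (Or.inr ⟨_, not_lt.1 c1, h'⟩)⟩) (fun t ht => Nat.lt_ceil.2 ht.1)
  have a1 := r1.agree 44 (above_search _)
  obtain ⟨t2, s2, r2, ht2, e2⟩ := Program.runs_block (p := .assign 44 (.reg 46)) 2 s1
    (by decide) (by decide)
  have a2 := a1.trans (r2.agree 44 (by decide)) le_rfl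
  obtain ⟨t3, s3, r3, ht3, h50, h51, h3⟩ := runs_probe hn hv (hs.mono (k := 44) (by norm_num) a2)
  have a3 := r3.agree 50 above_probe
  have h44 : s2.reg 44 = r := by rw [e2]; simp [Program.exec, h46]
  have h46' : s3.reg 46 = r := by rw [a3.1 46 (by norm_num), e2]; simp [Program.exec, h46]
  have ht2' : (t2 : ℝ) ≤ 2 := by exact_mod_cast ht2
  have hlog : (0 : ℝ) ≤ Nat.log 2 r := Nat.cast_nonneg _
  have htime : ((t1 + (t2 + t3) : ℕ) : ℝ) ≤ 2000 * depth n * (Nat.log 2 r + 1) := by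
    push_cast
    nlinarith
  -- the search does not pass a point of the polygon
  have hpast : ∀ t : ℕ, linePoint s t ∈ polygon v → r ≤ t := by
    intro t ht
    by_contra hlt
    have h2 := (h t ht).1
    obtain ⟨-, m, hm, hviol⟩ := hN.resolve_left (by omega)
    have h4 := hviol.lt ht
    have h5 : (t : ℝ) ≤ (r - 1 : ℕ) := by exact_mod_cast (show t ≤ r - 1 by omega)
    nlinarith
  refine ⟨_, s3, .seq r1 (.seq r2 r3), ?_⟩
  rw [h44] at h3 h50 h51
  rcases h3 with ⟨h65, h4⟩ | ⟨h65, h4⟩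
  · left
    rw [linePoint_congr le_rfl a2] at h4
    refine ⟨r, h65, h46', ?_, ?_, h4, fun t' ht' h5 => by have := hpast t' h5; omega, htime⟩
    · rw [h50]
      simp [linePoint, a2.1]
    · rw [h51]
      simp [linePoint, a2.1]
  · right
    have h4' := (h4.congr le_rfl a2)
    refine ⟨h65, fun t ht => ?_, htime.trans ?_⟩
    · have h5 := hpast t ht
      have hne : r ≠ t := by
        rintro rfl
        exact h4'.not_mem ht
      have h6 : r < t := by omega
      have h6' : (r : ℝ) < t := by exact_mod_cast h6
      rcases hY with hY | hY | ⟨m, hm, hY⟩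
      · exact h4'.not_mem hY
      · have := (h t ht).2
        linarith
      · have := hY.lt ht
        nlinarith
    · have hr : r ≤ ⌈s.reg 2⌉₊ := by
        rcases hN with h | h
        · rw [h]; exact Nat.one_le_ceil_iff.2 (by linarith)
        · have : r - 1 < ⌈s.reg 2⌉₊ := Nat.lt_ceil.2 h.1
          omega
      have : (Nat.log 2 r : ℝ) ≤ Nat.log 2 ⌈s.reg 2⌉₊ := by
        exact_mod_cast Nat.log_mono_right hr
      gcongr

end LatticeHull

/-! ## From a vertex of the hull to the next one -/

namespace LatticeHull

open RealRAM

/-- The lattice points of the polygon. -/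
def latticePoints {n : ℕ} (v : Fin n → Plane) : Set (ℤ × ℤ) := {z | toPlane z ∈ polygon v}

variable {n : ℕ} {v : Fin n → Plane}

theorem latConvex_latticePoints : LatConvex (latticePoints v) := by
  intro x hx y hy z hz a b c w ha hb hc habc hw
  have hconv : Convex ℝ (polygon v) := convex_convexHull ℝ _
  have hpos : (0 : ℝ) < a + b + c := by exact_mod_cast habc
  have ha' : (0 : ℝ) ≤ a := by exact_mod_cast ha
  have hb' : (0 : ℝ) ≤ b := by exact_mod_cast hb
  have hc' : (0 : ℝ) ≤ c := by exact_mod_cast hc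
  have := hconv.sum_mem (t := Finset.univ) (w := ![(a : ℝ) / (a + b + c), b / (a + b + c),
    c / (a + b + c)]) (z := ![toPlane x, toPlane y, toPlane z]) ?_ ?_ ?_
  · have e : toPlane w = ((a : ℝ) / (a + b + c)) • toPlane x + ((b : ℝ) / (a + b + c)) • toPlane y
        + ((c : ℝ) / (a + b + c)) • toPlane z := by
      have h1 := congrArg Prod.fst hw
      have h2 := congrArg Prod.snd hw
      simp at h1 h2
      have h1' : ((a : ℝ) + b + c) * w.1 = a * x.1 + b * y.1 + c * z.1 := by exact_mod_cast h1
      have h2' : ((a : ℝ) + b + c) * w.2 = a * x.2 + b * y.2 + c * z.2 := by exact_mod_cast h2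
      apply Plane.ext
      · simp; field_simp; linear_combination h1'
      · simp; field_simp; linear_combination h2'
    show toPlane w ∈ polygon v
    rw [e]
    simpa [Fin.sum_univ_three] using this
  · intro i _; fin_cases i <;> simp <;> positivity
  · simp [Fin.sum_univ_three]; field_simp
  · intro i _; fin_cases i
    · exact hx
    · exact hy
    · exact hz

/-- The registers `r`, `r + 1` hold the lattice vector `z`. -/
def HasVec (s : State) (r : ℕ) (z : ℤ × ℤ) : Prop := s.reg r = z.1 ∧ s.reg (r + 1) = z.2

theorem HasVec.congr {s s' : State} {k r : ℕ} {z : ℤ × ℤ} (h : HasVec s r z) (hs : Agree k s s')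
    (hr : r + 1 < k) : HasVec s' r z :=
  ⟨(hs.1 r (by omega)).trans h.1, (hs.1 (r + 1) hr).trans h.2⟩

theorem linePoint_eq {s : State} {o w : ℤ × ℤ} (ho : HasVec s 40 o) (hw : HasVec s 42 w) (t : ℕ) :
    linePoint s t = toPlane (o + (t : ℤ) • w) := by
  obtain ⟨h1, h2⟩ := ho
  obtain ⟨h3, h4⟩ := hw
  norm_num at h2 h4
  apply Plane.ext <;> simp [linePoint, h1, h2, h3, h4]

theorem linePoint_mem {s : State} {o w : ℤ × ℤ} (ho : HasVec s 40 o) (hw : HasVec s 42 w) (t : ℕ) :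
    linePoint s t ∈ polygon v ↔ o + (t : ℤ) • w ∈ latticePoints v := by
  rw [linePoint_eq ho hw]; rfl

/-- The number of steps of a search among lattice points. -/
noncomputable def searchDepth (cap : ℝ) : ℕ := Nat.log 2 ⌈cap⌉₊ + 1

/-- One round of the search for the clockwise-most direction. -/
def searchRound : Program :=
  (.assign 40 (.reg 20 + .reg 26) ;; .assign 41 (.reg 21 + .reg 27) ;;
    .assign 42 (.reg 28) ;; .assign 43 (.reg 29)) ;;
  findFirst ;;
  .ite (.eq (.reg 65) (.const 0))
    ((.assign 26 (.reg 26 + (.reg 46 - .const 1) * .reg 28) ;;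
      .assign 27 (.reg 27 + (.reg 46 - .const 1) * .reg 29) ;;
      .assign 28 (.reg 26 + .reg 28) ;; .assign 29 (.reg 27 + .reg 29) ;;
      .assign 40 (.reg 20 + .reg 28) ;; .assign 41 (.reg 21 + .reg 29) ;;
      .assign 42 (.reg 26) ;; .assign 43 (.reg 27)) ;;
     findLast ;;
     (.assign 28 (.reg 28 + (.reg 46 - .const 1) * .reg 26) ;;
      .assign 29 (.reg 29 + (.reg 46 - .const 1) * .reg 27)))
    (.assign 30 (.const 0))

theorem natLog_le_logb {t : ℕ} : (Nat.log 2 t : ℝ) ≤ Real.logb 2 t := by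
  exact_mod_cast Real.natLog_le_logb t 2

/-- With c = t + k(t-1) one has t(k+1) ≤ 2c ≤ c². The functional `cross g` of b grows at least by
the factor c in a round, while t and k+1 are the results of its two exponential searches; so the
round costs O(log c) probes. -/
theorem log_add_log_le {t k : ℕ} (ht : 2 ≤ t) :
    1 ≤ Real.logb 2 (t + k * (t - 1)) ∧
    (Nat.log 2 t : ℝ) + Nat.log 2 (k + 1) ≤ 2 * Real.logb 2 (t + k * (t - 1)) := by
  have h2t : (2 : ℝ) ≤ t := by exact_mod_cast ht
  have hk0 : (0 : ℝ) ≤ k := k.cast_nonneg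
  set c : ℝ := t + k * (t - 1) with hc
  have hc2 : 2 ≤ c := by nlinarith
  have hcc : (t : ℝ) * (k + 1) ≤ c ^ 2 := by
    have h3 : (t : ℝ) * (k + 1) ≤ 2 * c := by rw [hc]; nlinarith
    nlinarith
  constructor
  · rw [Real.le_logb_iff_rpow_le (by norm_num) (by linarith)]; simpa using hc2
  · have h4 := natLog_le_logb (t := t)
    have h5 := natLog_le_logb (t := k + 1)
    have h6 : Real.logb 2 t + Real.logb 2 (k + 1 : ℕ) = Real.logb 2 (t * (k + 1)) := by
      push_cast
      rw [Real.logb_mul (by positivity) (by positivity)]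
    have h7 : Real.logb 2 (t * (k + 1)) ≤ Real.logb 2 (c ^ 2) :=
      Real.logb_le_logb_of_le (by norm_num) (by positivity) hcc
    rw [Real.logb_pow] at h7
    push_cast at h7
    linarith

set_option maxHeartbeats 1000000 in
theorem runs_searchRound (hn : 3 ≤ n) (hv : IsCounterclockwise v) {s : State}
    (hs : HoldsPolygon v s) {p a b f g : ℤ × ℤ} (hp : p ∈ latticePoints v)
    (hf : Pointed f (shift (latticePoints v) p)) (hsp : HasVec s 20 p) (hsa : HasVec s 26 a)
    (hsb : HasVec s 28 b) (hinv : SearchInv (shift (latticePoints v) p) a b)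
    (hga : 1 ≤ cross g a) (hgb : 1 ≤ cross g b)
    (hcap : ∀ z ∈ shift (latticePoints v) p, (cross g z : ℝ) ≤ s.reg 2) :
    ∃ tm s', Runs searchRound s tm s' ∧ Agree 26 s s' ∧
      ((∃ a' b', ∃ c : ℝ, HasVec s' 26 a' ∧ HasVec s' 28 b' ∧ s'.reg 30 = s.reg 30 ∧
          SearchInv (shift (latticePoints v) p) a' b' ∧ 1 ≤ cross g a' ∧ 2 ≤ c ∧
          c * cross g b ≤ cross g b' ∧ (tm : ℝ) ≤ 12000 * depth n * Real.logb 2 c) ∨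
        (HasVec s' 26 a ∧ HasVec s' 28 b ∧ s'.reg 30 = 0 ∧
          (∀ t : ℤ, 0 ≤ t → a + t • b ∉ shift (latticePoints v) p) ∧
          (tm : ℝ) ≤ 3000 * depth n * searchDepth (s.reg 2))) := by
  have hd : (1 : ℝ) ≤ depth n := by simp [depth]
  have hD : LatConvex (shift (latticePoints v) p) := latConvex_latticePoints.shift p
  have h0 : (0 : ℤ × ℤ) ∈ shift (latticePoints v) p := by simpa [shift] using hp
  have hcap1 : 1 ≤ s.reg 2 := le_trans (by exact_mod_cast hgb) (hcap b hinv.mem)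
  have gadd : ∀ x y : ℤ × ℤ, ∀ k : ℤ, cross g (x + k • y) = cross g x + k * cross g y := by
    intro x y k; simp only [cross]; simp; ring
  obtain ⟨t1, s1, r1, ht1, e1⟩ := Program.runs_block (p := .assign 40 (.reg 20 + .reg 26) ;;
    .assign 41 (.reg 21 + .reg 27) ;; .assign 42 (.reg 28) ;; .assign 43 (.reg 29)) 20 s
    (by decide) (by decide)
  have f1 := r1.agree 40 (by decide)
  have hs1 := hs.mono (by norm_num) f1
  have ho1 : HasVec s1 40 (p + a) := by
    obtain ⟨x1, x2⟩ := hsp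
    obtain ⟨y1, y2⟩ := hsa
    norm_num at x2 y2
    constructor <;> rw [e1] <;> simp [Program.exec, *]
  have hw1 : HasVec s1 42 b := by
    obtain ⟨y1, y2⟩ := hsb
    norm_num at y2
    constructor <;> rw [e1] <;> simp [Program.exec, *]
  have h12 : s1.reg 2 = s.reg 2 := f1.1 2 (by norm_num)
  have hline : ∀ t : ℕ, linePoint s1 t ∈ polygon v ↔
      a + (t : ℤ) • b ∈ shift (latticePoints v) p := by
    intro t
    rw [linePoint_mem ho1 hw1, add_assoc]; rfl
  have hlarge : ∀ t : ℕ, linePoint s1 t ∈ polygon v → 2 ≤ t ∧ (t : ℝ) ≤ s1.reg 2 := by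
    intro t ht
    rw [hline] at ht
    refine ⟨?_, ?_⟩
    · by_contra hlt
      rcases (by omega : t = 0 ∨ t = 1) with rfl | rfl
      · exact hinv.not_mem (by simpa using ht)
      · exact hinv.add (by simpa using ht)
    · rw [h12]
      refine le_trans ?_ (hcap _ ht)
      rw [gadd]
      have : (t : ℤ) ≤ cross g a + t * cross g b := by nlinarith
      exact_mod_cast this
  obtain ⟨t2, s2, r2, h2⟩ := runs_findFirst hn hv hs1 (by rw [h12]; exact hcap1) hlarge
  have f2 := f1.trans (r2.agree 44 above_findFirst) (by norm_num)
  have hsp2 := hsp.congr f2 (by norm_num)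
  have hsa2 := hsa.congr f2 (by norm_num)
  have hsb2 := hsb.congr f2 (by norm_num)
  have ht1' : (t1 : ℝ) ≤ 20 := by exact_mod_cast ht1
  have hcost : ((Cond.eq (.reg 65) (.const 0)).cost : ℝ) = 7 := by
    have : (Cond.eq (.reg 65) (.const 0)).cost = 7 := by decide
    rw [this]; norm_num
  rcases h2 with ⟨t, h65, h46, -, -, hmem, hmin, ht2⟩ | ⟨h65, hnone, ht2⟩
  · -- a lattice point is found at level one
    have ht := (hlarge t hmem).1
    rw [hline] at hmem
    obtain ⟨t3, s3, r3, ht3, e3⟩ := Program.runs_block (p :=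
      .assign 26 (.reg 26 + (.reg 46 - .const 1) * .reg 28) ;;
      .assign 27 (.reg 27 + (.reg 46 - .const 1) * .reg 29) ;;
      .assign 28 (.reg 26 + .reg 28) ;; .assign 29 (.reg 27 + .reg 29) ;;
      .assign 40 (.reg 20 + .reg 28) ;; .assign 41 (.reg 21 + .reg 29) ;;
      .assign 42 (.reg 26) ;; .assign 43 (.reg 27)) 50 s2
      (by decide) (by decide)
    set A := a + ((t : ℤ) - 1) • b with hA
    set B := a + (t : ℤ) • b with hB
    have hBA : B = A + b := by rw [hA, hB]; module
    obtain ⟨x1, x2⟩ := hsp2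
    obtain ⟨y1, y2⟩ := hsa2
    obtain ⟨z1, z2⟩ := hsb2
    norm_num at x2 y2 z2
    have hs3A : HasVec s3 26 A := by
      constructor <;> rw [e3] <;> simp [Program.exec, h46, y1, y2, z1, z2, hA]
    have hs3B : HasVec s3 28 B := by
      constructor <;> rw [e3, hBA] <;> simp [Program.exec, h46, y1, y2, z1, z2, hA]
    have hs3o : HasVec s3 40 (p + B) := by
      constructor <;> rw [e3, hBA] <;> simp [Program.exec, h46, x1, x2, y1, y2, z1, z2, hA]
    have hs3w : HasVec s3 42 A := by
      constructor <;> rw [e3] <;> simp [Program.exec, h46, y1, y2, z1, z2, hA]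
    have h330 : s3.reg 30 = s.reg 30 := by
      rw [e3]; simp [Program.exec]; exact f2.1 30 (by norm_num)
    have f3 := (f2.mono (by norm_num)).trans (r3.agree 26 (by decide)) le_rfl
    have hline3 : ∀ k : ℕ, linePoint s3 k ∈ polygon v ↔
        B + (k : ℤ) • A ∈ shift (latticePoints v) p := by
      intro k
      rw [linePoint_mem hs3o hs3w, add_assoc]; rfl
    have hNA : 1 ≤ cross g A := by
      rw [hA, gadd]; nlinarith
    have hNB : 1 ≤ cross g B := by
      rw [hB, gadd]; nlinarith
    obtain ⟨t4, s4, k, r4, h46', hk, hk1, ht4⟩ := runs_findLast hn hv (hs.mono (by norm_num) f3)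
      (by have := (hline3 0).2 (by simpa using hmem); simpa using this) (⌈s.reg 2⌉₊ + 1)
      (fun k hk => by
        rw [hline3] at hk
        have h5 := hcap _ hk
        rw [gadd] at h5
        have : (k : ℤ) ≤ cross g B + k * cross g A := by nlinarith
        have h6 : (k : ℝ) ≤ s.reg 2 := le_trans (by exact_mod_cast this) h5
        have : k ≤ ⌈s.reg 2⌉₊ := by exact_mod_cast h6.trans (Nat.le_ceil _)
        omega)
    rw [hline3] at hk hk1
    have a4 := r4.agree 44 above_findLast
    have hs4A := hs3A.congr a4 (by norm_num)
    have hs4B := hs3B.congr a4 (by norm_num)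
    obtain ⟨t5, s5, r5, ht5, e5⟩ := Program.runs_block (p :=
      .assign 28 (.reg 28 + (.reg 46 - .const 1) * .reg 26) ;;
      .assign 29 (.reg 29 + (.reg 46 - .const 1) * .reg 27)) 20 s4
      (by decide) (by decide)
    refine ⟨_, s5, .seq r1 (.seq r2 (.ite_true (by simp [h65]) (.seq r3 (.seq r4 r5)))),
      (f3.trans a4 (by norm_num)).trans (r5.agree 26 (by decide)) le_rfl, Or.inl
        ⟨A, B + (k : ℤ) • A, t + k * (t - 1), ?_, ?_, ?_, ?_, hNA, ?_, ?_, ?_⟩⟩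
    · obtain ⟨x1, x2⟩ := hs4A
      norm_num at x2
      constructor <;> rw [e5] <;> simp [Program.exec, x1, x2]
    · obtain ⟨x1, x2⟩ := hs4A
      obtain ⟨y1, y2⟩ := hs4B
      norm_num at x2 y2
      constructor <;> rw [e5] <;> simp [Program.exec, x1, x2, y1, y2, h46']
    · rw [e5]; simp [Program.exec]; rw [a4.1 30 (by norm_num), h330]
    · refine hinv.step hD h0 hf hmem (fun t' ht0 ht' => ?_) (by positivity) hk
        (by push_cast at hk1; exact hk1)
      obtain ⟨t', rfl⟩ := Int.eq_ofNat_of_zero_le ht0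
      have := hmin t' (by omega)
      rwa [hline] at this
    · have h2t : (2 : ℝ) ≤ t := by exact_mod_cast ht
      have : (0 : ℝ) ≤ k := k.cast_nonneg
      nlinarith
    -- In B + kA the coefficient of b is t + k(t-1), and that of a is positive.
    · rw [gadd, hA, hB, gadd, gadd]
      push_cast
      have h2t : (2 : ℝ) ≤ t := by exact_mod_cast ht
      have hk0 : (0 : ℝ) ≤ k := k.cast_nonneg
      have hga' : (1 : ℝ) ≤ cross g a := by exact_mod_cast hga
      nlinarith
    · obtain ⟨l1, l2⟩ := log_add_log_le (k := k) ht
      set c : ℝ := t + k * (t - 1) with hc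
      have ht3' : (t3 : ℝ) ≤ 50 := by exact_mod_cast ht3
      have ht5' : (t5 : ℝ) ≤ 20 := by exact_mod_cast ht5
      have l3 : (0 : ℝ) ≤ Nat.log 2 t := Nat.cast_nonneg _
      have l4 : (0 : ℝ) ≤ Nat.log 2 (k + 1) := Nat.cast_nonneg _
      push_cast
      rw [hcost]
      have m1 : (depth n : ℝ) * (Nat.log 2 t + Nat.log 2 (k + 1)) ≤
          depth n * (2 * Real.logb 2 c) := by gcongr
      have m2 : (depth n : ℝ) * 1 ≤ depth n * Real.logb 2 c := by gcongr
      have m3 : 0 ≤ (depth n : ℝ) * Nat.log 2 t := by positivity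
      have m4 : 0 ≤ (depth n : ℝ) * Nat.log 2 (k + 1) := by positivity
      linarith
  · obtain ⟨t3, s3, r3, ht3, e3⟩ := Program.runs_block (p := .assign 30 (.const 0)) 2 s2
      (by decide) (by decide)
    refine ⟨_, s3, .seq r1 (.seq r2 (.ite_false (by simp [h65]) r3)), ?_, Or.inr
      ⟨?_, ?_, ?_, ?_, ?_⟩⟩
    · exact (f2.mono (by norm_num)).trans (r3.agree 26 (by decide)) le_rfl
    · rw [e3]; exact ⟨by simpa [Program.exec] using hsa2.1, by simpa [Program.exec] using hsa2.2⟩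
    · rw [e3]; exact ⟨by simpa [Program.exec] using hsb2.1, by simpa [Program.exec] using hsb2.2⟩
    · rw [e3]; simp [Program.exec]
    -- The empty line certifies that the search is over. Only this round is charged with a logarithm
    -- of the cap, since it makes no progress that could pay for it.
    · intro t ht
      obtain ⟨t, rfl⟩ := Int.eq_ofNat_of_zero_le ht
      have := hnone t
      rwa [hline] at this
    · have ht3' : (t3 : ℝ) ≤ 2 := by exact_mod_cast ht3
      rw [h12] at ht2
      push_cast
      rw [hcost]
      have e : (searchDepth (s.reg 2) : ℝ) = Nat.log 2 ⌈s.reg 2⌉₊ + 1 := by simp [searchDepth]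
      rw [e]
      have : (0 : ℝ) ≤ Nat.log 2 ⌈s.reg 2⌉₊ := Nat.cast_nonneg _
      nlinarith

end LatticeHull

/-! ### One step of the walk, with its amortized cost. -/

namespace LatticeHull

open RealRAM

variable {n : ℕ} {v : Fin n → Plane}

/-- The program for the passage from a vertex to the next one. The vertex is in the registers `20`,
`21`; the registers `22`-`25` hold a positive basis `d`, `e` such that the hull has a lattice
point in the direction `-d`, but none in the direction `d`. -/
def vertexStart : Program :=
  .assign 31 (.floor ((.reg 24 * .reg 22 + .reg 25 * .reg 23) /
    (.reg 22 * .reg 22 + .reg 23 * .reg 23))) ;;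
  .assign 24 (.reg 24 - .reg 31 * .reg 22) ;; .assign 25 (.reg 25 - .reg 31 * .reg 23) ;;
  .assign 26 (.reg 24 + .reg 3 * .reg 22) ;; .assign 27 (.reg 25 + .reg 3 * .reg 23) ;;
  .assign 28 (.const 0 - .reg 22) ;; .assign 29 (.const 0 - .reg 23) ;; .assign 30 (.const 1)

def vertexLine : Program :=
  .assign 40 (.reg 20) ;; .assign 41 (.reg 21) ;; .assign 42 (.reg 28) ;; .assign 43 (.reg 29)

def vertexEnd : Program :=
  .assign 20 (.reg 20 + (.reg 46 - .const 1) * .reg 28) ;;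
  .assign 21 (.reg 21 + (.reg 46 - .const 1) * .reg 29) ;;
  .assign 22 (.reg 28) ;; .assign 23 (.reg 29) ;;
  .assign 24 (.const 0 - .reg 26) ;; .assign 25 (.const 0 - .reg 27)

def vertexStep : Program :=
  vertexStart ;; .loop (.eq (.reg 30) (.const 1)) searchRound ;; vertexLine ;; findLast ;; vertexEnd

theorem above_vertexStep : vertexStep.Above 20 = true := by decide

/-- The number `G` bounds the diameter of the polygon, and the registers `2` and `3` hold bounds
for the searches. -/
structure Bounds {n : ℕ} (v : Fin n → Plane) (s : State) (G : ℝ) : Prop where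
  one_le : 1 ≤ G
  diam : ∀ x ∈ polygon v, ∀ y ∈ polygon v, (x 0 - y 0) ^ 2 + (x 1 - y 1) ^ 2 ≤ G ^ 2
  step : ∃ M : ℤ, s.reg 3 = M ∧ G + 2 ≤ M ∧ (M : ℝ) ≤ G + 3
  cap : 7 * G ^ 3 ≤ s.reg 2

theorem Bounds.congr {s s' : State} {G : ℝ} (h : Bounds v s G) {k : ℕ} (hs : Agree k s s')
    (hk : 3 < k) : Bounds v s' G :=
  ⟨h.one_le, h.diam, by rw [hs.1 3 hk]; exact h.step, by rw [hs.1 2 (by omega)]; exact h.cap⟩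

theorem Bounds.norm_le {s : State} {G : ℝ} (h : Bounds v s G) {p z : ℤ × ℤ}
    (hp : p ∈ latticePoints v) (hz : z ∈ shift (latticePoints v) p) :
    (z.1 : ℝ) ^ 2 + (z.2 : ℝ) ^ 2 ≤ G ^ 2 := by
  have := h.diam _ hz _ hp
  simpa using this

/-- The state of the walk along the boundary. -/
structure WalkInv {n : ℕ} (v : Fin n → Plane) (s : State) (p d e f : ℤ × ℤ) : Prop where
  reg_p : HasVec s 20 p
  reg_d : HasVec s 22 d
  reg_e : HasVec s 24 e
  mem : p ∈ latticePoints v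
  det : cross d e = 1
  back : -d ∈ shift (latticePoints v) p
  ne : f ≠ 0
  pointed : Pointed f (shift (latticePoints v) p)

/-- As e·d ≥ 0, the projection of e + s d to the line of d has length at least s|d| ≥ s. This
supplies the bound M - 2 in `SearchInv.init`, once e is reduced modulo d. -/
theorem multiple_le {d1 d2 e1 e2 G s : ℝ} (hG : 0 ≤ G) (hd : 1 ≤ d1 ^ 2 + d2 ^ 2)
    (he : 0 ≤ e1 * d1 + e2 * d2) (h : (e1 + s * d1) ^ 2 + (e2 + s * d2) ^ 2 ≤ G ^ 2) : s ≤ G := by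
  by_contra hs
  push Not at hs
  have hs0 : 0 < s := lt_of_le_of_lt hG hs
  set D := d1 ^ 2 + d2 ^ 2 with hD
  have h1 : (e1 * d1 + e2 * d2 + s * D) ^ 2 ≤
      ((e1 + s * d1) ^ 2 + (e2 + s * d2) ^ 2) * D := by
    have : ((e1 + s * d1) ^ 2 + (e2 + s * d2) ^ 2) * D =
        (e1 * d1 + e2 * d2 + s * D) ^ 2 + (e1 * d2 - e2 * d1) ^ 2 := by rw [hD]; ring
    rw [this]; nlinarith [sq_nonneg (e1 * d2 - e2 * d1)]
  have h2 : (s * D) ^ 2 ≤ (e1 * d1 + e2 * d2 + s * D) ^ 2 := by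
    have : 0 ≤ s * D := by positivity
    gcongr; linarith
  have h3 : s ^ 2 * D ^ 2 ≤ G ^ 2 * D := by nlinarith
  have h4 : s ^ 2 * D ≤ G ^ 2 := by
    have : s ^ 2 * D * D ≤ G ^ 2 * D := by linarith
    exact le_of_mul_le_mul_right this (by linarith)
  nlinarith

/-- Cauchy-Schwarz for g = e + (M+1)d and z. The component of e along d is at most |d| by reduction,
and the one across it is 1/|d| by the determinant, so |g| ≤ (G+6)G. The result limits the total
growth of `cross g` during the search from one vertex. -/
theorem cross_le {d1 d2 e1 e2 z1 z2 G M : ℝ} (hG : 1 ≤ G) (hd : 1 ≤ d1 ^ 2 + d2 ^ 2)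
    (hdG : d1 ^ 2 + d2 ^ 2 ≤ G ^ 2) (he : 0 ≤ e1 * d1 + e2 * d2)
    (he' : e1 * d1 + e2 * d2 ≤ d1 ^ 2 + d2 ^ 2) (hdet : d1 * e2 - d2 * e1 = 1)
    (hM0 : 0 ≤ M) (hM : M ≤ G + 3) (hz : z1 ^ 2 + z2 ^ 2 ≤ G ^ 2) :
    (e1 + (M + 1) * d1) * z2 - (e2 + (M + 1) * d2) * z1 ≤ 7 * G ^ 3 := by
  set D := d1 ^ 2 + d2 ^ 2 with hD
  set g1 := e1 + (M + 1) * d1 with hg1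
  set g2 := e2 + (M + 1) * d2 with hg2
  have h1 : (g1 ^ 2 + g2 ^ 2) * D = (e1 * d1 + e2 * d2 + (M + 1) * D) ^ 2 + 1 := by
    rw [hg1, hg2, hD]; linear_combination (d1 * e2 - d2 * e1 + 1) * hdet
  have h2 : (e1 * d1 + e2 * d2 + (M + 1) * D) ^ 2 ≤ ((M + 2) * D) ^ 2 := by
    have : 0 ≤ e1 * d1 + e2 * d2 + (M + 1) * D := by positivity
    gcongr; linarith
  have h3 : g1 ^ 2 + g2 ^ 2 ≤ (M + 2) ^ 2 * D + 1 := by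
    have : (g1 ^ 2 + g2 ^ 2) * D ≤ ((M + 2) ^ 2 * D + 1) * D := by nlinarith
    exact le_of_mul_le_mul_right this (by linarith)
  have h4 : g1 ^ 2 + g2 ^ 2 ≤ ((G + 6) * G) ^ 2 := by
    have : (M + 2) ^ 2 ≤ (G + 5) ^ 2 := pow_le_pow_left₀ (by linarith) (by linarith) 2
    have : (M + 2) ^ 2 * D ≤ (G + 5) ^ 2 * G ^ 2 := by gcongr
    nlinarith
  have h5 : (g1 * z2 - g2 * z1) ^ 2 ≤ (g1 ^ 2 + g2 ^ 2) * (z1 ^ 2 + z2 ^ 2) := by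
    have : (g1 ^ 2 + g2 ^ 2) * (z1 ^ 2 + z2 ^ 2) =
        (g1 * z2 - g2 * z1) ^ 2 + (g1 * z1 + g2 * z2) ^ 2 := by ring
    rw [this]
    exact le_add_of_nonneg_right (sq_nonneg _)
  have h6 : (g1 ^ 2 + g2 ^ 2) * (z1 ^ 2 + z2 ^ 2) ≤ ((G + 6) * G) ^ 2 * G ^ 2 := by gcongr
  have h7 : (g1 * z2 - g2 * z1) ^ 2 ≤ ((G + 6) * G * G) ^ 2 :=
    (h5.trans h6).trans_eq (by ring)
  have h8 := abs_le_of_sq_le_sq' h7 (by positivity)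
  have h9 : (G + 6) * G * G ≤ 7 * G ^ 3 := by
    nlinarith [mul_nonneg (sq_nonneg G) (sub_nonneg.2 hG)]
  linarith [h8.2]

-- A successful round multiplies the value of `cross g` at b by at least c ≥ 2 and costs O(log c)
-- probes. The value starts at 1 and stays below the cap in register `2`, so these costs telescope
-- to a single logarithm of the cap. The Boolean part of the potential pays for the one round that
-- fails.
set_option maxHeartbeats 1000000 in
theorem runs_vertexStep (hn : 3 ≤ n) (hv : IsCounterclockwise v) {s : State}
    (hs : HoldsPolygon v s) {G : ℝ} (hG : Bounds v s G) {p d e f : ℤ × ℤ}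
    (h : WalkInv v s p d e f) :
    ∃ tm s' q d' e', Runs vertexStep s tm s' ∧ IsHullEdge (latticePoints v) p q ∧
      WalkInv v s' q d' e' d' ∧ (tm : ℝ) ≤ 30000 * depth n * searchDepth (s.reg 2) := by
  have hdep : (1 : ℝ) ≤ depth n := by simp [depth]
  have hsd : (1 : ℝ) ≤ searchDepth (s.reg 2) := by simp [searchDepth]
  have hD : LatConvex (shift (latticePoints v) p) := latConvex_latticePoints.shift p
  have h0 : (0 : ℤ × ℤ) ∈ shift (latticePoints v) p := by simpa [shift] using h.mem
  obtain ⟨M, hM, hM1, hM2⟩ := hG.step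
  have hd0 : d ≠ 0 := by
    rintro rfl; have := h.det; simp [cross] at this
  have hdd := dot_self_pos hd0
  have hdd' : (1 : ℝ) ≤ (d.1 : ℝ) ^ 2 + (d.2 : ℝ) ^ 2 := by
    have : (1 : ℤ) ≤ d.1 ^ 2 + d.2 ^ 2 := by simp only [dot] at hdd; nlinarith
    exact_mod_cast this
  -- the reduced vector `e`
  obtain ⟨t1, s1, r1, ht1, e1⟩ := Program.runs_block (p := vertexStart) 70 s
    (by decide) (by decide)
  have f1 := r1.agree 20 (by decide)
  -- Reducing e modulo d keeps the determinant and gives 0 ≤ e'·d ≤ d·d, as `multiple_le` and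
  -- `cross_le` require.
  set r : ℤ := ⌊((e.1 : ℝ) * d.1 + e.2 * d.2) / (d.1 * d.1 + d.2 * d.2)⌋ with hr
  set e' : ℤ × ℤ := e - r • d with he'
  obtain ⟨x1, x2⟩ := h.reg_p
  obtain ⟨y1, y2⟩ := h.reg_d
  obtain ⟨z1, z2⟩ := h.reg_e
  norm_num at x2 y2 z2
  have hp1 : HasVec s1 20 p := by
    constructor <;> rw [e1] <;> simp [Program.exec, vertexStart, x1, x2]
  have ha1 : HasVec s1 26 (e' + M • d) := by
    constructor <;> rw [e1] <;>
      simp [Program.exec, vertexStart, y1, y2, z1, z2, hM, he', ← hr]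
  have hb1 : HasVec s1 28 (-d) := by
    constructor <;> rw [e1] <;> simp [Program.exec, vertexStart, y1, y2]
  have hgo : s1.reg 30 = 1 := by
    rw [e1]; simp [Program.exec, vertexStart]
  have hdet' : cross d e' = 1 := by
    have := h.det
    simp only [cross, he'] at this ⊢; simp; linear_combination this
  have hfl1 := Int.floor_le (((e.1 : ℝ) * d.1 + e.2 * d.2) / (d.1 * d.1 + d.2 * d.2))
  have hfl2 := Int.lt_floor_add_one (((e.1 : ℝ) * d.1 + e.2 * d.2) / (d.1 * d.1 + d.2 * d.2))
  rw [← hr] at hfl1 hfl2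
  rw [le_div_iff₀ (by nlinarith)] at hfl1
  rw [div_lt_iff₀ (by nlinarith)] at hfl2
  have he1 : (0 : ℝ) ≤ e'.1 * d.1 + e'.2 * d.2 := by
    simp [he']; linarith
  have he2 : (e'.1 : ℝ) * d.1 + e'.2 * d.2 ≤ (d.1 : ℝ) ^ 2 + (d.2 : ℝ) ^ 2 := by
    simp [he']; linarith
  have hdG : (d.1 : ℝ) ^ 2 + (d.2 : ℝ) ^ 2 ≤ G ^ 2 := by
    have := hG.norm_le h.mem h.back
    simpa using this
  have hinit : SearchInv (shift (latticePoints v) p) (e' + M • d) (-d) := by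
    apply SearchInv.init hD h0 hdet' h.back
    intro s hs
    have h1 := hG.norm_le h.mem hs
    have h2 := multiple_le (s := s) (G := G) (by linarith [hG.one_le]) hdd' he1
      (by simpa using h1)
    have : ((s : ℤ) : ℝ) ≤ (M - 2 : ℤ) := by push_cast; linarith
    exact_mod_cast this
  -- The functional `cross g` has the value 1 at both starting vectors e' + M d and -d.
  set g : ℤ × ℤ := e' + (M + 1) • d with hg
  have hcap : ∀ z ∈ shift (latticePoints v) p, (cross g z : ℝ) ≤ s.reg 2 := by
    intro z hz
    have hz' := hG.norm_le h.mem hz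
    have hM0 : (0 : ℝ) ≤ M := by linarith [hG.one_le]
    have hdetR : (d.1 : ℝ) * e'.2 - d.2 * e'.1 = 1 := by
      have h1 := hdet'
      simp only [cross] at h1
      exact_mod_cast h1
    have := cross_le hG.one_le hdd' hdG he1 he2 hdetR hM0 hM2 hz'
    refine le_trans ?_ (this.trans hG.cap)
    simp [cross, hg]
  have hcap0 : 1 ≤ s.reg 2 := by
    have h1 := hG.cap
    have h2 : (1 : ℝ) ≤ G ^ 3 := one_le_pow₀ hG.one_le
    linarith
  have hlogcap : Real.logb 2 (s.reg 2) ≤ searchDepth (s.reg 2) := by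
    have h1 : Real.logb 2 (s.reg 2) ≤ Real.logb 2 ⌈s.reg 2⌉₊ :=
      Real.logb_le_logb_of_le (by norm_num) (by linarith) (Nat.le_ceil _)
    have h2 : Real.logb 2 (⌈s.reg 2⌉₊ : ℕ) ≤ Real.logb 2 ((2 ^ searchDepth (s.reg 2) : ℕ) : ℝ) := by
      refine Real.logb_le_logb_of_le (by norm_num) ?_ ?_
      · have := Nat.one_le_ceil_iff.2 (show 0 < s.reg 2 by linarith)
        exact_mod_cast this
      · exact_mod_cast (Nat.lt_pow_succ_log_self (by norm_num) _).le
    have h3 : Real.logb 2 ((2 ^ searchDepth (s.reg 2) : ℕ) : ℝ) = searchDepth (s.reg 2) := by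
      push_cast; rw [Real.logb_pow]; simp
    linarith
  -- the search loop
  let I : (ℤ × ℤ) × (ℤ × ℤ) × Bool → State → Prop := fun x σ => Agree 26 s1 σ ∧
    HasVec σ 26 x.1 ∧ HasVec σ 28 x.2.1 ∧ SearchInv (shift (latticePoints v) p) x.1 x.2.1 ∧
    1 ≤ cross g x.1 ∧ 1 ≤ cross g x.2.1 ∧
    ((x.2.2 = true ∧ σ.reg 30 = 1) ∨ (x.2.2 = false ∧ σ.reg 30 = 0 ∧
      ∀ t : ℤ, 0 ≤ t → x.1 + t • x.2.1 ∉ shift (latticePoints v) p))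
  let Φ : (ℤ × ℤ) × (ℤ × ℤ) × Bool → ℝ := fun x =>
    13000 * depth n * (Real.logb 2 (s.reg 2) - Real.logb 2 (cross g x.2.1 : ℤ)) +
      (if x.2.2 then 4000 * (depth n : ℝ) * searchDepth (s.reg 2) else 0) + 8
  have hΦ0 : ∀ x σ, I x σ →
      0 ≤ 13000 * depth n * (Real.logb 2 (s.reg 2) - Real.logb 2 (cross g x.2.1 : ℤ)) := by
    intro x σ hI
    have h1 : (1 : ℝ) ≤ (cross g x.2.1 : ℤ) := by exact_mod_cast hI.2.2.2.2.2.1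
    have h2 : Real.logb 2 (cross g x.2.1 : ℤ) ≤ Real.logb 2 (s.reg 2) :=
      Real.logb_le_logb_of_le (by norm_num) (by linarith) (hcap _ hI.2.2.2.1.mem)
    have : 0 ≤ Real.logb 2 (s.reg 2) - Real.logb 2 (cross g x.2.1 : ℤ) := by linarith
    positivity
  have hI1 : I (e' + M • d, -d, true) s1 := by
    refine ⟨Agree.refl _ _, ha1, hb1, hinit, ?_, ?_, Or.inl ⟨rfl, hgo⟩⟩
    · simp only [cross, hg] at hdet' ⊢; simp; linarith
    · simp only [cross, hg] at hdet' ⊢; simp; linarith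
  have f1' := f1
  have h12 : s1.reg 2 = s.reg 2 := f1.1 2 (by norm_num)
  obtain ⟨t2, s2, x, r2, hI2, hb2, ht2⟩ := Runs.loop_rule (b := .eq (.reg 30) (.const 1))
    (p := searchRound) 8 (by decide) I Φ (fun x σ hI hb => by
      obtain ⟨g1, g2, g3, g4, g5, g6, g7⟩ := hI
      simp at hb
      have hx : x.2.2 = true := by
        rcases g7 with g7 | g7
        · exact g7.1
        · rw [g7.2.1] at hb; norm_num at hb
      have hσ2 : σ.reg 2 = s.reg 2 := (g1.1 2 (by norm_num)).trans h12
      obtain ⟨tm, σ', q, hfr, hres⟩ := runs_searchRound hn hv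
        ((hs.mono (k := 20) (by norm_num) f1).mono (k := 26) (by norm_num) g1) h.mem h.pointed
        (hp1.congr g1 (by norm_num)) g2 g3 g4 g5 g6 (by rw [hσ2]; exact hcap)
      rcases hres with ⟨a', b', c, k1, k2, k3, k4, k5, k6, k7, k8⟩ | ⟨k1, k2, k3, k4, k5⟩
      · have hgb : (1 : ℝ) ≤ (cross g x.2.1 : ℤ) := by exact_mod_cast g6
        have hcb : (1 : ℝ) ≤ (cross g b' : ℤ) := by nlinarith
        refine ⟨tm, σ', (a', b', true), q, ⟨g1.trans hfr le_rfl, k1, k2, k4, k5,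
          by exact_mod_cast hcb, Or.inl ⟨rfl, k3.trans hb⟩⟩, ?_⟩
        have l1 : Real.logb 2 c + Real.logb 2 (cross g x.2.1 : ℤ) ≤ Real.logb 2 (cross g b' : ℤ) := by
          rw [← Real.logb_mul (by positivity) (by positivity)]
          exact Real.logb_le_logb_of_le (by norm_num) (by positivity) k7
        have l2 : 1 ≤ Real.logb 2 c := by
          rw [Real.le_logb_iff_rpow_le (by norm_num) (by linarith)]; simpa using k6
        simp only [Φ, hx, if_true]
        have m1 : (depth n : ℝ) * (Real.logb 2 c + Real.logb 2 (cross g x.2.1 : ℤ)) ≤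
            depth n * Real.logb 2 (cross g b' : ℤ) := by gcongr
        have m2 : (depth n : ℝ) * 1 ≤ depth n * Real.logb 2 c := by gcongr
        push_cast
        linarith
      · refine ⟨tm, σ', (x.1, x.2.1, false), q, ⟨g1.trans hfr le_rfl, k1, k2, g4, g5, g6,
          Or.inr ⟨rfl, k3, k4⟩⟩, ?_⟩
        simp only [Φ, hx, if_true]
        rw [hσ2] at k5
        have m1 : (1 : ℝ) * 1 ≤ depth n * searchDepth (s.reg 2) := by gcongr
        simp
        linarith) (fun x σ hI => by
      have h1 := hΦ0 x σ hI
      have h2 : (0 : ℝ) ≤ if x.2.2 then 4000 * (depth n : ℝ) * searchDepth (s.reg 2) else 0 := by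
        split_ifs <;> positivity
      simp only [Φ]
      push_cast
      linarith) hI1
  obtain ⟨a, b, go⟩ := x
  obtain ⟨g1, g2, g3, g4, g5, g6, g7⟩ := hI2
  simp only at g2 g3 g4 g5 g6 g7
  have hnone : ∀ t : ℤ, 0 ≤ t → a + t • b ∉ shift (latticePoints v) p := by
    rcases g7 with g7 | g7
    · exact absurd (by simp [g7.2]) hb2
    · exact g7.2.2
  have hleft := g4.final hD h0 hnone
  -- the end of the edge
  obtain ⟨t3, s3, r3, ht3, e3⟩ := Program.runs_block (p := vertexLine) 10 s2
    (by decide) (by decide)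
  have f3 := (f1.trans g1 (by norm_num)).trans (r3.agree 40 (by decide)) (by norm_num)
  have a3 := r3.agree 40 (by decide)
  have hp2 := hp1.congr g1 (by norm_num)
  have ho3 : HasVec s3 40 p := by
    obtain ⟨x1, x2⟩ := hp2
    norm_num at x2
    constructor <;> rw [e3] <;> simp [Program.exec, vertexLine, x1, x2]
  have hw3 : HasVec s3 42 b := by
    obtain ⟨x1, x2⟩ := g3
    norm_num at x2
    constructor <;> rw [e3] <;> simp [Program.exec, vertexLine, x1, x2]
  have hline : ∀ k : ℕ, linePoint s3 k ∈ polygon v ↔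
      (k : ℤ) • b ∈ shift (latticePoints v) p := by
    intro k
    rw [linePoint_mem ho3 hw3]; rfl
  have hkcap : ∀ k : ℕ, linePoint s3 k ∈ polygon v → k ≤ ⌈s.reg 2⌉₊ := by
    intro k hk
    rw [hline] at hk
    have h5 := hcap _ hk
    have : cross g ((k : ℤ) • b) = k * cross g b := by simp only [cross]; simp; ring
    rw [this] at h5
    have : (k : ℤ) ≤ k * cross g b := by nlinarith
    have h6 : (k : ℝ) ≤ s.reg 2 := le_trans (by exact_mod_cast this) h5
    exact_mod_cast h6.trans (Nat.le_ceil _)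
  obtain ⟨t4, s4, k, r4, h46, hk, hk1, ht4⟩ := runs_findLast hn hv
    (hs.mono (k := 20) (by norm_num) f3)
    (by have := (hline 0).2 (by simpa using h0); simpa using this) (⌈s.reg 2⌉₊ + 1)
    (fun k hk => by have := hkcap k hk; omega)
  have hkc := hkcap k hk
  rw [hline] at hk hk1
  have hkpos : 0 < k := by
    by_contra hk0
    obtain rfl : k = 0 := by omega
    exact hk1 (by simpa using g4.mem)
  have a4 := a3.trans (r4.agree 44 above_findLast) (by norm_num)
  obtain ⟨t5, s5, r5, ht5, e5⟩ := Program.runs_block (p := vertexEnd) 40 s4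
    (by decide) (by decide)
  have hedge : IsHullEdge (latticePoints v) p (p + (k : ℤ) • b) :=
    isHullEdge_of_direction latConvex_latticePoints h.mem h.pointed g4.det g4.mem hleft
      (by exact_mod_cast hkpos) hk (by push_cast at hk1; exact hk1)
  have hp4 := hp2.congr a4 (by norm_num)
  have ha4 := g2.congr a4 (by norm_num)
  have hb4 := g3.congr a4 (by norm_num)
  -- The basis is handed on to the next vertex: -b points back along the edge, and `cross b (-a)`
  -- equals `cross a b`, which is 1.
  refine ⟨_, s5, p + (k : ℤ) • b, b, -a, .seq r1 (.seq r2 (.seq r3 (.seq r4 r5))), hedge,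
    ⟨?_, ?_, ?_, hedge.right_mem, ?_, ?_, ?_, hedge.pointed (by exact_mod_cast hkpos)⟩, ?_⟩
  · obtain ⟨x1, x2⟩ := hp4
    obtain ⟨y1, y2⟩ := hb4
    norm_num at x2 y2
    constructor <;> rw [e5] <;> simp [Program.exec, vertexEnd, x1, x2, y1, y2, h46]
  · obtain ⟨y1, y2⟩ := hb4
    norm_num at y2
    constructor <;> rw [e5] <;> simp [Program.exec, vertexEnd, y1, y2]
  · obtain ⟨y1, y2⟩ := ha4
    norm_num at y2
    constructor <;> rw [e5] <;> simp [Program.exec, vertexEnd, y1, y2]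
  · have := g4.det
    simp only [cross] at this ⊢; simp; linarith
  · have h1 : ((k : ℤ) - 1) • b ∈ shift (latticePoints v) p := by
      refine hD _ hk _ h0 _ h0 ((k : ℤ) - 1) 1 0 _ (by omega) (by norm_num) le_rfl (by omega) ?_
      simp only [smul_smul, smul_zero, add_zero]
      congr 1
      ring
    show p + (k : ℤ) • b + -b ∈ latticePoints v
    have h2 : p + ((k : ℤ) - 1) • b ∈ latticePoints v := h1
    convert h2 using 1
    module
  · rintro rfl
    have := g4.det
    simp [cross] at this
  · have ht1' : (t1 : ℝ) ≤ 70 := by exact_mod_cast ht1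
    have ht3' : (t3 : ℝ) ≤ 10 := by exact_mod_cast ht3
    have ht5' : (t5 : ℝ) ≤ 40 := by exact_mod_cast ht5
    have hlogk : Nat.log 2 (k + 1) ≤ searchDepth (s.reg 2) := by
      have h1 : k + 1 ≤ 2 ^ searchDepth (s.reg 2) := by
        have := Nat.lt_pow_succ_log_self (b := 2) (by norm_num) ⌈s.reg 2⌉₊
        rw [searchDepth]
        omega
      have := Nat.log_mono_right (b := 2) h1
      rwa [Nat.log_pow (by norm_num)] at this
    have hlogk' : (Nat.log 2 (k + 1) : ℝ) ≤ searchDepth (s.reg 2) := by exact_mod_cast hlogk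
    have hg0 : cross g (-d) = 1 := by
      simp only [cross, hg] at hdet' ⊢; simp; linarith
    simp only [Φ, if_true, hg0] at ht2
    simp at ht2
    push_cast
    have m1 : (depth n : ℝ) * Real.logb 2 (s.reg 2) ≤ depth n * searchDepth (s.reg 2) := by gcongr
    have m2 : (depth n : ℝ) * Nat.log 2 (k + 1) ≤ depth n * searchDepth (s.reg 2) := by gcongr
    have m3 : (1 : ℝ) * 1 ≤ depth n * searchDepth (s.reg 2) := by gcongr
    have m4 : (depth n : ℝ) * 1 ≤ depth n * searchDepth (s.reg 2) := by gcongr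
    linarith

end LatticeHull

/-! ## The walk around the hull -/

namespace LatticeHull

open RealRAM

variable {n : ℕ} {v : Fin n → Plane}

theorem finite_latticePoints {s : State} {G : ℝ} (h : Bounds v s G) : (latticePoints v).Finite := by
  rcases Set.eq_empty_or_nonempty (latticePoints v) with h0 | ⟨p, hp⟩
  · rw [h0]; exact Set.finite_empty
  · refine (Set.finite_Icc (p - (⌈G⌉, ⌈G⌉)) (p + (⌈G⌉, ⌈G⌉))).subset fun z hz => ?_
    have h1 := h.norm_le hp (z := z - p) (by simpa [shift] using hz)
    have h2 := Int.le_ceil G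
    have hG := h.one_le
    simp at h1
    have h3 : |(z.1 : ℝ) - p.1| ≤ G := abs_le_of_sq_le_sq (by nlinarith) (by linarith)
    have h4 : |(z.2 : ℝ) - p.2| ≤ G := abs_le_of_sq_le_sq (by nlinarith) (by linarith)
    rw [abs_le] at h3 h4
    have a1 : ((p.1 - ⌈G⌉ : ℤ) : ℝ) ≤ z.1 := by push_cast; linarith
    have a2 : ((p.2 - ⌈G⌉ : ℤ) : ℝ) ≤ z.2 := by push_cast; linarith
    have a3 : ((z.1 : ℤ) : ℝ) ≤ (p.1 + ⌈G⌉ : ℤ) := by push_cast; linarith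
    have a4 : ((z.2 : ℤ) : ℝ) ≤ (p.2 + ⌈G⌉ : ℤ) := by push_cast; linarith
    exact ⟨⟨by exact_mod_cast a1, by exact_mod_cast a2⟩, ⟨by exact_mod_cast a3, by exact_mod_cast a4⟩⟩

/-- The hull of the lattice points of the polygon. -/
def latticeHull {n : ℕ} (v : Fin n → Plane) : Set Plane := convexHull ℝ (toPlane '' latticePoints v)

def walkStart : Program :=
  .assign 10 (.reg 20) ;; .assign 11 (.reg 21) ;; .assign 12 (.const 0) ;; .assign 13 (.const 1)

def walkOutput : Program :=
  .write 2 (.reg 12) (.reg 20) ;; .write 3 (.reg 12) (.reg 21) ;;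
  .assign 12 (.reg 12 + .const 1)

def walkTest : Program :=
  .ite (.and (.eq (.reg 20) (.reg 10)) (.eq (.reg 21) (.reg 11)))
    (.assign 13 (.const 0)) (.assign 13 (.const 1))

/-- The program that lists the vertices of the hull, starting at a given one. -/
def walk : Program :=
  walkStart ;;
  .loop (.eq (.reg 13) (.const 1)) (walkOutput ;; vertexStep ;; walkTest) ;;
  .assign 0 (.reg 12)

/-- The vertices `P 0, …, P m` have been found, and all of them but the last one are in the
output arrays. The flag tells whether the walk goes on. -/
structure WalkState {n : ℕ} (v : Fin n → Plane) (G cap : ℝ) (m : ℕ) (go : Bool) (σ : State)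
    (P F : ℕ → ℤ × ℤ) (d e : ℤ × ℤ) : Prop where
  poly : HoldsPolygon v σ
  bounds : Bounds v σ G
  cap : σ.reg 2 = cap
  inv : WalkInv v σ (P m) d e (F m)
  edge : ∀ j, j < m → IsHullEdge (latticePoints v) (P j) (P (j + 1))
  ne : ∀ j, 1 ≤ j → j < m → P j ≠ P 0
  dir : ∀ j, j ≤ m → F j ≠ 0
  pointed : ∀ j, j ≤ m → Pointed (F j) (shift (latticePoints v) (P j))
  first : HasVec σ 10 (P 0)
  count : σ.reg 12 = m
  out : ∀ i, i < m → σ.arr 2 i = (P i).1 ∧ σ.arr 3 i = (P i).2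
  flag : (go = true ∧ σ.reg 13 = 1 ∧ (1 ≤ m → P m ≠ P 0)) ∨
    (go = false ∧ σ.reg 13 = 0 ∧ 1 ≤ m ∧ P m = P 0)

/-- Before the walk returns, the m + 1 points found so far are distinct extreme points. This bounds
the number of rounds and, with it, forces the walk to close. -/
theorem WalkState.lt_numVertices {G cap : ℝ} {m : ℕ} {σ : State} {P F : ℕ → ℤ × ℤ} {d e : ℤ × ℤ}
    (h : WalkState v G cap m true σ P F d e) : m < numVertices (latticeHull v) := by
  have hne : ∀ j, 1 ≤ j → j < m + 1 → P j ≠ P 0 := by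
    intro j hj1 hjm
    rcases eq_or_lt_of_le (show j ≤ m by omega) with h1 | h1
    · subst h1
      rcases h.flag with h2 | h2
      · exact h2.2.2 hj1
      · exact absurd h2.1 (by simp)
    · exact h.ne j hj1 h1
  have hinj : ∀ {i j : ℕ}, i < j → j < m + 1 → P i ≠ P j :=
    fun hij hj => walk_injective (fun j hj => h.edge j (by omega)) hne hij hj
  have hfin : ((latticeHull v).extremePoints ℝ).Finite :=
    ((finite_latticePoints h.bounds).image toPlane).subset extremePoints_convexHull_subset
  have hmem : ∀ j, j ≤ m → P j ∈ latticePoints v := by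
    intro j hj
    rcases eq_or_lt_of_le hj with h1 | h1
    · rw [h1]; exact h.inv.mem
    · exact (h.edge j h1).left_mem
  have hsub : ((Finset.range (m + 1)).image (fun j => toPlane (P j)) : Set Plane) ⊆
      (latticeHull v).extremePoints ℝ := by
    intro x hx
    simp only [Finset.coe_image, Set.mem_image, Finset.coe_range, Set.mem_Iio] at hx
    obtain ⟨j, hj, rfl⟩ := hx
    exact mem_extremePoints_of_pointed (hmem j (by omega)) (h.dir j (by omega))
      (h.pointed j (by omega))
  have hcard := Set.ncard_le_ncard hsub hfin
  rw [Set.ncard_coe_finset, Finset.card_image_of_injOn, Finset.card_range] at hcard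
  · exact hcard
  · intro i hi j hj hij
    have h1 := toPlane_injective hij
    simp at hi hj
    by_contra hne'
    rcases lt_or_gt_of_ne hne' with h2 | h2
    · exact hinj h2 (by omega) h1
    · exact hinj h2 (by omega) h1.symm

theorem runs_walkRound (hn : 3 ≤ n) (hv : IsCounterclockwise v) {G cap : ℝ} {m : ℕ} {σ : State}
    {P F : ℕ → ℤ × ℤ} {d e : ℤ × ℤ} (h : WalkState v G cap m true σ P F d e) :
    ∃ tm σ' go P' F' d' e', Runs (walkOutput ;; vertexStep ;; walkTest) σ tm σ' ∧
      WalkState v G cap (m + 1) go σ' P' F' d' e' ∧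
      (tm : ℝ) ≤ 30000 * depth n * searchDepth cap + 50 := by
  obtain ⟨t1, s1, r1, ht1, e1⟩ := Program.runs_block (p := walkOutput) 15 σ (by decide) (by decide)
  have hreg : ∀ r, r ≠ 12 → s1.reg r = σ.reg r := by
    intro r hr; rw [e1]; simp [walkOutput, Program.exec, hr]
  have h112 : s1.reg 12 = (m + 1 : ℕ) := by
    rw [e1]; simp [walkOutput, Program.exec, h.count]
  have hp := h.inv.reg_p
  obtain ⟨hp1, hp2⟩ := hp
  norm_num at hp2
  have harr : ∀ a i, s1.arr a i = if a = 3 ∧ i = m then ((P m).2 : ℝ) else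
      if a = 2 ∧ i = m then ((P m).1 : ℝ) else σ.arr a i := by
    intro a i
    rw [e1]
    simp [walkOutput, Program.exec, State.arr_setArr, h.count, hp1, hp2]
  have hpoly : HoldsPolygon v s1 := by
    refine ⟨by rw [hreg 1 (by norm_num), h.poly.num], ?_, ?_⟩
    · rw [← h.poly.xs]; funext i; rw [harr]; simp
    · rw [← h.poly.ys]; funext i; rw [harr]; simp
  have hb : Bounds v s1 G := ⟨h.bounds.one_le, h.bounds.diam,
    by rw [hreg 3 (by norm_num)]; exact h.bounds.step,
    by rw [hreg 2 (by norm_num)]; exact h.bounds.cap⟩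
  have hinv : WalkInv v s1 (P m) d e (F m) := by
    obtain ⟨w1, w2, w3, w4, w5, w6, w7, w8⟩ := h.inv
    exact ⟨⟨(hreg _ (by norm_num)).trans w1.1, (hreg _ (by norm_num)).trans w1.2⟩,
      ⟨(hreg _ (by norm_num)).trans w2.1, (hreg _ (by norm_num)).trans w2.2⟩,
      ⟨(hreg _ (by norm_num)).trans w3.1, (hreg _ (by norm_num)).trans w3.2⟩, w4, w5, w6, w7, w8⟩
  obtain ⟨t2, s2, q, d', e', r2, hedge, hinv2, ht2⟩ := runs_vertexStep hn hv hpoly hb hinv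
  have a2 := r2.agree 20 above_vertexStep
  obtain ⟨t3, s3, r3, ht3, e3⟩ := Program.runs_block (p := walkTest) 20 s2 (by decide) (by decide)
  have a3 : Agree 13 s2 s3 := r3.agree 13 (by decide)
  have hreg3 : ∀ r, r ≠ 13 → s3.reg r = s2.reg r := by
    intro r hr
    rw [e3]
    by_cases hc : s2.reg 20 = s2.reg 10 ∧ s2.reg 21 = s2.reg 11
    · simp [walkTest, Program.exec, if_pos hc, hr]
    · simp [walkTest, Program.exec, if_neg hc, hr]
  have hcap : s1.reg 2 = cap := by rw [hreg 2 (by norm_num), h.cap]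
  rw [hcap] at ht2
  obtain ⟨w1, w2, w3, w4, w5, w6, w7, w8⟩ := hinv2
  have w1' : HasVec s3 20 q :=
    ⟨(hreg3 _ (by norm_num)).trans w1.1, (hreg3 _ (by norm_num)).trans w1.2⟩
  let P' : ℕ → ℤ × ℤ := fun j => if j ≤ m then P j else q
  let F' : ℕ → ℤ × ℤ := fun j => if j ≤ m then F j else d'
  have hP : ∀ j, j ≤ m → P' j = P j := fun j hj => by simp [P', hj]
  have hF : ∀ j, j ≤ m → F' j = F j := fun j hj => by simp [F', hj]
  have hPm : P' (m + 1) = q := by simp [P']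
  have hFm : F' (m + 1) = d' := by simp [F']
  have hfirst : HasVec s3 10 (P' 0) := by
    rw [hP 0 (by omega)]
    obtain ⟨y1, y2⟩ := h.first
    norm_num at y2
    exact ⟨by rw [hreg3 10 (by norm_num), a2.1 10 (by norm_num), hreg 10 (by norm_num), y1],
      by norm_num; rw [hreg3 11 (by norm_num), a2.1 11 (by norm_num), hreg 11 (by norm_num), y2]⟩
  have htest : (s2.reg 20 = s2.reg 10 ∧ s2.reg 21 = s2.reg 11) ↔ q = P 0 := by
    obtain ⟨y1, y2⟩ := h.first
    obtain ⟨x1, x2⟩ := w1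
    norm_num at x2 y2
    rw [a2.1 10 (by norm_num), a2.1 11 (by norm_num), hreg 10 (by norm_num), hreg 11 (by norm_num),
      x1, x2, y1, y2, Prod.ext_iff]
    norm_cast
  have ht : ((t1 + (t2 + t3) : ℕ) : ℝ) ≤ 30000 * depth n * searchDepth cap + 50 := by
    have ht1' : (t1 : ℝ) ≤ 15 := by exact_mod_cast ht1
    have ht3' : (t3 : ℝ) ≤ 20 := by exact_mod_cast ht3
    push_cast
    linarith
  have main : ∀ go, ((go = true ∧ s3.reg 13 = 1 ∧ (1 ≤ m + 1 → P' (m + 1) ≠ P' 0)) ∨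
      (go = false ∧ s3.reg 13 = 0 ∧ 1 ≤ m + 1 ∧ P' (m + 1) = P' 0)) →
      WalkState v G cap (m + 1) go s3 P' F' d' e' := by
    intro go hgo
    refine ⟨(hpoly.mono (by norm_num) a2).mono (by norm_num) a3,
      (hb.congr a2 (by norm_num)).congr a3 (by norm_num), ?_, ?_, ?_, ?_, ?_, ?_, hfirst, ?_, ?_, hgo⟩
    · rw [a3.1 2 (by norm_num), a2.1 2 (by norm_num), hcap]
    · rw [hPm, hFm]
      exact ⟨w1', ⟨(hreg3 _ (by norm_num)).trans w2.1, (hreg3 _ (by norm_num)).trans w2.2⟩,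
        ⟨(hreg3 _ (by norm_num)).trans w3.1, (hreg3 _ (by norm_num)).trans w3.2⟩, w4, w5, w6, w7, w8⟩
    · intro j hj
      rcases eq_or_lt_of_le (show j ≤ m by omega) with h1 | h1
      · rw [h1, hPm, hP m le_rfl]; exact hedge
      · rw [hP j (by omega), hP (j + 1) (by omega)]; exact h.edge j h1
    · intro j hj1 hjm
      rw [hP j (by omega), hP 0 (by omega)]
      rcases eq_or_lt_of_le (show j ≤ m by omega) with h1 | h1
      · subst h1
        rcases h.flag with h2 | h2
        · exact h2.2.2 hj1
        · exact absurd h2.1 (by simp)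
      · exact h.ne j hj1 h1
    · intro j hj
      rcases eq_or_lt_of_le hj with h1 | h1
      · rw [h1, hFm]; exact w7
      · rw [hF j (by omega)]; exact h.dir j (by omega)
    · intro j hj
      rcases eq_or_lt_of_le hj with h1 | h1
      · rw [h1, hFm, hPm]; exact w8
      · rw [hF j (by omega), hP j (by omega)]; exact h.pointed j (by omega)
    · rw [a3.1 12 (by norm_num), a2.1 12 (by norm_num), h112]
    · intro i hi
      rw [a3.2, a2.2, hP i (by omega), harr, harr]
      rcases eq_or_lt_of_le (show i ≤ m by omega) with h1 | h1
      · simp [h1]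
      · have := h.out i h1
        simpa [show i ≠ m by omega] using this
  by_cases hq : q = P 0
  · refine ⟨_, s3, false, P', F', d', e', .seq r1 (.seq r2 r3), main false (Or.inr ⟨rfl, ?_, by omega,
      by rw [hPm, hP 0 (by omega), hq]⟩), ht⟩
    rw [e3]; simp [walkTest, Program.exec, if_pos (htest.2 hq)]
  · refine ⟨_, s3, true, P', F', d', e', .seq r1 (.seq r2 r3), main true (Or.inl ⟨rfl, ?_, fun _ =>
      by rw [hPm, hP 0 (by omega)]; exact hq⟩), ht⟩
    rw [e3]; simp [walkTest, Program.exec, if_neg (mt htest.1 hq)]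

theorem runs_walk (hn : 3 ≤ n) (hv : IsCounterclockwise v) {s : State}
    (hs : HoldsPolygon v s) {G : ℝ} (hG : Bounds v s G) {p d e f : ℤ × ℤ}
    (h : WalkInv v s p d e f) :
    ∃ tm s' m, ∃ w : Fin m → Plane, Runs walk s tm s' ∧ s'.Outputs w ∧
      IsVertexList w (latticeHull v) ∧
      (tm : ℝ) ≤ (numVertices (latticeHull v) + 1) *
        (30000 * depth n * searchDepth (s.reg 2) + 100) := by
  obtain ⟨t1, s1, r1, ht1, e1⟩ := Program.runs_block (p := walkStart) 10 s (by decide) (by decide)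
  have a1 : Agree 10 s s1 := r1.agree 10 (by decide)
  have hge : ∀ r, 20 ≤ r → s1.reg r = s.reg r := by
    intro r hr
    rw [e1]
    simp [walkStart, Program.exec, show r ≠ 10 by omega, show r ≠ 11 by omega,
      show r ≠ 12 by omega, show r ≠ 13 by omega]
  obtain ⟨w1, w2, w3, w4, w5, w6, w7, w8⟩ := h
  set V := numVertices (latticeHull v)
  set T : ℝ := 30000 * depth n * searchDepth (s.reg 2) + 60 with hT
  have hT0 : 0 ≤ T := by positivity
  have hstart : WalkState v G (s.reg 2) 0 true s1 (fun _ => p) (fun _ => f) d e := by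
    refine ⟨hs.mono (by norm_num) a1, hG.congr a1 (by norm_num), a1.1 2 (by norm_num),
      ⟨⟨(hge _ (by norm_num)).trans w1.1, (hge _ (by norm_num)).trans w1.2⟩,
      ⟨(hge _ (by norm_num)).trans w2.1, (hge _ (by norm_num)).trans w2.2⟩,
      ⟨(hge _ (by norm_num)).trans w3.1, (hge _ (by norm_num)).trans w3.2⟩, w4, w5, w6, w7, w8⟩,
      by simp, by simp, fun _ _ => w7, fun _ _ => w8, ?_, ?_, by simp, Or.inl ⟨rfl, ?_, by simp⟩⟩
    · obtain ⟨x1, x2⟩ := w1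
      norm_num at x2
      constructor <;> rw [e1] <;> simp [walkStart, Program.exec, x1, x2]
    · rw [e1]; simp [walkStart, Program.exec]
    · rw [e1]; simp [walkStart, Program.exec]
  obtain ⟨t2, s2, x, r2, ⟨P, F, d', e', hI⟩, hb, ht2⟩ := Runs.loop_rule
    (b := .eq (.reg 13) (.const 1)) (p := walkOutput ;; vertexStep ;; walkTest) 8 (by decide)
    (fun (x : ℕ × Bool) σ => ∃ P F d e, WalkState v G (s.reg 2) x.1 x.2 σ P F d e)
    -- The potential holds a budget T for each vertex not yet output, and none after the return to
    -- the start.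
    (fun x => (if x.2 then ((V : ℝ) - x.1) * T else 0) + 8)
    (fun x σ hI hb => by
      obtain ⟨P, F, d, e, hI⟩ := hI
      obtain ⟨m, go⟩ := x
      simp at hb
      have hgo : go = true := by
        rcases hI.flag with h1 | h1
        · exact h1.1
        · rw [h1.2.1] at hb; norm_num at hb
      subst hgo
      obtain ⟨tm, σ', go, P', F', d', e', hr, hW, ht⟩ := runs_walkRound hn hv hI
      refine ⟨tm, σ', (m + 1, go), hr, ⟨P', F', d', e', hW⟩, ?_⟩
      have hm : (m : ℝ) + 1 ≤ V := by exact_mod_cast hI.lt_numVertices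
      cases go
      · simp
        nlinarith
      · simp
        nlinarith) (fun x σ hI => by
      obtain ⟨P, F, d, e, hI⟩ := hI
      obtain ⟨m, go⟩ := x
      cases go
      · simp
      · have hm : (m : ℝ) + 1 ≤ V := by exact_mod_cast hI.lt_numVertices
        have : 0 ≤ ((V : ℝ) - m) * T := mul_nonneg (by linarith) hT0
        simpa using this) (x := (0, true)) ⟨_, _, _, _, hstart⟩
  obtain ⟨m, go⟩ := x
  have hflag : 1 ≤ m ∧ P m = P 0 := by
    rcases hI.flag with h1 | h1
    · exact absurd (by simp [h1.2.1]) hb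
    · exact h1.2.2
  obtain ⟨t3, s3, r3, ht3, e3⟩ := Program.runs_block (p := .assign 0 (.reg 12)) 2 s2
    (by decide) (by decide)
  refine ⟨_, s3, m, fun i => toPlane (P i), .seq r1 (.seq r2 r3), ⟨?_, ?_⟩,
    isVertexList_of_walk hI.edge hI.ne hflag.1 hflag.2 (fun j hj => hI.dir j hj.le)
      (fun j hj => hI.pointed j hj.le), ?_⟩
  · rw [e3]; simp [Program.exec, hI.count]
  · intro i
    rw [e3]
    simpa [Program.exec] using hI.out i i.2
  · have ht1' : (t1 : ℝ) ≤ 10 := by exact_mod_cast ht1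
    have ht3' : (t3 : ℝ) ≤ 2 := by exact_mod_cast ht3
    have hV : (0 : ℝ) ≤ V := Nat.cast_nonneg _
    simp at ht2
    push_cast
    nlinarith

end LatticeHull

/-! ## The shape of the polygon -/

namespace LatticeHull

open RealRAM

variable {n : ℕ} {v : Fin n → Plane}

/-- A loop over the vertices of the polygon, which are counted by register `36`. -/
def forVertices (body : Program) : Program :=
  .assign 36 (.const 0) ;;
  .loop (.lt (.reg 36) (.reg 1)) (body ;; .assign 36 (.reg 36 + .const 1))

theorem runs_forVertices {body : Program} (c : ℕ) (hfree : body.LoopFree = true)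
    (hcost : body.maxCost ≤ c) (Inv : ℕ → State → Prop)
    (hpoly : ∀ i σ, Inv i σ → HoldsPolygon v σ)
    (hset : ∀ i σ x, Inv i σ → Inv i (σ.setReg 36 x))
    (hbody : ∀ i < n, ∀ σ, Inv i σ → σ.reg 36 = i →
      Inv (i + 1) (body.exec σ) ∧ (body.exec σ).reg 36 = i) {s : State} (hs : Inv 0 s) :
    ∃ t s', Runs (forVertices body) s t s' ∧ Inv n s' ∧ (t : ℝ) ≤ n * (c + 8) + 6 := by
  obtain ⟨t1, s1, r1, ht1, e1⟩ := Program.runs_block (p := .assign 36 (.const 0)) 2 s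
    (by decide) (by decide)
  have hs1 : Inv 0 s1 := by
    rw [e1]; exact hset _ _ _ hs
  obtain ⟨t2, s2, k, r2, ⟨i, hI, h36, hk, hin⟩, hb, ht2⟩ := Runs.loop_count
    (b := .lt (.reg 36) (.reg 1)) (p := body ;; .assign 36 (.reg 36 + .const 1)) 4 (by decide)
    (fun k σ => ∃ i, Inv i σ ∧ σ.reg 36 = (i : ℕ) ∧ i + k = n ∧ i ≤ n) (c + 4) (by positivity)
    (fun k σ hI hb => by
      obtain ⟨i, hI, h36, hk, hin⟩ := hI
      have hi : i < n := by
        simp [h36, (hpoly i σ hI).num] at hb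
        exact hb
      obtain ⟨u1, σ1, q1, hu1, d1⟩ := Program.runs_block (p := body) c σ hfree hcost
      obtain ⟨u2, σ2, q2, hu2, d2⟩ := Program.runs_block
        (p := .assign 36 (.reg 36 + .const 1)) 4 σ1 (by decide) (by decide)
      obtain ⟨h1, h2⟩ := hbody i hi σ hI h36
      rw [← d1] at h1 h2
      have hu1' : (u1 : ℝ) ≤ c := by exact_mod_cast hu1
      have hu2' : (u2 : ℝ) ≤ 4 := by exact_mod_cast hu2
      refine ⟨_, σ2, k - 1, .seq q1 q2, ⟨i + 1, ?_, ?_, by omega, hi⟩, by omega,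
        by push_cast; linarith⟩
      · rw [d2]; exact hset _ _ _ h1
      · rw [d2]; simp [Program.exec, h2]) (k := n) ⟨0, hs1, by rw [e1]; simp [Program.exec],
        by omega, by omega⟩
  have hi : i = n := by
    have : ¬ i < n := by
      intro h
      apply hb
      simp [h36, (hpoly i s2 hI).num]
      exact h
    omega
  subst hi
  have ht1' : (t1 : ℝ) ≤ 2 := by exact_mod_cast ht1
  exact ⟨_, s2, .seq r1 r2, hI, by push_cast at ht2 ⊢; linarith⟩

/-- The vector from the first vertex to vertex number `i`. -/
noncomputable def arm {n : ℕ} (v : Fin n → Plane) (i : ℕ) : ℝ × ℝ :=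
  (vertex v i 0 - vertex v 0 0, vertex v i 1 - vertex v 0 1)

def loadArm : Program :=
  .assign 37 (.read 0 (.reg 36) - .read 0 (.const 0)) ;;
  .assign 38 (.read 1 (.reg 36) - .read 1 (.const 0))

theorem exec_loadArm {s : State} (hs : HoldsPolygon v s) {i : ℕ} (hi : s.reg 36 = i) :
    loadArm.exec s = (s.setReg 37 (arm v i).1).setReg 38 (arm v i).2 := by
  simp [loadArm, Program.exec, hi, hs.xs, hs.ys, arm, vertex]

/-- The longest arm u and the arm w with the largest determinant against u span a parallelogram of
the shape of the polygon, in the sense of `sq_le_of_parallelogram`. -/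
def farthestBody : Program :=
  loadArm ;;
  .ite (.lt (.reg 4) (.reg 37 * .reg 37 + .reg 38 * .reg 38))
    (.assign 4 (.reg 37 * .reg 37 + .reg 38 * .reg 38) ;; .assign 5 (.reg 37) ;;
      .assign 6 (.reg 38)) .skip

def widestBody : Program :=
  loadArm ;;
  .assign 39 ((.reg 5 * .reg 38 - .reg 6 * .reg 37) * (.reg 5 * .reg 38 - .reg 6 * .reg 37)) ;;
  .ite (.lt (.reg 9) (.reg 39))
    (.assign 9 (.reg 39) ;; .assign 7 (.reg 37) ;; .assign 8 (.reg 38)) .skip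

/-- The registers `5`, `6` hold the longest arm, and register `4` the square of its length. -/
structure Farthest {n : ℕ} (v : Fin n → Plane) (i : ℕ) (s : State) : Prop where
  poly : HoldsPolygon v s
  val : s.reg 4 = s.reg 5 ^ 2 + s.reg 6 ^ 2
  max : ∀ j < i, (arm v j).1 ^ 2 + (arm v j).2 ^ 2 ≤ s.reg 4
  mem : ∃ j < n, s.reg 5 = (arm v j).1 ∧ s.reg 6 = (arm v j).2

/-- Moreover, the registers `7`, `8` hold the arm farthest from the line of the longest one. -/
structure Widest {n : ℕ} (v : Fin n → Plane) (i : ℕ) (s : State) : Prop where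
  far : Farthest v n s
  val : s.reg 9 = (s.reg 5 * s.reg 8 - s.reg 6 * s.reg 7) ^ 2
  max : ∀ j < i, (s.reg 5 * (arm v j).2 - s.reg 6 * (arm v j).1) ^ 2 ≤ s.reg 9
  mem : ∃ j < n, s.reg 7 = (arm v j).1 ∧ s.reg 8 = (arm v j).2

theorem Farthest.congr {i : ℕ} {s s' : State} (h : Farthest v i s) (ha : s'.arr = s.arr)
    (h1 : s'.reg 1 = s.reg 1) (h4 : s'.reg 4 = s.reg 4) (h5 : s'.reg 5 = s.reg 5)
    (h6 : s'.reg 6 = s.reg 6) : Farthest v i s' :=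
  ⟨⟨h1.trans h.poly.num, by rw [ha, h.poly.xs], by rw [ha, h.poly.ys]⟩, by rw [h4, h5, h6, h.val],
    by rw [h4]; exact h.max, by rw [h5, h6]; exact h.mem⟩

theorem Widest.congr {i : ℕ} {s s' : State} (h : Widest v i s) (ha : s'.arr = s.arr)
    (hr : ∀ r, 1 ≤ r → r ≤ 9 → r ≠ 2 → r ≠ 3 → s'.reg r = s.reg r) : Widest v i s' := by
  have h5 := hr 5 (by norm_num) (by norm_num) (by norm_num) (by norm_num)
  have h6 := hr 6 (by norm_num) (by norm_num) (by norm_num) (by norm_num)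
  have h7 := hr 7 (by norm_num) (by norm_num) (by norm_num) (by norm_num)
  have h8 := hr 8 (by norm_num) (by norm_num) (by norm_num) (by norm_num)
  have h9 := hr 9 (by norm_num) (by norm_num) (by norm_num) (by norm_num)
  exact ⟨h.far.congr ha (hr 1 (by norm_num) (by norm_num) (by norm_num) (by norm_num))
    (hr 4 (by norm_num) (by norm_num) (by norm_num) (by norm_num)) h5 h6,
    by rw [h5, h6, h7, h8, h9, h.val], by rw [h5, h6, h9]; exact h.max,
    by rw [h7, h8]; exact h.mem⟩

theorem runs_farthest (hn : 3 ≤ n) {s : State} (hs : HoldsPolygon v s) (h4 : s.reg 4 = 0)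
    (h5 : s.reg 5 = 0) (h6 : s.reg 6 = 0) :
    ∃ t s', Runs (forVertices farthestBody) s t s' ∧ Farthest v n s' ∧ (t : ℝ) ≤ 68 * n + 6 := by
  obtain ⟨t, s', hr, hI, ht⟩ := runs_forVertices (v := v) (body := farthestBody) 60 (by decide)
    (by decide) (Farthest v) (fun i σ h => h.poly)
    (fun i σ x h => h.congr rfl (by simp) (by simp) (by simp) (by simp))
    (fun i hi σ h h36 => by
      have e : farthestBody.exec σ = if σ.reg 4 < (arm v i).1 ^ 2 + (arm v i).2 ^ 2 then
          (((((σ.setReg 37 (arm v i).1).setReg 38 (arm v i).2).setReg 4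
            ((arm v i).1 ^ 2 + (arm v i).2 ^ 2)).setReg 5 (arm v i).1).setReg 6 (arm v i).2) else
          (σ.setReg 37 (arm v i).1).setReg 38 (arm v i).2 := by
        simp [farthestBody, Program.exec, exec_loadArm h.poly h36, pow_two]
      rw [e]
      split_ifs with hc
      · refine ⟨⟨⟨by simp [h.poly.num], h.poly.xs, h.poly.ys⟩, by simp, ?_,
          i, hi, by simp, by simp⟩, by simp [h36]⟩
        intro j hj
        simp
        rcases eq_or_lt_of_le (show j ≤ i by omega) with h1 | h1
        · rw [h1]
        · exact (h.max j h1).trans hc.le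
      · refine ⟨⟨⟨by simp [h.poly.num], h.poly.xs, h.poly.ys⟩, by simpa using h.val, ?_,
          by simpa using h.mem⟩, by simp [h36]⟩
        intro j hj
        simp
        rcases eq_or_lt_of_le (show j ≤ i by omega) with h1 | h1
        · rw [h1]; exact not_lt.1 hc
        · exact h.max j h1) (s := s)
    ⟨hs, by simp [h4, h5, h6], by simp, 0, by omega, by simp [h5, arm], by simp [h6, arm]⟩
  exact ⟨t, s', hr, hI, by norm_num at ht; linarith⟩

theorem runs_widest (hn : 3 ≤ n) {s : State} (hs : Farthest v n s) (h7 : s.reg 7 = 0)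
    (h8 : s.reg 8 = 0) (h9 : s.reg 9 = 0) :
    ∃ t s', Runs (forVertices widestBody) s t s' ∧ Widest v n s' ∧ (t : ℝ) ≤ 68 * n + 6 := by
  obtain ⟨t, s', hr, hI, ht⟩ := runs_forVertices (v := v) (body := widestBody) 60 (by decide)
    (by decide) (Widest v) (fun i σ h => h.far.poly)
    (fun i σ x h => h.congr rfl (fun r _ _ _ _ => by simp; omega))
    (fun i hi σ h h36 => by
      set D := (σ.reg 5 * (arm v i).2 - σ.reg 6 * (arm v i).1) ^ 2 with hD
      have e : widestBody.exec σ = if σ.reg 9 < D then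
          (((((σ.setReg 37 (arm v i).1).setReg 38 (arm v i).2).setReg 39 D).setReg 9 D).setReg 7
            (arm v i).1).setReg 8 (arm v i).2 else
          ((σ.setReg 37 (arm v i).1).setReg 38 (arm v i).2).setReg 39 D := by
        simp [widestBody, Program.exec, exec_loadArm h.far.poly h36, pow_two, hD]
      rw [e]
      split_ifs with hc
      · refine ⟨⟨h.far.congr rfl (by simp) (by simp) (by simp) (by simp), by simp [hD], ?_,
          i, hi, by simp, by simp⟩, by simp [h36]⟩
        intro j hj
        simp
        rcases eq_or_lt_of_le (show j ≤ i by omega) with h1 | h1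
        · rw [h1]
        · exact (h.max j h1).trans hc.le
      · refine ⟨⟨h.far.congr rfl (by simp) (by simp) (by simp) (by simp), by simpa using h.val, ?_,
          by simpa using h.mem⟩, by simp [h36]⟩
        intro j hj
        simp
        rcases eq_or_lt_of_le (show j ≤ i by omega) with h1 | h1
        · rw [h1]; exact not_lt.1 hc
        · exact h.max j h1) (s := s)
    ⟨hs, by simp [h7, h8, h9], by simp, 0, by omega, by simp [h7, arm], by simp [h8, arm]⟩
  exact ⟨t, s', hr, hI, by norm_num at ht; linarith⟩

/-! ### Consequences for the polygon -/

/-- A linear inequality holds in the polygon if it holds at the vertices. -/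
theorem polygon_le {a b c : ℝ} (h : ∀ i < n, a * vertex v i 0 + b * vertex v i 1 ≤ c) :
    ∀ z ∈ polygon v, a * z 0 + b * z 1 ≤ c := by
  intro z hz
  refine convexHull_min (s := Set.range v) (t := {z : Plane | a * z 0 + b * z 1 ≤ c}) ?_ ?_ hz
  · rintro _ ⟨i, rfl⟩
    have := h i i.2
    rwa [vertex_eq v i.2] at this
  · intro x hx y hy s t hs ht hst
    simp only [Set.mem_ofPred_eq] at hx hy ⊢
    simp
    have h1 := mul_le_mul_of_nonneg_left hx hs
    have h2 := mul_le_mul_of_nonneg_left hy ht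
    have h3 : s * c + t * c = c := by rw [← add_mul, hst, one_mul]
    linarith

theorem dist_sq (x y : Plane) : dist x y ^ 2 = (x 0 - y 0) ^ 2 + (x 1 - y 1) ^ 2 := by
  rw [EuclideanSpace.dist_eq, Real.sq_sqrt (by positivity)]
  simp [Fin.sum_univ_two, Real.dist_eq, sq_abs]

/-- With R the squared length of the longest arm, the polygon lies in a disc of radius √R, and 2√R ≤
R + 1. The cruder bound R + 1 needs no square root and costs only a constant factor in logarithms.
-/
theorem Farthest.diam_le {s : State} (h : Farthest v n s) :
    ∀ x ∈ polygon v, ∀ y ∈ polygon v,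
      (x 0 - y 0) ^ 2 + (x 1 - y 1) ^ 2 ≤ (s.reg 4 + 1) ^ 2 := by
  have hR : 0 ≤ s.reg 4 := by rw [h.val]; positivity
  have hball : polygon v ⊆ Metric.closedBall (vertex v 0) (Real.sqrt (s.reg 4)) := by
    refine convexHull_min ?_ (convex_closedBall _ _)
    rintro _ ⟨i, rfl⟩
    rw [Metric.mem_closedBall]
    refine Real.le_sqrt_of_sq_le ?_
    rw [dist_sq, ← vertex_eq v i.2]
    exact h.max i i.2
  intro x hx y hy
  have h1 : dist x y ≤ 2 * Real.sqrt (s.reg 4) := by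
    have h2 := Metric.mem_closedBall.1 (hball hx)
    have h3 := Metric.mem_closedBall.1 (hball hy)
    have := dist_triangle_right x y (vertex v 0)
    linarith
  rw [← dist_sq]
  have h4 : dist x y ^ 2 ≤ (2 * Real.sqrt (s.reg 4)) ^ 2 := by gcongr
  rw [mul_pow, Real.sq_sqrt hR] at h4
  nlinarith [sq_nonneg (s.reg 4 - 1)]

theorem Farthest.le_diam (hn : 3 ≤ n) {s : State} (h : Farthest v n s) :
    s.reg 4 ≤ Metric.diam (polygon v) ^ 2 := by
  obtain ⟨j, hj, h5, h6⟩ := h.mem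
  have hb : Bornology.IsBounded (polygon v) :=
    isBounded_convexHull.2 (Set.finite_range v).isBounded
  have h1 := Metric.dist_le_diam_of_mem hb (vertex_mem v hj) (vertex_mem v (show 0 < n by omega))
  have h2 : s.reg 4 = dist (vertex v j) (vertex v 0) ^ 2 := by
    rw [dist_sq, h.val, h5, h6]; simp [arm]
  rw [h2]
  gcongr

theorem Widest.det_ne_zero (hn : 3 ≤ n) (hv : IsCounterclockwise v) {s : State}
    (h : Widest v n s) : s.reg 5 * s.reg 8 - s.reg 6 * s.reg 7 ≠ 0 := by
  intro h0
  have h9 : s.reg 9 = 0 := by rw [h.val, h0]; norm_num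
  have hz : ∀ j < n, s.reg 5 * (arm v j).2 - s.reg 6 * (arm v j).1 = 0 := by
    intro j hj
    have := h.max j hj
    rw [h9] at this
    exact pow_eq_zero_iff (two_ne_zero) |>.1 (le_antisymm this (sq_nonneg _))
  have h1 := hz 1 (by omega)
  have h2 := hz 2 (by omega)
  have hor : 0 < (arm v 1).1 * (arm v 2).2 - (arm v 1).2 * (arm v 2).1 := by
    have := hv ⟨0, by omega⟩ ⟨1, by omega⟩ ⟨2, by omega⟩ (by simp) (by simp)
    simp only [orientation] at this
    rw [← vertex_eq v (show 0 < n by omega), ← vertex_eq v (show 1 < n by omega),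
      ← vertex_eq v (show 2 < n by omega)] at this
    simpa [arm] using this
  have hle := h.far.max 1 (by omega)
  rw [h.far.val] at hle
  have hpos : 0 < s.reg 5 ^ 2 + s.reg 6 ^ 2 := by
    refine lt_of_lt_of_le ?_ hle
    by_contra hc
    have a1 : (arm v 1).1 = 0 := by nlinarith [sq_nonneg (arm v 1).1, sq_nonneg (arm v 1).2]
    have a2 : (arm v 1).2 = 0 := by nlinarith [sq_nonneg (arm v 1).1, sq_nonneg (arm v 1).2]
    rw [a1, a2] at hor
    simp at hor
  have : (s.reg 5 ^ 2 + s.reg 6 ^ 2) *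
      ((arm v 1).1 * (arm v 2).2 - (arm v 1).2 * (arm v 2).1) = 0 := by
    linear_combination ((arm v 1).1 * s.reg 5 + (arm v 1).2 * s.reg 6) * h2 -
      ((arm v 2).1 * s.reg 5 + (arm v 2).2 * s.reg 6) * h1
  have := mul_pos hpos hor
  linarith

/-- Write z = s u + t w. The choice of w gives |t| ≤ 1, and then |s u| = |z - t w| ≤ 2|u| gives |s|
≤ 2. Cauchy-Schwarz yields the factor 5; it is relaxed to the square 9. -/
theorem sq_le_of_parallelogram {u1 u2 w1 w2 z1 z2 a b : ℝ} (hdet : u1 * w2 - u2 * w1 ≠ 0)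
    (hz : z1 ^ 2 + z2 ^ 2 ≤ u1 ^ 2 + u2 ^ 2) (hw : w1 ^ 2 + w2 ^ 2 ≤ u1 ^ 2 + u2 ^ 2)
    (hdz : (u1 * z2 - u2 * z1) ^ 2 ≤ (u1 * w2 - u2 * w1) ^ 2) :
    (a * z1 + b * z2) ^ 2 ≤ 9 * ((a * u1 + b * u2) ^ 2 + (a * w1 + b * w2) ^ 2) := by
  set D := u1 * w2 - u2 * w1 with hD
  set t := (u1 * z2 - u2 * z1) / D with ht
  set s := (z1 * w2 - z2 * w1) / D with hs
  have e1 : z1 = s * u1 + t * w1 := by rw [hs, ht]; field_simp; rw [hD]; ring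
  have e2 : z2 = s * u2 + t * w2 := by rw [hs, ht]; field_simp; rw [hD]; ring
  have ht1 : t ^ 2 ≤ 1 := by
    rw [ht, div_pow, div_le_one (by positivity)]; exact hdz
  have hu : 0 < u1 ^ 2 + u2 ^ 2 := by
    by_contra hc
    have a1 : u1 = 0 := by nlinarith [sq_nonneg u1, sq_nonneg u2]
    have a2 : u2 = 0 := by nlinarith [sq_nonneg u1, sq_nonneg u2]
    apply hdet
    rw [hD, a1, a2]; ring
  have hs1 : s ^ 2 ≤ 4 := by
    have h1 : s ^ 2 * (u1 ^ 2 + u2 ^ 2) = (z1 - t * w1) ^ 2 + (z2 - t * w2) ^ 2 := by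
      rw [e1, e2]; ring
    have h2 : (z1 - t * w1) ^ 2 + (z2 - t * w2) ^ 2 ≤
        2 * (z1 ^ 2 + z2 ^ 2) + 2 * (t ^ 2 * (w1 ^ 2 + w2 ^ 2)) := by
      nlinarith [sq_nonneg (z1 + t * w1), sq_nonneg (z2 + t * w2)]
    have h3 : t ^ 2 * (w1 ^ 2 + w2 ^ 2) ≤ 1 * (u1 ^ 2 + u2 ^ 2) := by gcongr
    have h4 : s ^ 2 * (u1 ^ 2 + u2 ^ 2) ≤ 4 * (u1 ^ 2 + u2 ^ 2) := by linarith
    exact le_of_mul_le_mul_right h4 hu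
  set A := a * u1 + b * u2 with hA
  set B := a * w1 + b * w2 with hB
  have e3 : a * z1 + b * z2 = s * A + t * B := by rw [e1, e2, hA, hB]; ring
  rw [e3]
  have h5 : (s * A + t * B) ^ 2 ≤ (s ^ 2 + t ^ 2) * (A ^ 2 + B ^ 2) := by
    nlinarith [sq_nonneg (s * B - t * A)]
  have h6 : (s ^ 2 + t ^ 2) * (A ^ 2 + B ^ 2) ≤ 9 * (A ^ 2 + B ^ 2) := by
    gcongr; linarith
  exact h5.trans h6

/-- The quadratic form that measures the extent of the polygon in the direction of a functional. -/
noncomputable def extent (s : State) (y : ℤ × ℤ) : ℝ :=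
  (y.1 * s.reg 5 + y.2 * s.reg 6) ^ 2 + (y.1 * s.reg 7 + y.2 * s.reg 8) ^ 2

/-- The value of an integer functional. -/
noncomputable def level (y : ℤ × ℤ) (z : Plane) : ℝ := y.1 * z 0 + y.2 * z 1

theorem level_toPlane (y z : ℤ × ℤ) : level y (toPlane z) = (dot y z : ℤ) := by
  simp [level, dot]

theorem Widest.level_sub_le (hn : 3 ≤ n) (hv : IsCounterclockwise v) {s : State}
    (h : Widest v n s) (y : ℤ × ℤ) {i : ℕ} (hi : i < n) :
    (level y (vertex v i) - level y (vertex v 0)) ^ 2 ≤ 9 * extent s y := by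
  have e : level y (vertex v i) - level y (vertex v 0) = y.1 * (arm v i).1 + y.2 * (arm v i).2 := by
    simp only [level, arm]; ring
  rw [e]
  refine sq_le_of_parallelogram (h.det_ne_zero hn hv) ?_ ?_ ?_
  · rw [← h.far.val]; exact h.far.max i hi
  · obtain ⟨j, hj, h7, h8⟩ := h.mem
    rw [← h.far.val, h7, h8]; exact h.far.max j hj
  · rw [← h.val]; exact h.max i hi

end LatticeHull

/-! ## Initialization and lattice reduction -/

namespace LatticeHull

open RealRAM

variable {n : ℕ} {v : Fin n → Plane}

def clearWidest : Program :=
  .assign 7 (.const 0) ;; .assign 8 (.const 0) ;; .assign 9 (.const 0)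

def setBounds : Program :=
  .assign 3 (.floor (.reg 4 + .const 1) + .const 3) ;;
  .assign 2 (.const 40 * ((.reg 4 + .const 1) * ((.reg 4 + .const 1) * (.reg 4 + .const 1))))

/-- Compute two long vectors in the polygon and the bounds for the searches. -/
def setup : Program :=
  .assign 1 (.reg 0) ;; forVertices farthestBody ;; clearWidest ;; forVertices widestBody ;;
  setBounds

theorem runs_setup (hn : 3 ≤ n) :
    ∃ t s, Runs setup (inputState v) t s ∧ Widest v n s ∧ s.reg 2 = 40 * (s.reg 4 + 1) ^ 3 ∧
      Bounds v s (s.reg 4 + 1) ∧ (t : ℝ) ≤ 136 * n + 50 := by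
  obtain ⟨t1, s1, r1, ht1, e1⟩ := Program.runs_block (p := .assign 1 (.reg 0)) 2 (inputState v)
    (by decide) (by decide)
  have hp : HoldsPolygon v s1 :=
    ⟨by rw [e1]; simp [Program.exec, inputState], by rw [e1]; rfl, by rw [e1]; rfl⟩
  obtain ⟨t2, s2, r2, h2, ht2⟩ := runs_farthest hn hp (by rw [e1]; simp [Program.exec, inputState])
    (by rw [e1]; simp [Program.exec, inputState]) (by rw [e1]; simp [Program.exec, inputState])
  obtain ⟨t3, s3, r3, ht3, e3⟩ := Program.runs_block (p := clearWidest) 6 s2 (by decide) (by decide)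
  have h3 : Farthest v n s3 := by
    rw [e3]
    exact h2.congr rfl (by simp [clearWidest, Program.exec]) (by simp [clearWidest, Program.exec])
      (by simp [clearWidest, Program.exec]) (by simp [clearWidest, Program.exec])
  obtain ⟨t4, s4, r4, h4, ht4⟩ := runs_widest hn h3 (by rw [e3]; simp [clearWidest, Program.exec])
    (by rw [e3]; simp [clearWidest, Program.exec]) (by rw [e3]; simp [clearWidest, Program.exec])
  obtain ⟨t5, s5, r5, ht5, e5⟩ := Program.runs_block (p := setBounds) 25 s4 (by decide) (by decide)
  have h5 : Widest v n s5 := by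
    rw [e5]
    refine h4.congr rfl fun r _ _ h2 h3 => ?_
    simp [setBounds, Program.exec, h2, h3]
  have hR : 0 ≤ s5.reg 4 := by rw [h5.far.val]; positivity
  have e54 : s5.reg 4 = s4.reg 4 := by rw [e5]; simp [setBounds, Program.exec]
  have e52 : s5.reg 2 = 40 * (s5.reg 4 + 1) ^ 3 := by
    rw [e54, e5]; simp [setBounds, Program.exec]; ring
  have e53 : s5.reg 3 = (⌊s5.reg 4 + 1⌋ + 3 : ℤ) := by
    rw [e54, e5]; simp [setBounds, Program.exec]
  refine ⟨_, s5, .seq r1 (.seq r2 (.seq r3 (.seq r4 r5))), h5, e52,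
    ⟨by linarith, h5.far.diam_le, ⟨_, e53, ?_, ?_⟩, ?_⟩, ?_⟩
  · have := Int.lt_floor_add_one (s5.reg 4 + 1)
    push_cast at this ⊢; linarith
  · have := Int.floor_le (s5.reg 4 + 1)
    push_cast at this ⊢; linarith
  · rw [e52]
    have : 0 ≤ (s5.reg 4 + 1) ^ 3 := by positivity
    linarith
  · have a1 : (t1 : ℝ) ≤ 2 := by exact_mod_cast ht1
    have a3 : (t3 : ℝ) ≤ 6 := by exact_mod_cast ht3
    have a5 : (t5 : ℝ) ≤ 25 := by exact_mod_cast ht5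
    push_cast
    linarith

/-! ### Lattice reduction -/

/-- The bilinear form that belongs to `extent`. -/
noncomputable def pairing (s : State) (y z : ℤ × ℤ) : ℝ :=
  (y.1 * s.reg 5 + y.2 * s.reg 6) * (z.1 * s.reg 5 + z.2 * s.reg 6) +
    (y.1 * s.reg 7 + y.2 * s.reg 8) * (z.1 * s.reg 7 + z.2 * s.reg 8)

/-- Lagrange's identity. The determinant of the quadratic form is the same in all bases of
determinant 1. -/
theorem extent_mul_extent (s : State) {y z : ℤ × ℤ} (h : cross y z = 1) :
    extent s y * extent s z =
      pairing s y z ^ 2 + (s.reg 5 * s.reg 8 - s.reg 6 * s.reg 7) ^ 2 := by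
  have h' : (y.1 : ℝ) * z.2 - y.2 * z.1 = 1 := by exact_mod_cast h
  simp only [extent, pairing]
  linear_combination (s.reg 5 * s.reg 8 - s.reg 6 * s.reg 7) ^ 2 *
    ((y.1 : ℝ) * z.2 - y.2 * z.1 + 1) * h'

theorem extent_nonneg (s : State) (y : ℤ × ℤ) : 0 ≤ extent s y := by
  simp only [extent]; positivity

theorem extent_pos {s : State} (hs : s.reg 5 * s.reg 8 - s.reg 6 * s.reg 7 ≠ 0) {y z : ℤ × ℤ}
    (h : cross y z = 1) : 0 < extent s y := by
  refine lt_of_le_of_ne (extent_nonneg s y) fun h0 => ?_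
  have h1 := extent_mul_extent s h
  rw [← h0] at h1
  have : 0 < (s.reg 5 * s.reg 8 - s.reg 6 * s.reg 7) ^ 2 := by positivity
  nlinarith [sq_nonneg (pairing s y z)]

theorem extent_sub_smul (s : State) (y z : ℤ × ℤ) (q : ℤ) :
    extent s (z - q • y) = extent s z - 2 * q * pairing s y z + q ^ 2 * extent s y := by
  simp [extent, pairing]; ring

theorem pairing_sub_smul (s : State) (y z : ℤ × ℤ) (q : ℤ) :
    pairing s y (z - q • y) = pairing s y z - q * extent s y := by
  simp [extent, pairing]; ring

/-- Reduce the vector in the registers `16`, `17` by the vector in the registers `14`, `15`. -/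
def reduce : Program :=
  (.assign 33 (.reg 14 * .reg 5 + .reg 15 * .reg 6) ;;
   .assign 34 (.reg 14 * .reg 7 + .reg 15 * .reg 8) ;;
   .assign 35 (.reg 16 * .reg 5 + .reg 17 * .reg 6) ;;
   .assign 36 (.reg 16 * .reg 7 + .reg 17 * .reg 8) ;;
   .assign 37 (.reg 33 * .reg 33 + .reg 34 * .reg 34) ;;
   .assign 38 (.floor ((.reg 33 * .reg 35 + .reg 34 * .reg 36) / .reg 37 +
    .const 1 / .const 2))) ;;
  (.assign 16 (.reg 16 - .reg 38 * .reg 14) ;; .assign 17 (.reg 17 - .reg 38 * .reg 15) ;;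
   .assign 35 (.reg 35 - .reg 38 * .reg 33) ;; .assign 36 (.reg 36 - .reg 38 * .reg 34) ;;
   .assign 39 (.reg 35 * .reg 35 + .reg 36 * .reg 36))

def swapBasis : Program :=
  .assign 18 (.reg 14) ;; .assign 19 (.reg 15) ;; .assign 14 (.reg 16) ;; .assign 15 (.reg 17) ;;
  .assign 16 (.const 0 - .reg 18) ;; .assign 17 (.const 0 - .reg 19)

def startBasis : Program :=
  .assign 14 (.const 1) ;; .assign 15 (.const 0) ;; .assign 16 (.const 0) ;; .assign 17 (.const 1)

/-- Find a basis of the lattice of functionals whose first member is short. -/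
def gauss : Program :=
  startBasis ;; reduce ;;
  .loop (.and (.lt (.const 1) (.reg 37)) (.lt (.reg 39 + .reg 39) (.reg 37)))
    (swapBasis ;; reduce)

/-- The store `σ` arises from `s` and holds a basis `y`, `z` of integer functionals. -/
structure HasBasis (s σ : State) (B : ℝ) (y z : ℤ × ℤ) : Prop where
  agree : Agree 14 s σ
  fst : HasVec σ 14 y
  snd : HasVec σ 16 z
  det : cross y z = 1
  fst_le : extent s y ≤ B
  snd_le : extent s z ≤ B

structure HasReducedBasis (s σ : State) (B : ℝ) (y z : ℤ × ℤ) : Prop extends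
    HasBasis s σ B y z where
  sq_fst : σ.reg 37 = extent s y
  sq_snd : σ.reg 39 = extent s z
  pairing_le : 4 * pairing s y z ^ 2 ≤ extent s y ^ 2

/-- The multiplier q is the integer nearest to pairing/extent, so the remaining pairing is at most
half the extent of y, and subtracting q y does not increase the extent of z. The bound B thus
persists for both vectors. -/
theorem HasBasis.reduce {s σ : State} {B : ℝ} {y z : ℤ × ℤ}
    (hs : s.reg 5 * s.reg 8 - s.reg 6 * s.reg 7 ≠ 0) (h : HasBasis s σ B y z) :
    ∃ z', HasReducedBasis s (reduce.exec σ) B y z' := by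
  obtain ⟨y1, y2⟩ := h.fst
  obtain ⟨z1, z2⟩ := h.snd
  norm_num at y2 z2
  have g5 := h.agree.1 5 (by norm_num)
  have g6 := h.agree.1 6 (by norm_num)
  have g7 := h.agree.1 7 (by norm_num)
  have g8 := h.agree.1 8 (by norm_num)
  have hE := extent_pos hs h.det
  set q : ℤ := ⌊pairing s y z / extent s y + 1 / 2⌋ with hq
  have hr1 : q * extent s y ≤ pairing s y z + extent s y / 2 := by
    have := Int.floor_le (pairing s y z / extent s y + 1 / 2)
    rw [← hq] at this
    have := mul_le_mul_of_nonneg_right this hE.le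
    field_simp at this
    linarith
  have hr2 : pairing s y z - extent s y / 2 ≤ q * extent s y := by
    have := (Int.lt_floor_add_one (pairing s y z / extent s y + 1 / 2)).le
    rw [← hq] at this
    have := mul_le_mul_of_nonneg_right this hE.le
    field_simp at this
    linarith
  have h38 : ⌊(((y.1 : ℝ) * s.reg 5 + y.2 * s.reg 6) * (z.1 * s.reg 5 + z.2 * s.reg 6) +
      (y.1 * s.reg 7 + y.2 * s.reg 8) * (z.1 * s.reg 7 + z.2 * s.reg 8)) /
      ((y.1 * s.reg 5 + y.2 * s.reg 6) * (y.1 * s.reg 5 + y.2 * s.reg 6) +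
      (y.1 * s.reg 7 + y.2 * s.reg 8) * (y.1 * s.reg 7 + y.2 * s.reg 8)) + 2⁻¹⌋ = q := by
    rw [hq]; congr 1; simp only [pairing, extent]; norm_num [pow_two]
  refine ⟨z - q • y, ⟨h.agree.trans (k' := 14) ?_ le_rfl, ⟨?_, ?_⟩, ⟨?_, ?_⟩, ?_, h.fst_le, ?_⟩,
    ?_, ?_, ?_⟩
  · exact ⟨fun r hr => by
      simp [LatticeHull.reduce, Program.exec, show r ≠ 33 by omega, show r ≠ 34 by omega,
        show r ≠ 35 by omega, show r ≠ 36 by omega, show r ≠ 37 by omega, show r ≠ 38 by omega,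
        show r ≠ 39 by omega, show r ≠ 16 by omega, show r ≠ 17 by omega],
      by simp [LatticeHull.reduce, Program.exec]⟩
  · simp [LatticeHull.reduce, Program.exec, y1]
  · simp [LatticeHull.reduce, Program.exec, y2]
  · simp [LatticeHull.reduce, Program.exec, y1, y2, z1, z2, g5, g6, g7, g8, h38]
  · simp [LatticeHull.reduce, Program.exec, y1, y2, z1, z2, g5, g6, g7, g8, h38]
  · have := h.det
    simp only [cross] at this ⊢
    simp; linear_combination this
  · rw [extent_sub_smul]
    refine le_trans ?_ h.snd_le
    rcases le_or_gt q 0 with h0 | h0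
    · rcases eq_or_lt_of_le h0 with h1 | h1
      · simp [h1]
      · have h2 : (q : ℝ) ≤ -1 := by exact_mod_cast Int.le_sub_one_of_lt h1
        have h3 : 0 ≤ (-1 - (q : ℝ)) * extent s y := mul_nonneg (by linarith) hE.le
        have h4 : 0 ≤ (-(q : ℝ)) * (q * extent s y - 2 * pairing s y z) :=
          mul_nonneg (by linarith) (by linarith)
        linarith
    · have h2 : (1 : ℝ) ≤ q := by exact_mod_cast h0
      have h3 : 0 ≤ ((q : ℝ) - 1) * extent s y := mul_nonneg (by linarith) hE.le
      have h4 : 0 ≤ (q : ℝ) * (2 * pairing s y z - q * extent s y) :=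
        mul_nonneg (by linarith) (by linarith)
      linarith
  · simp [LatticeHull.reduce, Program.exec, y1, y2, g5, g6, g7, g8, extent]; ring
  · simp [LatticeHull.reduce, Program.exec, y1, y2, z1, z2, g5, g6, g7, g8, h38, extent]; ring
  · rw [pairing_sub_smul]
    nlinarith

/-- Each swap more than halves the extent of the first vector. Stopping at extent 1 keeps the number
of rounds logarithmic in B even when the polygon is arbitrarily thin. At the other exit, Q(y) ≤ 2
Q(z) and 4 pairing² ≤ Q(y)², put into Lagrange's identity, give Q(y)² ≤ 2 pairing² + 2D² + ... in
the form Q(y)² ≤ 4D², where Q is the extent and D the determinant of the two arms. -/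
theorem runs_gauss {s : State} (hs : s.reg 5 * s.reg 8 - s.reg 6 * s.reg 7 ≠ 0) {B : ℝ}
    (hB1 : extent s (1, 0) ≤ B) (hB2 : extent s (0, 1) ≤ B) {k : ℕ} (hk : B < 2 ^ k) :
    ∃ t s' y z, Runs gauss s t s' ∧ HasBasis s s' B y z ∧
      (extent s y ≤ 1 ∨ extent s y ^ 2 ≤ 4 * (s.reg 5 * s.reg 8 - s.reg 6 * s.reg 7) ^ 2) ∧
      (t : ℝ) ≤ 120 * k + 120 := by
  obtain ⟨t1, s1, r1, ht1, e1⟩ := Program.runs_block (p := startBasis) 8 s (by decide) (by decide)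
  have h1 : HasBasis s s1 B (1, 0) (0, 1) := by
    refine ⟨⟨fun r hr => ?_, by rw [e1]; rfl⟩, ?_, ?_, by simp [cross], hB1, hB2⟩
    · rw [e1]
      simp [startBasis, Program.exec, show r ≠ 14 by omega, show r ≠ 15 by omega,
        show r ≠ 16 by omega, show r ≠ 17 by omega]
    · rw [e1]; constructor <;> simp [startBasis, Program.exec]
    · rw [e1]; constructor <;> simp [startBasis, Program.exec]
  obtain ⟨t2, s2, r2, ht2, e2⟩ := Program.runs_block (p := reduce) 90 s1 (by decide) (by decide)
  have h2 := h1.reduce hs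
  rw [← e2] at h2
  obtain ⟨t3, s3, k', r3, ⟨y, z, h3, -⟩, hb, ht3⟩ := Runs.loop_count
    (b := .and (.lt (.const 1) (.reg 37)) (.lt (.reg 39 + .reg 39) (.reg 37)))
    (p := swapBasis ;; reduce) 12 (by decide)
    (fun k σ => ∃ y z, HasReducedBasis s σ B y z ∧ extent s y < 2 ^ k) 108 (by norm_num)
    (fun k σ hI hb => by
      obtain ⟨y, z, hI, hk⟩ := hI
      simp [hI.sq_fst, hI.sq_snd] at hb
      obtain ⟨u1, σ1, q1, hu1, d1⟩ := Program.runs_block (p := swapBasis) 18 σ (by decide)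
        (by decide)
      have h1 : HasBasis s σ1 B z (-y) := by
        obtain ⟨y1, y2⟩ := hI.fst
        obtain ⟨z1, z2⟩ := hI.snd
        norm_num at y2 z2
        refine ⟨hI.agree.trans (k' := 14) ⟨fun r hr => ?_, by rw [d1]; rfl⟩ le_rfl, ?_, ?_, ?_,
          hI.snd_le, ?_⟩
        · rw [d1]
          simp [swapBasis, Program.exec, show r ≠ 14 by omega, show r ≠ 15 by omega,
            show r ≠ 16 by omega, show r ≠ 17 by omega, show r ≠ 18 by omega,
            show r ≠ 19 by omega]
        · rw [d1]; constructor <;> simp [swapBasis, Program.exec, z1, z2]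
        · rw [d1]; constructor <;> simp [swapBasis, Program.exec, y1, y2]
        · have := hI.det
          simp only [cross] at this ⊢
          simp; linear_combination this
        · have : extent s (-y) = extent s y := by simp [extent]; ring
          rw [this]; exact hI.fst_le
      obtain ⟨u2, σ2, q2, hu2, d2⟩ := Program.runs_block (p := reduce) 90 σ1 (by decide) (by decide)
      have h2 := h1.reduce hs
      rw [← d2] at h2
      obtain ⟨z', h2⟩ := h2
      have hk0 : k ≠ 0 := by
        rintro rfl
        norm_num at hk
        linarith [hb.1]
      obtain ⟨j, rfl⟩ := Nat.exists_eq_succ_of_ne_zero hk0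
      refine ⟨_, σ2, j, .seq q1 q2, ⟨_, _, h2, ?_⟩, by omega, ?_⟩
      · rw [pow_succ] at hk
        linarith [hb.2]
      · have : ((u1 + u2 : ℕ) : ℝ) ≤ 108 := by exact_mod_cast (by omega : u1 + u2 ≤ 108)
        exact this) (k := k) (by
      obtain ⟨z, h2⟩ := h2
      exact ⟨_, z, h2, hB1.trans_lt hk⟩)
  refine ⟨_, s3, y, z, .seq r1 (.seq r2 r3), h3.toHasBasis, ?_, ?_⟩
  · simp [h3.sq_fst, h3.sq_snd] at hb
    rcases le_or_gt (extent s y) 1 with h4 | h4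
    · exact Or.inl h4
    · right
      have h5 := hb h4
      have h6 := extent_mul_extent s h3.det
      have h7 := h3.pairing_le
      have h8 := extent_nonneg s y
      nlinarith
  · have a1 : (t1 : ℝ) ≤ 8 := by exact_mod_cast ht1
    have a2 : (t2 : ℝ) ≤ 90 := by exact_mod_cast ht2
    push_cast at ht3 ⊢
    linarith

/-! ### The range of two functionals -/

def rangeBody : Program :=
  (.assign 37 (.reg 14 * .read 0 (.reg 36) + .reg 15 * .read 1 (.reg 36)) ;;
   .assign 38 (.reg 16 * .read 0 (.reg 36) + .reg 17 * .read 1 (.reg 36))) ;;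
  .ite (.lt (.reg 37) (.reg 31)) (.assign 31 (.reg 37)) .skip ;;
  .ite (.lt (.reg 32) (.reg 37)) (.assign 32 (.reg 37)) .skip ;;
  .ite (.lt (.reg 38) (.reg 33)) (.assign 33 (.reg 38)) .skip

def startRange : Program :=
  .assign 31 (.reg 14 * .read 0 (.const 0) + .reg 15 * .read 1 (.const 0)) ;;
  .assign 32 (.reg 31) ;;
  .assign 33 (.reg 16 * .read 0 (.const 0) + .reg 17 * .read 1 (.const 0))

/-- Compute the range of the functional in the registers `14`, `15` and the minimum of the functional
in the registers `16`, `17`. -/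
def range : Program := startRange ;; forVertices rangeBody

/-- The registers `31`, `32`, `33` hold the range of `y` and the minimum of `z` on the first `i`
vertices. -/
structure HasRange {n : ℕ} (v : Fin n → Plane) (y z : ℤ × ℤ) (i : ℕ) (s : State) : Prop where
  min_le : ∀ j < i, s.reg 31 ≤ level y (vertex v j)
  le_max : ∀ j < i, level y (vertex v j) ≤ s.reg 32
  low_le : ∀ j < i, s.reg 33 ≤ level z (vertex v j)
  min_eq : ∃ j < n, s.reg 31 = level y (vertex v j)
  max_eq : ∃ j < n, s.reg 32 = level y (vertex v j)
  low_eq : ∃ j < n, s.reg 33 = level z (vertex v j)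

theorem runs_range (hn : 3 ≤ n) {s : State} (hs : HoldsPolygon v s) {y z : ℤ × ℤ}
    (hy : HasVec s 14 y) (hz : HasVec s 16 z) :
    ∃ t s', Runs range s t s' ∧ Agree 20 s s' ∧ HasRange v y z n s' ∧ (t : ℝ) ≤ 68 * n + 50 := by
  obtain ⟨t1, s1, r1, ht1, e1⟩ := Program.runs_block (p := startRange) 30 s (by decide) (by decide)
  obtain ⟨y1, y2⟩ := hy
  obtain ⟨z1, z2⟩ := hz
  norm_num at y2 z2
  have a1 : Agree 20 s s1 := r1.agree 20 (by decide)
  obtain ⟨t2, s2, r2, ⟨h2, a2⟩, ht2⟩ := runs_forVertices (v := v) (body := rangeBody) 60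
    (by decide) (by decide) (fun i σ => HasRange v y z i σ ∧ Agree 20 s σ)
    (fun i σ h => hs.mono (by norm_num) h.2)
    (fun i σ x h => ⟨⟨by simpa using h.1.min_le, by simpa using h.1.le_max,
      by simpa using h.1.low_le, by simpa using h.1.min_eq, by simpa using h.1.max_eq,
      by simpa using h.1.low_eq⟩, h.2.trans (k' := 20)
        ⟨fun r hr => by simp [show r ≠ 36 by omega], rfl⟩ le_rfl⟩)
    (fun i hi σ h h36 => by
      obtain ⟨h, ha⟩ := h
      have hp : HoldsPolygon v σ := hs.mono (by norm_num) ha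
      set a := level y (vertex v i) with hva
      set b := level z (vertex v i) with hvb
      have g14 := ha.1 14 (by norm_num)
      have g15 := ha.1 15 (by norm_num)
      have g16 := ha.1 16 (by norm_num)
      have g17 := ha.1 17 (by norm_num)
      have e31 : (rangeBody.exec σ).reg 31 = min (σ.reg 31) a := by
        simp only [rangeBody, Program.exec, Cond.holds_lt]
        split_ifs <;> simp_all [min_def, hp.xs, hp.ys, level, vertex]
      have e32 : (rangeBody.exec σ).reg 32 = max (σ.reg 32) a := by
        simp only [rangeBody, Program.exec, Cond.holds_lt]
        split_ifs <;> simp_all [max_def, hp.xs, hp.ys, level, vertex] <;>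
          (intro h1; linarith)
      have e33 : (rangeBody.exec σ).reg 33 = min (σ.reg 33) b := by
        simp only [rangeBody, Program.exec, Cond.holds_lt]
        split_ifs <;> simp_all [min_def, hp.xs, hp.ys, level, vertex]
      have e36 : (rangeBody.exec σ).reg 36 = i := by
        simp only [rangeBody, Program.exec, Cond.holds_lt]
        split_ifs <;> simp_all
      obtain ⟨t, r, -⟩ := Program.runs_exec (p := rangeBody) (by decide) σ
      refine ⟨⟨⟨?_, ?_, ?_, ?_, ?_, ?_⟩, ha.trans (r.agree 20 (by decide)) le_rfl⟩, e36⟩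
      · intro j hj
        rw [e31]
        rcases eq_or_lt_of_le (show j ≤ i by omega) with h1 | h1
        · rw [h1]; exact min_le_right _ _
        · exact (min_le_left _ _).trans (h.min_le j h1)
      · intro j hj
        rw [e32]
        rcases eq_or_lt_of_le (show j ≤ i by omega) with h1 | h1
        · rw [h1]; exact le_max_right _ _
        · exact (h.le_max j h1).trans (le_max_left _ _)
      · intro j hj
        rw [e33]
        rcases eq_or_lt_of_le (show j ≤ i by omega) with h1 | h1
        · rw [h1]; exact min_le_right _ _
        · exact (min_le_left _ _).trans (h.low_le j h1)
      · rw [e31]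
        rcases min_choice (σ.reg 31) a with h1 | h1
        · rw [h1]; exact h.min_eq
        · exact ⟨i, hi, h1⟩
      · rw [e32]
        rcases max_choice (σ.reg 32) a with h1 | h1
        · rw [h1]; exact h.max_eq
        · exact ⟨i, hi, h1⟩
      · rw [e33]
        rcases min_choice (σ.reg 33) b with h1 | h1
        · rw [h1]; exact h.low_eq
        · exact ⟨i, hi, h1⟩) (s := s1) (by
      refine ⟨⟨by simp, by simp, by simp, ⟨0, by omega, ?_⟩, ⟨0, by omega, ?_⟩, ⟨0, by omega, ?_⟩⟩, a1⟩
      all_goals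
        rw [e1]
        simp [startRange, Program.exec, y1, y2, z1, z2, hs.xs, hs.ys, level, vertex])
  refine ⟨_, s2, .seq r1 r2, a2, h2, ?_⟩
  have a1 : (t1 : ℝ) ≤ 30 := by exact_mod_cast ht1
  push_cast at ht2 ⊢
  linarith

end LatticeHull

/-! ## Long columns -/

namespace LatticeHull

open RealRAM

variable {n : ℕ} {v : Fin n → Plane}

/-- The lattice point with the coordinates `c`, `k` with respect to the functionals `y`, `z`. -/
def colPoint (y z : ℤ × ℤ) (c k : ℤ) : ℤ × ℤ := (c * z.2 - k * y.2, k * y.1 - c * z.1)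

theorem dot_colPoint_fst {y z : ℤ × ℤ} (h : cross y z = 1) (c k : ℤ) :
    dot y (colPoint y z c k) = c := by
  simp only [cross, dot, colPoint] at *
  linear_combination c * h

theorem dot_colPoint_snd {y z : ℤ × ℤ} (h : cross y z = 1) (c k : ℤ) :
    dot z (colPoint y z c k) = k := by
  simp only [cross, dot, colPoint] at *
  linear_combination k * h

theorem colPoint_dot {y z : ℤ × ℤ} (h : cross y z = 1) (x : ℤ × ℤ) :
    colPoint y z (dot y x) (dot z x) = x := by
  simp only [cross, dot, colPoint] at *
  ext
  · simp only; linear_combination x.1 * h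
  · simp only; linear_combination x.2 * h

theorem Plane.ext_level {y z : ℤ × ℤ} (h : cross y z = 1) {a b : Plane}
    (h1 : level y a = level y b) (h2 : level z a = level z b) : a = b := by
  have h' : (y.1 : ℝ) * z.2 - y.2 * z.1 = 1 := by exact_mod_cast h
  simp only [level] at h1 h2
  apply Plane.ext
  · linear_combination z.2 * h1 - y.2 * h2 - (a 0 - b 0) * h'
  · linear_combination y.1 * h2 - z.1 * h1 - (a 1 - b 1) * h'

theorem level_add_smul (y : ℤ × ℤ) (a b : Plane) (t : ℝ) :
    level y (a + t • (b - a)) = level y a + t * (level y b - level y a) := by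
  simp [level]; ring

theorem exists_pair_of_chord {P : Set Plane} (hP : Convex ℝ P) {y z : ℤ × ℤ} (h : cross y z = 1)
    {a b : Plane} (ha : a ∈ P) (hb : b ∈ P) {c : ℤ} (hac : level y a = c) (hbc : level y b = c)
    (hab : level z a + 2 ≤ level z b) :
    ∃ k : ℤ, toPlane (colPoint y z c k) ∈ P ∧ toPlane (colPoint y z c (k + 1)) ∈ P := by
  have key : ∀ k : ℤ, level z a ≤ k → (k : ℝ) ≤ level z b → toPlane (colPoint y z c k) ∈ P := by
    intro k h1 h2
    have hpos : 0 < level z b - level z a := by linarith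
    have e : toPlane (colPoint y z c k) =
        a + ((k - level z a) / (level z b - level z a)) • (b - a) := by
      apply Plane.ext_level h
      · rw [level_add_smul, level_toPlane, dot_colPoint_fst h, hac, hbc]; ring
      · rw [level_add_smul, level_toPlane, dot_colPoint_snd h]; field_simp; ring
    rw [e]
    exact hP.add_smul_sub_mem ha hb ⟨div_nonneg (by linarith) hpos.le,
      (div_le_one hpos).2 (by linarith)⟩
  have h1 := Int.le_ceil (level z a)
  have h2 := Int.ceil_lt_add_one (level z a)
  exact ⟨⌈level z a⌉, key _ h1 (by linarith), key _ (by push_cast; linarith)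
    (by push_cast; linarith)⟩

/-- The two points are those of the column on the sides from a to m and from a to b; the length of
the chord follows from similar triangles. -/
theorem exists_chord {P : Set Plane} (hP : Convex ℝ P) {y : ℤ × ℤ} (z : ℤ × ℤ) {a b m : Plane}
    (ha : a ∈ P) (hb : b ∈ P) (hm : m ∈ P) {c : ℝ} (hab : level y b - level y a ≠ 0)
    (ham : level y m - level y a ≠ 0)
    (h1 : (c - level y a) / (level y b - level y a) ∈ Set.Icc (0 : ℝ) 1)
    (h2 : (c - level y a) / (level y m - level y a) ∈ Set.Icc (0 : ℝ) 1) :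
    ∃ p ∈ P, ∃ q ∈ P, level y p = c ∧ level y q = c ∧ level z p - level z q =
      (c - level y a) / (level y m - level y a) *
        (((level y b - level y a) * (level z m - level z a) -
          (level z b - level z a) * (level y m - level y a)) / (level y b - level y a)) := by
  refine ⟨_, hP.add_smul_sub_mem ha hm h2, _, hP.add_smul_sub_mem ha hb h1, ?_, ?_, ?_⟩
  · rw [level_add_smul]; field_simp; ring
  · rw [level_add_smul]; field_simp; ring
  · rw [level_add_smul, level_add_smul]; field_simp; ring

/-- A triangle with a large area has a long chord in all columns that are not close to its ends. -/
theorem exists_long_chord {P : Set Plane} (hP : Convex ℝ P) {y z : ℤ × ℤ} {a b m : Plane}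
    (ha : a ∈ P) (hb : b ∈ P) (hm : m ∈ P) {c : ℝ} (h1 : level y a + 96 ≤ c)
    (h2 : c + 96 ≤ level y b) (ham : level y a ≤ level y m) (hmb : level y m ≤ level y b)
    (hδ : (level y b - level y a) ^ 2 / 48 ≤ |(level y b - level y a) * (level z m - level z a) -
      (level z b - level z a) * (level y m - level y a)|) :
    ∃ p ∈ P, ∃ q ∈ P, level y p = c ∧ level y q = c ∧ level z p + 2 ≤ level z q := by
  set W := level y b - level y a with hW
  set δ := W * (level z m - level z a) - (level z b - level z a) * (level y m - level y a) with hδ'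
  have hW0 : 0 < W := by linarith
  suffices ∃ p ∈ P, ∃ q ∈ P, level y p = c ∧ level y q = c ∧ 2 ≤ |level z p - level z q| by
    obtain ⟨p, hp, q, hq, e1, e2, h⟩ := this
    rcases le_abs.1 h with h | h
    · exact ⟨q, hq, p, hp, e2, e1, by linarith⟩
    · exact ⟨p, hp, q, hq, e1, e2, by linarith⟩
  -- The longest chord has length |δ|/W ≥ W/48, and a column at distance 96 from the ends retains at
  -- least the fraction 96/W of it; the product is 2.
  have hbound : ∀ s : ℝ, 96 / W ≤ s → 2 ≤ |s * (δ / W)| := by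
    intro s hs
    have hs0 : 0 ≤ s := le_trans (by positivity) hs
    rw [abs_mul, abs_div, abs_of_pos hW0, abs_of_nonneg hs0]
    calc (2 : ℝ) = 96 / W * (W ^ 2 / 48 / W) := by field_simp; norm_num
      _ ≤ s * (|δ| / W) := by gcongr
  rcases le_total c (level y m) with h | h
  · have hE : 0 < level y m - level y a := by linarith
    obtain ⟨p, hp, q, hq, e1, e2, e3⟩ := exists_chord hP z ha hb hm (c := c) hW0.ne' hE.ne'
      ⟨div_nonneg (by linarith) hW0.le, (div_le_one hW0).2 (by linarith)⟩
      ⟨div_nonneg (by linarith) hE.le, (div_le_one hE).2 (by linarith)⟩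
    refine ⟨p, hp, q, hq, e1, e2, ?_⟩
    rw [e3]
    apply hbound
    gcongr <;> linarith
  -- Beyond m the triangle is seen from b instead of a, which changes the sign of δ only.
  · have hE : 0 < level y b - level y m := by linarith
    have hE' : level y m - level y b ≠ 0 := by linarith
    have hW' : level y a - level y b ≠ 0 := by linarith
    have e4 : (c - level y b) / (level y a - level y b) = (level y b - c) / W := by
      rw [hW, ← neg_div_neg_eq]; congr 1 <;> ring
    have e5 : (c - level y b) / (level y m - level y b) =
        (level y b - c) / (level y b - level y m) := by
      rw [← neg_div_neg_eq]; congr 1 <;> ring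
    have e6 : (level y a - level y b) * (level z m - level z b) -
        (level z a - level z b) * (level y m - level y b) = -δ := by
      rw [hδ', hW]; ring
    have e7 : level y a - level y b = -W := by rw [hW]; ring
    obtain ⟨p, hp, q, hq, e1, e2, e3⟩ := exists_chord hP z hb ha hm (c := c) hW' hE'
      (by rw [e4]; exact ⟨div_nonneg (by linarith) hW0.le, (div_le_one hW0).2 (by linarith)⟩)
      (by rw [e5]; exact ⟨div_nonneg (by linarith) hE.le, (div_le_one hE).2 (by linarith)⟩)
    refine ⟨p, hp, q, hq, e1, e2, ?_⟩
    rw [e3, e5, e6, e7, neg_div_neg_eq]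
    apply hbound
    gcongr <;> linarith

/-- The δ's are twice the signed areas, in the coordinates y and z, of triangles over the same base
with three different apexes. If all were below W²/48, their differences would be below W²/24, and
Cauchy-Schwarz would give D² ≤ Q W²/288 ≤ Q²/8 for D = pq' - p'q, Q = p² + q². Reduction gives D² ≥
Q²/4. -/
theorem exists_large_area {δ₀ δ₁ δ₂ W H p p' q q' : ℝ} (h1 : δ₁ - δ₀ = W * p' - H * p)
    (h2 : δ₂ - δ₀ = W * q' - H * q) (hQ : 0 < p ^ 2 + q ^ 2) (hW : 0 < W)
    (hWQ : W ^ 2 ≤ 36 * (p ^ 2 + q ^ 2)) (hD : (p ^ 2 + q ^ 2) ^ 2 ≤ 4 * (p * q' - p' * q) ^ 2) :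
    W ^ 2 / 48 ≤ |δ₀| ∨ W ^ 2 / 48 ≤ |δ₁| ∨ W ^ 2 / 48 ≤ |δ₂| := by
  by_contra! hc
  obtain ⟨c0, c1, c2⟩ := hc
  rw [abs_lt] at c0 c1 c2
  set Q := p ^ 2 + q ^ 2 with hQ'
  set D := p * q' - p' * q with hD'
  have ha : (δ₁ - δ₀) ^ 2 ≤ (W ^ 2 / 24) ^ 2 := sq_le_sq' (by linarith) (by linarith)
  have hb : (δ₂ - δ₀) ^ 2 ≤ (W ^ 2 / 24) ^ 2 := sq_le_sq' (by linarith) (by linarith)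
  have e : p * (δ₂ - δ₀) - q * (δ₁ - δ₀) = W * D := by rw [h1, h2, hD']; ring
  have h3 : (W * D) ^ 2 ≤ Q * ((δ₁ - δ₀) ^ 2 + (δ₂ - δ₀) ^ 2) := by
    rw [← e, hQ']
    linarith [sq_nonneg (p * (δ₁ - δ₀) + q * (δ₂ - δ₀))]
  have h4 : (W * D) ^ 2 ≤ Q * (2 * (W ^ 2 / 24) ^ 2) :=
    h3.trans (by gcongr; linarith)
  have h5 : W ^ 2 * D ^ 2 ≤ W ^ 2 * (Q * W ^ 2 / 288) := by linarith
  have h6 : D ^ 2 ≤ Q * W ^ 2 / 288 := le_of_mul_le_mul_left h5 (by positivity)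
  have h7 : Q * W ^ 2 ≤ Q * (36 * Q) := by gcongr
  nlinarith

theorem level_range_sq_le {a b c Q : ℝ} (ha : (a - c) ^ 2 ≤ 9 * Q) (hb : (b - c) ^ 2 ≤ 9 * Q) :
    (a - b) ^ 2 ≤ 36 * Q := by
  nlinarith [sq_nonneg (a + b - 2 * c)]

/-- If the polygon is wide with respect to the first member of a reduced basis, then all columns that
are not close to its ends contain two consecutive lattice points. -/
theorem exists_pair_of_wide (hn : 3 ≤ n) (hv : IsCounterclockwise v) {s σ : State}
    (hs : Widest v n s) {y z : ℤ × ℤ} (hdet : cross y z = 1)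
    (hred : extent s y ≤ 1 ∨
      extent s y ^ 2 ≤ 4 * (s.reg 5 * s.reg 8 - s.reg 6 * s.reg 7) ^ 2)
    (hr : HasRange v y z n σ) {c : ℤ} (h1 : σ.reg 31 + 96 ≤ c) (h2 : c + 96 ≤ σ.reg 32) :
    ∃ k : ℤ, colPoint y z c k ∈ latticePoints v ∧ colPoint y z c (k + 1) ∈ latticePoints v := by
  have hP : Convex ℝ (polygon v) := convex_convexHull ℝ _
  obtain ⟨i, hi, ei⟩ := hr.min_eq
  obtain ⟨j, hj, ej⟩ := hr.max_eq
  obtain ⟨k, hk, k5, k6⟩ := hs.far.mem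
  obtain ⟨l, hl, l7, l8⟩ := hs.mem
  have hW : 0 < σ.reg 32 - σ.reg 31 := by linarith
  have hWQ : (σ.reg 32 - σ.reg 31) ^ 2 ≤ 36 * extent s y := by
    rw [ei, ej]
    exact level_range_sq_le (hs.level_sub_le hn hv y hj) (hs.level_sub_le hn hv y hi)
  -- An extent of at most 1 would mean a width of at most 6, while two margins of 96 are available.
  have hred' : extent s y ^ 2 ≤ 4 * (s.reg 5 * s.reg 8 - s.reg 6 * s.reg 7) ^ 2 := by
    refine hred.resolve_left fun h => ?_
    nlinarith
  have hdet' : (y.1 : ℝ) * z.2 - y.2 * z.1 = 1 := by exact_mod_cast hdet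
  set δ : ℕ → ℝ := fun m => (level y (vertex v j) - level y (vertex v i)) *
    (level z (vertex v m) - level z (vertex v i)) - (level z (vertex v j) - level z (vertex v i)) *
    (level y (vertex v m) - level y (vertex v i)) with hδ
  have key : ∀ m < n, (σ.reg 32 - σ.reg 31) ^ 2 / 48 ≤ |δ m| →
      ∃ k : ℤ, colPoint y z c k ∈ latticePoints v ∧ colPoint y z c (k + 1) ∈ latticePoints v := by
    intro m hm h
    obtain ⟨p, hp, q, hq, e1, e2, e3⟩ := exists_long_chord hP (y := y) (z := z) (vertex_mem v hi)
      (vertex_mem v hj) (vertex_mem v hm) (c := c) (by rw [← ei]; exact h1)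
      (by rw [← ej]; exact h2) (by rw [← ei]; exact hr.min_le m hm)
      (by rw [← ej]; exact hr.le_max m hm) (by rw [← ei, ← ej]; simpa [hδ, ei, ej] using h)
    exact exists_pair_of_chord hP hdet hp hq e1 e2 e3
  -- The three apexes are the first vertex and the ends of the arms u and w. The base joins the
  -- vertices at which y is smallest and largest.
  rcases exists_large_area (δ₀ := δ 0) (δ₁ := δ k) (δ₂ := δ l) (W := σ.reg 32 - σ.reg 31)
    (H := level z (vertex v j) - level z (vertex v i))
    (p := y.1 * s.reg 5 + y.2 * s.reg 6) (q := y.1 * s.reg 7 + y.2 * s.reg 8)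
    (p' := z.1 * s.reg 5 + z.2 * s.reg 6) (q' := z.1 * s.reg 7 + z.2 * s.reg 8)
    (by simp only [hδ, ei, ej, level, k5, k6, arm]; ring)
    (by simp only [hδ, ei, ej, level, l7, l8, arm]; ring)
    (extent_pos (hs.det_ne_zero hn hv) hdet) hW hWQ
    (by
      have e : ((y.1 * s.reg 5 + y.2 * s.reg 6) * (z.1 * s.reg 7 + z.2 * s.reg 8) -
          (z.1 * s.reg 5 + z.2 * s.reg 6) * (y.1 * s.reg 7 + y.2 * s.reg 8)) =
          s.reg 5 * s.reg 8 - s.reg 6 * s.reg 7 := by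
        linear_combination (s.reg 5 * s.reg 8 - s.reg 6 * s.reg 7) * hdet'
      rw [e]; exact hred') with h | h | h
  · exact key 0 (by omega) h
  · exact key k hk h
  · exact key l hl h

/-- It suffices to examine a bounded number of columns. -/
theorem exists_column_bound (hn : 3 ≤ n) (hv : IsCounterclockwise v) {s σ : State}
    (hs : Widest v n s) {y z : ℤ × ℤ} (hdet : cross y z = 1)
    (hred : extent s y ≤ 1 ∨
      extent s y ^ 2 ≤ 4 * (s.reg 5 * s.reg 8 - s.reg 6 * s.reg 7) ^ 2)
    (hr : HasRange v y z n σ) {c₀ : ℤ} (h1 : σ.reg 31 ≤ c₀) (h2 : (c₀ : ℝ) < σ.reg 31 + 1) :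
    ∃ N : ℕ, 1 ≤ N ∧ N ≤ 200 ∧ ((∀ c : ℤ, (c : ℝ) ≤ σ.reg 32 → c < c₀ + N) ∨
      ∃ k : ℤ, colPoint y z (c₀ + N - 1) k ∈ latticePoints v ∧
        colPoint y z (c₀ + N - 1) (k + 1) ∈ latticePoints v) := by
  rcases lt_or_ge (σ.reg 32) (σ.reg 31 + 200) with h | h
  · refine ⟨200, by norm_num, le_rfl, Or.inl fun c hc => ?_⟩
    have : (c : ℝ) < (c₀ + 200 : ℤ) := by push_cast; linarith
    exact_mod_cast this
  -- Column number c₀ + 96 is at distance at least 96 from both ends, since c₀ is less than the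
  -- minimum plus 1 and the width is at least 200.
  · refine ⟨97, by norm_num, by norm_num, Or.inr ?_⟩
    refine exists_pair_of_wide hn hv hs hdet hred hr ?_ ?_ <;> push_cast <;> linarith

end LatticeHull

/-! ## The first vertex of the hull -/

namespace LatticeHull

open RealRAM

variable {n : ℕ} {v : Fin n → Plane}

/-! ### Columns of a lattice-convex set -/

/-- For f = (y.2, -y.1) the form `cross f` is `dot y`. On the kernel of y, `dot f` and `dot z` have
opposite signs, because y, z is a positive basis. -/
theorem pointed_of_lex {S : Set (ℤ × ℤ)} {y z p : ℤ × ℤ} (h : cross y z = 1)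
    (hp : ∀ x ∈ S, x ≠ p → dot y p < dot y x ∨ (dot y x = dot y p ∧ dot z p < dot z x)) :
    Pointed (y.2, -y.1) (shift S p) := by
  intro x hx hne
  have h1 := hp (p + x) hx (by simpa using hne)
  simp only [LexPos, cross, dot] at *
  simp at h1 ⊢
  rcases h1 with h1 | ⟨h1, h2⟩
  · left; linarith
  · right
    have hz : 0 < z.1 * x.1 + z.2 * x.2 := by linarith
    have h0 : y.1 * x.1 + y.2 * x.2 = 0 := by linarith
    refine ⟨by linarith, ?_⟩
    have e : y.2 * x.1 - y.1 * x.2 = -((z.1 * x.1 + z.2 * x.2) * (y.1 ^ 2 + y.2 ^ 2)) := by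
      linear_combination (-(y.2 * x.1) + y.1 * x.2) * h + (y.1 * z.1 + y.2 * z.2) * h0
    have hy : 0 < y.1 ^ 2 + y.2 ^ 2 := by
      by_contra hc
      have a1 : y.1 = 0 := by nlinarith [sq_nonneg y.1, sq_nonneg y.2]
      have a2 : y.2 = 0 := by nlinarith [sq_nonneg y.1, sq_nonneg y.2]
      rw [a1, a2] at h; simp at h
    have := mul_pos hz hy
    linarith

theorem LatConvex.column_eq {S : Set (ℤ × ℤ)} (hS : LatConvex S) {y z : ℤ × ℤ}
    (h : cross y z = 1) {c k : ℤ} (hk : colPoint y z c k ∈ S)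
    (hmin : ∀ x ∈ S, dot y x = c → k ≤ dot z x) (hsucc : colPoint y z c (k + 1) ∉ S) :
    ∀ x ∈ S, dot y x = c → x = colPoint y z c k := by
  intro x hx hc
  have h1 := hmin x hx hc
  obtain ⟨j, rfl⟩ : ∃ j, x = colPoint y z c j := ⟨dot z x, by rw [← hc, colPoint_dot h]⟩
  rw [dot_colPoint_snd h] at h1
  rcases eq_or_lt_of_le h1 with h2 | h2
  · rw [h2]
  · exfalso
    refine hsucc (hS _ hk _ hx _ hx (j - k - 1) 1 0 _ (by linarith) (by norm_num) le_rfl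
      (by linarith) ?_)
    ext <;> simp [colPoint] <;> ring

/-- A common divisor g ≥ 2 of the coordinates would put the lattice point p - (p - q)/g into the
set. Its column lies strictly between those of p and q, where there is no point. -/
theorem LatConvex.isCoprime {S : Set (ℤ × ℤ)} (hS : LatConvex S) {y z : ℤ × ℤ}
    (h : cross y z = 1) {p q : ℤ × ℤ} (hp : p ∈ S) (hq : q ∈ S) (hlt : dot y p < dot y q)
    (hmin : ∀ x ∈ S, x = p ∨ dot y q ≤ dot y x) :
    IsCoprime (dot y (p - q)) (dot z (p - q)) := by
  rw [Int.isCoprime_iff_gcd_eq_one]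
  set g := Int.gcd (dot y (p - q)) (dot z (p - q)) with hg
  have e1 : dot y (p - q) = dot y p - dot y q := by simp [dot]; ring
  have e2 : dot z (p - q) = dot z p - dot z q := by simp [dot]; ring
  have hg0 : 0 < g := Int.gcd_pos_of_ne_zero_left _ (by omega)
  obtain ⟨a, ha⟩ : (g : ℤ) ∣ dot y (p - q) := Int.gcd_dvd_left ..
  obtain ⟨b, hb⟩ : (g : ℤ) ∣ dot z (p - q) := Int.gcd_dvd_right ..
  by_contra hne
  have hg2 : 2 ≤ (g : ℤ) := by omega
  have hx : colPoint y z (dot y p - a) (dot z p - b) ∈ S := by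
    refine hS _ hp _ hq _ hq (g - 1) 1 0 _ (by omega) (by norm_num) le_rfl (by omega) ?_
    conv_rhs => rw [← colPoint_dot h p, ← colPoint_dot h q]
    have e3 : dot y q = dot y p - g * a := by linarith
    have e4 : dot z q = dot z p - g * b := by linarith
    rw [e3, e4]
    ext <;> simp [colPoint] <;> ring
  have ha0 : a < 0 := by
    have : (g : ℤ) * a < 0 := by linarith
    by_contra hc
    have := mul_nonneg (by omega : (0 : ℤ) ≤ g) (not_lt.1 hc)
    linarith
  rcases hmin _ hx with h1 | h1
  · have := congrArg (dot y) h1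
    rw [dot_colPoint_fst h] at this
    omega
  · rw [dot_colPoint_fst h] at h1
    nlinarith

/-! ### The search for the first column -/

/-- The line starts two units below the integer part of the minimum of z, so that every lattice
point of the column has a number of at least 2, as `runs_findFirst` requires. -/
def columnLine : Program :=
  .assign 40 (.reg 34 * .reg 17 - (.floor (.reg 33) - .const 2) * .reg 15) ;;
  .assign 41 ((.floor (.reg 33) - .const 2) * .reg 14 - .reg 34 * .reg 16) ;;
  .assign 42 (.const 0 - .reg 15) ;; .assign 43 (.reg 14)

def columnFirst : Program :=
  .assign 20 (.reg 50) ;; .assign 21 (.reg 51) ;; .assign 22 (.reg 15) ;;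
  .assign 23 (.const 0 - .reg 14) ;; .assign 35 (.const 1) ;;
  .assign 50 (.reg 50 + .reg 42) ;; .assign 51 (.reg 51 + .reg 43)

def columnSecond : Program :=
  .assign 22 (.reg 20 - .reg 50) ;; .assign 23 (.reg 21 - .reg 51) ;; .assign 35 (.const 2)

/-- Examine the column whose number is in register `34`. -/
def columnStep : Program :=
  columnLine ;; findFirst ;;
  .ite (.eq (.reg 65) (.const 0))
    (.ite (.eq (.reg 35) (.const 0))
      (columnFirst ;; locate ;; .ite (.eq (.reg 65) (.const 0)) (.assign 35 (.const 2)) .skip)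
      columnSecond) .skip ;;
  .assign 34 (.reg 34 + .const 1)

/-- Find the first lattice point, and a second one that is a neighbour of the first one in the
hull. -/
def columns : Program :=
  (.assign 34 (.const 0 - .floor (.const 0 - .reg 31)) ;; .assign 35 (.const 0)) ;;
  .loop (.and (.le (.reg 34) (.reg 32)) (.lt (.reg 35) (.const 2))) columnStep

/-- The registers `20`-`23` hold the first lattice point and a direction towards it. -/
def FoundPair {n : ℕ} (v : Fin n → Plane) (y z : ℤ × ℤ) (σ : State) : Prop :=
  ∃ p d, HasVec σ 20 p ∧ HasVec σ 22 d ∧ p ∈ latticePoints v ∧ -d ∈ shift (latticePoints v) p ∧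
    Pointed (y.2, -y.1) (shift (latticePoints v) p) ∧ dot y d ≤ 0 ∧ -200 ≤ dot y d ∧
    (dot y d = 0 → dot z d = -1) ∧ IsCoprime (dot y d) (dot z d)

/-- The registers `20`-`21` hold the first lattice point. -/
def FoundPoint {n : ℕ} (v : Fin n → Plane) (y : ℤ × ℤ) (c₀ c : ℤ) (σ : State) : Prop :=
  ∃ p, HasVec σ 20 p ∧ p ∈ latticePoints v ∧ c₀ ≤ dot y p ∧ dot y p < c ∧
    ∀ x ∈ latticePoints v, x = p ∨ c ≤ dot y x

theorem FoundPair.congr {y z : ℤ × ℤ} {σ σ' : State} (h : FoundPair v y z σ)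
    (h0 : σ'.reg 20 = σ.reg 20) (h1 : σ'.reg 21 = σ.reg 21) (h2 : σ'.reg 22 = σ.reg 22)
    (h3 : σ'.reg 23 = σ.reg 23) : FoundPair v y z σ' := by
  obtain ⟨p, d, a, b, h⟩ := h
  exact ⟨p, d, ⟨h0.trans a.1, h1.trans a.2⟩, ⟨h2.trans b.1, h3.trans b.2⟩, h⟩

theorem FoundPoint.congr {y : ℤ × ℤ} {c₀ c : ℤ} {σ σ' : State} (h : FoundPoint v y c₀ c σ)
    (h0 : σ'.reg 20 = σ.reg 20) (h1 : σ'.reg 21 = σ.reg 21) : FoundPoint v y c₀ c σ' := by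
  obtain ⟨p, a, h⟩ := h
  exact ⟨p, ⟨h0.trans a.1, h1.trans a.2⟩, h⟩

/-- The constant data of the search. -/
structure ColumnData {n : ℕ} (v : Fin n → Plane) (y z : ℤ × ℤ) (s σ : State) : Prop where
  agree : Agree 20 s σ
  lo : σ.reg 31 = s.reg 31
  hi : σ.reg 32 = s.reg 32
  low : σ.reg 33 = s.reg 33

/-- What is known before column number `c` is examined. -/
def ColumnFlag {n : ℕ} (v : Fin n → Plane) (y z : ℤ × ℤ) (c₀ c : ℤ) (σ : State) : Prop :=
  (σ.reg 35 = 0 ∧ ∀ x ∈ latticePoints v, c ≤ dot y x) ∨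
  (σ.reg 35 = 1 ∧ FoundPoint v y c₀ c σ) ∨ (σ.reg 35 = 2 ∧ FoundPair v y z σ)

/-- In the first nonempty column the lowest point is the lexicographic minimum. If the point above
it belongs to the polygon, the column itself supplies the direction; otherwise the column has one
point by convexity, and the lowest point of the next nonempty column is the second one. Register
`35` is the state of this search: nothing, one point, or a pair. -/
theorem runs_columnStep (hn : 3 ≤ n) (hv : IsCounterclockwise v) {s σ : State}
    (hs : HoldsPolygon v s) {y z : ℤ × ℤ} (hy : HasVec s 14 y) (hz : HasVec s 16 z)
    (hdet : cross y z = 1) (hcap : 1 ≤ s.reg 2)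
    (hlow : ∀ x ∈ latticePoints v, s.reg 33 ≤ (dot z x : ℤ))
    (hhigh : ∀ x ∈ latticePoints v, (dot z x : ℤ) + 3 ≤ s.reg 33 + s.reg 2) {c₀ c : ℤ}
    (hc0 : c₀ ≤ c) (hc1 : c ≤ c₀ + 200) (hσ : ColumnData v y z s σ) (hcol : σ.reg 34 = c)
    (hflag : ColumnFlag v y z c₀ c σ) (h35 : σ.reg 35 < 2) :
    ∃ tm σ', Runs columnStep σ tm σ' ∧ ColumnData v y z s σ' ∧ σ'.reg 34 = (c + 1 : ℤ) ∧
      ColumnFlag v y z c₀ (c + 1) σ' ∧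
      ((∃ k : ℤ, colPoint y z c k ∈ latticePoints v ∧ colPoint y z c (k + 1) ∈ latticePoints v) →
        σ'.reg 35 = 2) ∧ (tm : ℝ) ≤ 2300 * depth n * searchDepth (s.reg 2) := by
  set S := latticePoints v with hS
  set K : ℤ := ⌊s.reg 33⌋ - 2 with hK
  have hdep : (1 : ℝ) ≤ depth n := by simp [depth]
  have hsd : (1 : ℝ) ≤ searchDepth (s.reg 2) := by simp [searchDepth]
  have hdd : (depth n : ℝ) ≤ depth n * searchDepth (s.reg 2) := by nlinarith
  obtain ⟨y1, y2⟩ := hy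
  obtain ⟨z1, z2⟩ := hz
  norm_num at y2 z2
  obtain ⟨t1, σ1, r1, ht1, e1⟩ := Program.runs_block (p := columnLine) 32 σ (by decide) (by decide)
  have g14 := hσ.agree.1 14 (by norm_num)
  have g15 := hσ.agree.1 15 (by norm_num)
  have g16 := hσ.agree.1 16 (by norm_num)
  have g17 := hσ.agree.1 17 (by norm_num)
  have g2 := hσ.agree.1 2 (by norm_num)
  have ag1 : Agree 40 σ σ1 := r1.agree 40 (by decide)
  have ho : HasVec σ1 40 (colPoint y z c K) := by
    rw [e1]
    constructor <;> simp [columnLine, Program.exec, g14, g15, g16, g17, y1, y2, z1, z2, hcol,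
      hσ.low, colPoint, hK]
  have hw : HasVec σ1 42 (-y.2, y.1) := by
    rw [e1]
    constructor <;> simp [columnLine, Program.exec, g14, g15, y1, y2]
  have hline : ∀ t : ℕ, colPoint y z c K + (t : ℤ) • (-y.2, y.1) = colPoint y z c (K + t) := by
    intro t
    ext <;> simp [colPoint] <;> ring
  have hmem : ∀ t : ℕ, linePoint σ1 t ∈ polygon v ↔ colPoint y z c (K + t) ∈ S := by
    intro t
    rw [linePoint_mem ho hw, hline]
  have hKle := Int.floor_le (s.reg 33)
  have hKlt := Int.lt_floor_add_one (s.reg 33)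
  have hKr : (K : ℝ) = ⌊s.reg 33⌋ - 2 := by rw [hK]; push_cast; ring
  have hnat : ∀ x ∈ S, dot y x = c → ∃ t : ℕ, x = colPoint y z c (K + t) := by
    intro x hx hxc
    have h1 := hlow x hx
    have h2 : K ≤ dot z x := by
      have : (K : ℝ) ≤ (dot z x : ℤ) := by rw [hKr]; linarith
      exact_mod_cast this
    refine ⟨(dot z x - K).toNat, ?_⟩
    rw [Int.toNat_of_nonneg (by linarith), add_sub_cancel, ← hxc, colPoint_dot hdet]
  have hp1 : HoldsPolygon v σ1 := (hs.mono (by norm_num) hσ.agree).mono (by norm_num) ag1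
  have g12 : σ1.reg 2 = s.reg 2 := (ag1.1 2 (by norm_num)).trans g2
  obtain ⟨t2, σ2, r2, h2⟩ := runs_findFirst hn hv hp1 (by rw [g12]; exact hcap) (by
    intro t ht
    have ht' := (hmem t).1 ht
    have h1 := hlow _ ht'
    have h2 := hhigh _ ht'
    rw [dot_colPoint_snd hdet] at h1 h2
    push_cast at h1 h2
    rw [g12]
    constructor
    · have : (1 : ℝ) < t := by linarith
      exact_mod_cast this
    · linarith)
  have ag2 : Agree 44 σ1 σ2 := r2.agree 44 above_findFirst
  have ag12 : Agree 40 σ σ2 := ag1.trans ag2 (by norm_num)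
  have hp2 : HoldsPolygon v σ2 := hp1.mono (by norm_num) ag2
  have h234 : σ2.reg 34 = c := (ag12.1 34 (by norm_num)).trans hcol
  have h235 : σ2.reg 35 = σ.reg 35 := ag12.1 35 (by norm_num)
  have hσ2 : ColumnData v y z s σ2 := ⟨hσ.agree.trans (ag12.mono (by norm_num)) le_rfl,
    (ag12.1 31 (by norm_num)).trans hσ.lo, (ag12.1 32 (by norm_num)).trans hσ.hi,
    (ag12.1 33 (by norm_num)).trans hσ.low⟩
  have a1 : (t1 : ℝ) ≤ 32 := by exact_mod_cast ht1
  -- the rest of the round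
  suffices ∃ t3 σ3, Runs (.ite (.eq (.reg 65) (.const 0))
      (.ite (.eq (.reg 35) (.const 0))
        (columnFirst ;; locate ;; .ite (.eq (.reg 65) (.const 0)) (.assign 35 (.const 2)) .skip)
        columnSecond) .skip) σ2 t3 σ3 ∧ ColumnData v y z s σ3 ∧ σ3.reg 34 = c ∧
      ColumnFlag v y z c₀ (c + 1) σ3 ∧
      ((∃ k : ℤ, colPoint y z c k ∈ S ∧ colPoint y z c (k + 1) ∈ S) → σ3.reg 35 = 2) ∧
      (t3 : ℝ) ≤ 200 * depth n + 60 ∧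
      (t2 : ℝ) ≤ 2000 * depth n * searchDepth (s.reg 2) by
    obtain ⟨t3, σ3, r3, hσ3, h34, hflag3, hpair, ht3, ht2⟩ := this
    obtain ⟨t4, σ4, r4, ht4, e4⟩ := Program.runs_block (p := .assign 34 (.reg 34 + .const 1)) 4 σ3
      (by decide) (by decide)
    refine ⟨_, σ4, .seq r1 (.seq r2 (.seq r3 r4)), ⟨hσ3.agree.trans (k' := 20)
      (r4.agree 20 (by decide)) le_rfl, ?_, ?_, ?_⟩, ?_, ?_, ?_, ?_⟩
    · rw [e4]; simpa [Program.exec] using hσ3.lo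
    · rw [e4]; simpa [Program.exec] using hσ3.hi
    · rw [e4]; simpa [Program.exec] using hσ3.low
    · rw [e4]; simp [Program.exec, h34]
    · have h35 : σ4.reg 35 = σ3.reg 35 := by rw [e4]; simp [Program.exec]
      have h20 : σ4.reg 20 = σ3.reg 20 := by rw [e4]; simp [Program.exec]
      have h21 : σ4.reg 21 = σ3.reg 21 := by rw [e4]; simp [Program.exec]
      have h22 : σ4.reg 22 = σ3.reg 22 := by rw [e4]; simp [Program.exec]
      have h23 : σ4.reg 23 = σ3.reg 23 := by rw [e4]; simp [Program.exec]
      rcases hflag3 with h | h | h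
      · exact Or.inl ⟨h35.trans h.1, h.2⟩
      · exact Or.inr (Or.inl ⟨h35.trans h.1, h.2.congr h20 h21⟩)
      · exact Or.inr (Or.inr ⟨h35.trans h.1, h.2.congr h20 h21 h22 h23⟩)
    · intro h
      rw [e4]; simpa [Program.exec] using hpair h
    · have a4 : (t4 : ℝ) ≤ 4 := by exact_mod_cast ht4
      push_cast
      linarith
  rcases h2 with ⟨t, h65, -, h50, h51, ht, hmin, ht2⟩ | ⟨h65, hno, ht2⟩
  · -- the column is not empty
    set q := colPoint y z c (K + t) with hq
    have hqS : q ∈ S := (hmem t).1 ht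
    have hqc : dot y q = c := dot_colPoint_fst hdet c _
    have hqz : dot z q = K + t := dot_colPoint_snd hdet c _
    rw [linePoint_eq ho hw, hline, toPlane_zero] at h50
    rw [linePoint_eq ho hw, hline, toPlane_one] at h51
    have hqmin : ∀ x ∈ S, dot y x = c → K + t ≤ dot z x := by
      intro x hx hxc
      obtain ⟨t', rfl⟩ := hnat x hx hxc
      rw [dot_colPoint_snd hdet]
      have : ¬ t' < t := fun h => hmin t' h ((hmem t').2 hx)
      omega
    have ht2' : (t2 : ℝ) ≤ 2000 * depth n * searchDepth (s.reg 2) := by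
      refine ht2.trans ?_
      have h1 := hhigh _ hqS
      rw [hqz] at h1
      push_cast at h1
      have h3 : (t : ℝ) ≤ ⌈s.reg 2⌉₊ := by
        refine le_trans ?_ (Nat.le_ceil _)
        linarith
      have h4 : t ≤ ⌈s.reg 2⌉₊ := by exact_mod_cast h3
      have h5 : Nat.log 2 t + 1 ≤ searchDepth (s.reg 2) := by
        simp only [searchDepth]
        have := Nat.log_mono_right (b := 2) h4
        omega
      have h6 : ((Nat.log 2 t : ℕ) : ℝ) + 1 ≤ searchDepth (s.reg 2) := by exact_mod_cast h5
      gcongr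
    rcases hflag with ⟨f0, hall⟩ | ⟨f1, hpt⟩ | ⟨f2, -⟩
    · obtain ⟨t3, σ3, r3, ht3, e3⟩ := Program.runs_block (p := columnFirst) 24 σ2 (by decide)
        (by decide)
      have hp3 : HoldsPolygon v σ3 := hp2.mono (by norm_num) (r3.agree 20 (by decide))
      obtain ⟨t4, σ4, r4, ht4, h4⟩ := runs_locate hn hv hp3
      have ag4 : Agree 60 σ3 σ4 := r4.agree 60 above_locate
      obtain ⟨t5, σ5, r5, ht5, e5⟩ := Program.runs_block
        (p := .ite (.eq (.reg 65) (.const 0)) (.assign 35 (.const 2)) .skip) 12 σ4 (by decide)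
        (by decide)
      have e50 : (!₂[σ3.reg 50, σ3.reg 51] : Plane) = toPlane (colPoint y z c (K + t + 1)) := by
        obtain ⟨w1, w2⟩ := hw
        norm_num at w2
        have g42 := (ag2.1 42 (by norm_num)).trans w1
        have g43 := (ag2.1 43 (by norm_num)).trans w2
        apply Plane.ext
        · rw [e3]
          simp [columnFirst, Program.exec, h50, g42, colPoint]; ring
        · rw [e3]
          simp [columnFirst, Program.exec, h51, g43, colPoint]; ring
      have c0 : ((Cond.eq (.reg 65) (.const 0)).cost : ℝ) ≤ 8 := by
        exact_mod_cast (by decide : (Cond.eq (.reg 65) (.const 0)).cost ≤ 8)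
      have c1 : ((Cond.eq (.reg 35) (.const 0)).cost : ℝ) ≤ 8 := by
        exact_mod_cast (by decide : (Cond.eq (.reg 35) (.const 0)).cost ≤ 8)
      have a3 : (t3 : ℝ) ≤ 24 := by exact_mod_cast ht3
      have a4 : (t4 : ℝ) ≤ 200 * depth n := by exact_mod_cast ht4
      have a5 : (t5 : ℝ) ≤ 12 := by exact_mod_cast ht5
      have hreg : ∀ r, 20 ≤ r → r < 35 → σ5.reg r = σ3.reg r := by
        intro r _ h2
        have h3 := ag4.1 r (by omega)
        rw [e5]
        simp only [Program.exec]
        split_ifs <;> simp [h3]; omega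
      have h31 := hreg 31 (by norm_num) (by norm_num)
      have h32 := hreg 32 (by norm_num) (by norm_num)
      have h33 := hreg 33 (by norm_num) (by norm_num)
      have h34 := hreg 34 (by norm_num) (by norm_num)
      have h20 := hreg 20 (by norm_num) (by norm_num)
      have h21 := hreg 21 (by norm_num) (by norm_num)
      have h22 := hreg 22 (by norm_num) (by norm_num)
      have h23 := hreg 23 (by norm_num) (by norm_num)
      have g214 := (hσ2.agree.1 14 (by norm_num)).trans y1
      have g215 := (hσ2.agree.1 15 (by norm_num)).trans y2
      rw [e3] at h31 h32 h33 h34 h20 h21 h22 h23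
      simp [columnFirst, Program.exec] at h31 h32 h33 h34 h20 h21 h22 h23
      rw [h50] at h20
      rw [h51] at h21
      rw [g215] at h22
      rw [g214] at h23
      have h35 : σ4.reg 35 = 1 := by
        rw [ag4.1 35 (by norm_num), e3]; simp [columnFirst, Program.exec]
      refine ⟨_, σ5, .ite_true (by simp [h65]) (.ite_true (by simp [h235, f0])
        (.seq r3 (.seq r4 r5))), ⟨hσ2.agree.trans (k' := 20) (Runs.agree (.seq r3 (.seq r4 r5)) 20
          (by decide)) le_rfl, h31.trans hσ2.lo, h32.trans hσ2.hi, h33.trans hσ2.low⟩,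
        h34.trans h234, ?_, ?_, by push_cast; linarith, ht2'⟩
      · rcases h4 with ⟨k65, hin⟩ | ⟨k65, A, B, C, hle, hlt, -⟩
        · rw [e50] at hin
          refine Or.inr (Or.inr ⟨by rw [e5]; simp [Program.exec, k65], q, (y.2, -y.1), ⟨h20, h21⟩,
            ⟨h22, by simpa using h23⟩, hqS, ?_, ?_, ?_, ?_, fun _ => ?_, ?_⟩)
          · have : q + -(y.2, -y.1) = colPoint y z c (K + t + 1) := by
              ext <;> simp [hq, colPoint] <;> ring
            show _ ∈ S
            rw [this]; exact hin
          · refine pointed_of_lex hdet fun x hx hne => ?_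
            rw [hqc, hqz]
            rcases eq_or_lt_of_le (hall x hx) with h1 | h1
            · right
              refine ⟨h1.symm, lt_of_le_of_ne (hqmin x hx h1.symm) fun h2 => hne ?_⟩
              rw [← colPoint_dot hdet x, ← h1, ← h2]
            · exact Or.inl h1
          · simp [dot]; linarith
          · simp [dot]; linarith
          · simp only [cross] at hdet; simp [dot]; linarith
          · have e1 : dot y (y.2, -y.1) = 0 := by simp [dot]; ring
            have e2 : dot z (y.2, -y.1) = -1 := by simp only [cross] at hdet; simp [dot]; linarith
            rw [e1, e2]
            exact isCoprime_zero_left.2 (by simp)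
        · have hout : colPoint y z c (K + t + 1) ∉ S := by
            intro h
            have h1 := hle _ h
            have h2 := congrArg (fun p : Plane => p 0) e50
            have h3 := congrArg (fun p : Plane => p 1) e50
            simp at h1 h2 h3
            rw [h2, h3] at hlt
            linarith
          refine Or.inr (Or.inl ⟨by rw [e5]; simp [Program.exec, k65, h35], q, ⟨h20, h21⟩, hqS,
            by rw [hqc]; exact hc0, by rw [hqc]; linarith, fun x hx => ?_⟩)
          rcases eq_or_lt_of_le (hall x hx) with h1 | h1
          · exact Or.inl (latConvex_latticePoints.column_eq hdet hqS hqmin hout x hx h1.symm)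
          · exact Or.inr h1
      · rintro ⟨k, hk1, hk2⟩
        rcases h4 with ⟨k65, hin⟩ | ⟨k65, A, B, C, hle, hlt, -⟩
        · rw [e5]; simp [Program.exec, k65]
        · exfalso
          have hout : colPoint y z c (K + t + 1) ∉ S := by
            intro h
            have h1 := hle _ h
            have h2 := congrArg (fun p : Plane => p 0) e50
            have h3 := congrArg (fun p : Plane => p 1) e50
            simp at h1 h2 h3
            rw [h2, h3] at hlt
            linarith
          have key := latConvex_latticePoints.column_eq hdet hqS hqmin hout
          have h1 := congrArg (dot z) ((key _ hk1 (dot_colPoint_fst hdet _ _)).trans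
            (key _ hk2 (dot_colPoint_fst hdet _ _)).symm)
          rw [dot_colPoint_snd hdet, dot_colPoint_snd hdet] at h1
          omega
    · obtain ⟨p, ⟨p1, p2⟩, hpS, hp0, hpc, hall⟩ := hpt
      norm_num at p2
      obtain ⟨t3, σ3, r3, ht3, e3⟩ := Program.runs_block (p := columnSecond) 12 σ2 (by decide)
        (by decide)
      have g20 := (ag12.1 20 (by norm_num)).trans p1
      have g21 := (ag12.1 21 (by norm_num)).trans p2
      have c0 : ((Cond.eq (.reg 65) (.const 0)).cost : ℝ) ≤ 8 := by
        exact_mod_cast (by decide : (Cond.eq (.reg 65) (.const 0)).cost ≤ 8)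
      have c1 : ((Cond.eq (.reg 35) (.const 0)).cost : ℝ) ≤ 8 := by
        exact_mod_cast (by decide : (Cond.eq (.reg 35) (.const 0)).cost ≤ 8)
      have a3 : (t3 : ℝ) ≤ 12 := by exact_mod_cast ht3
      have h35 : σ3.reg 35 = 2 := by rw [e3]; simp [columnSecond, Program.exec]
      have hd : dot y (p - q) = dot y p - c := by rw [← hqc]; simp [dot]; ring
      refine ⟨_, σ3, .ite_true (by simp [h65]) (.ite_false (by simp [h235, f1]) r3),
        ⟨hσ2.agree.trans (k' := 20) (r3.agree 20 (by decide)) le_rfl, ?_, ?_, ?_⟩,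
        ?_, Or.inr (Or.inr ⟨h35, p, p - q, ⟨?_, ?_⟩, ⟨?_, ?_⟩, hpS, ?_, ?_, ?_, ?_, fun h => ?_, ?_⟩),
        fun _ => h35, by push_cast; linarith, ht2'⟩
      · rw [e3]; simpa [columnSecond, Program.exec] using hσ2.lo
      · rw [e3]; simpa [columnSecond, Program.exec] using hσ2.hi
      · rw [e3]; simpa [columnSecond, Program.exec] using hσ2.low
      · rw [e3]; simpa [columnSecond, Program.exec] using h234
      · rw [e3]; simpa [columnSecond, Program.exec] using g20
      · rw [e3]; simpa [columnSecond, Program.exec] using g21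
      · rw [e3]; simp [columnSecond, Program.exec, g20, h50, hq]
      · rw [e3]; simp [columnSecond, Program.exec, g21, h51, hq]
      · show _ ∈ S
        simpa using hqS
      · refine pointed_of_lex hdet fun x hx hne => Or.inl ?_
        rcases hall x hx with h1 | h1
        · exact absurd h1 hne
        · omega
      · omega
      · omega
      · omega
      · exact latConvex_latticePoints.isCoprime hdet hpS hqS (by omega) (by rwa [hqc])
    · rw [f2] at h35; norm_num at h35
  · have hempty : ∀ x ∈ S, dot y x ≠ c := by
      intro x hx hxc
      obtain ⟨t, rfl⟩ := hnat x hx hxc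
      exact hno t ((hmem t).2 hx)
    have c0 : ((Cond.eq (.reg 65) (.const 0)).cost : ℝ) ≤ 8 := by
      exact_mod_cast (by decide : (Cond.eq (.reg 65) (.const 0)).cost ≤ 8)
    have h20 : σ2.reg 20 = σ.reg 20 := ag12.1 20 (by norm_num)
    have h21 : σ2.reg 21 = σ.reg 21 := ag12.1 21 (by norm_num)
    refine ⟨_, σ2, .ite_false (by simp [h65]) (.skip _), hσ2, h234, ?_, ?_,
      by push_cast; linarith, ?_⟩
    · rcases hflag with ⟨f0, hall⟩ | ⟨f1, p, ⟨p1, p2⟩, hpS, hp0, hpc, hall⟩ | ⟨f2, -⟩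
      · refine Or.inl ⟨h235.trans f0, fun x hx => ?_⟩
        have := hall x hx
        have := hempty x hx
        omega
      · refine Or.inr (Or.inl ⟨h235.trans f1, p, ⟨h20.trans p1, h21.trans p2⟩, hpS, hp0,
          by omega, fun x hx => ?_⟩)
        have := hempty x hx
        rcases hall x hx with h1 | h1
        · exact Or.inl h1
        · right; omega
      · rw [f2] at h35; norm_num at h35
    · rintro ⟨k, hk, -⟩
      exact absurd (dot_colPoint_fst hdet c k) (hempty _ hk)
    · rw [g12] at ht2
      refine ht2.trans ?_
      simp [searchDepth]

/-- After N columns either the range of y is exhausted or a column with two consecutive lattice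
points has been examined, and such a column always ends the search. -/
theorem runs_columns (hn : 3 ≤ n) (hv : IsCounterclockwise v) {s : State}
    (hs : HoldsPolygon v s) {y z : ℤ × ℤ} (hy : HasVec s 14 y) (hz : HasVec s 16 z)
    (hdet : cross y z = 1) (hcap : 1 ≤ s.reg 2)
    (hlow : ∀ x ∈ latticePoints v, s.reg 33 ≤ (dot z x : ℤ))
    (hhigh : ∀ x ∈ latticePoints v, (dot z x : ℤ) + 3 ≤ s.reg 33 + s.reg 2)
    (hlo : ∀ x ∈ latticePoints v, s.reg 31 ≤ (dot y x : ℤ))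
    (hhi : ∀ x ∈ latticePoints v, (dot y x : ℤ) ≤ s.reg 32)
    (hN : ∀ c₀ : ℤ, s.reg 31 ≤ c₀ → (c₀ : ℝ) < s.reg 31 + 1 →
      ∃ N : ℕ, 1 ≤ N ∧ N ≤ 200 ∧ ((∀ c : ℤ, (c : ℝ) ≤ s.reg 32 → c < c₀ + N) ∨
        ∃ k : ℤ, colPoint y z (c₀ + N - 1) k ∈ latticePoints v ∧
          colPoint y z (c₀ + N - 1) (k + 1) ∈ latticePoints v)) :
    ∃ tm s', Runs columns s tm s' ∧ Agree 20 s s' ∧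
      ((s'.reg 35 = 0 ∧ latticePoints v = ∅) ∨
        (s'.reg 35 = 1 ∧ ∃ p, HasVec s' 20 p ∧ latticePoints v = {p}) ∨
        (s'.reg 35 = 2 ∧ FoundPair v y z s')) ∧
      (tm : ℝ) ≤ 500000 * depth n * searchDepth (s.reg 2) := by
  have hdep : (1 : ℝ) ≤ depth n := by simp [depth]
  have hsd : (1 : ℝ) ≤ searchDepth (s.reg 2) := by simp [searchDepth]
  set T : ℝ := 2300 * depth n * searchDepth (s.reg 2) with hT
  have hT1 : 2300 ≤ T := by rw [hT]; nlinarith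
  obtain ⟨N, hN1, hN2, hN⟩ := hN ⌈s.reg 31⌉ (Int.le_ceil _) (Int.ceil_lt_add_one _)
  set c₀ := ⌈s.reg 31⌉ with hc₀
  obtain ⟨t1, s1, r1, ht1, e1⟩ := Program.runs_block
    (p := .assign 34 (.const 0 - .floor (.const 0 - .reg 31)) ;; .assign 35 (.const 0)) 10 s
    (by decide) (by decide)
  have hstart : ColumnData v y z s s1 := by
    refine ⟨r1.agree 20 (by decide), ?_, ?_, ?_⟩ <;> rw [e1] <;> simp [Program.exec]
  obtain ⟨t2, s2, k, r2, ⟨c, hd, hck, hkN, hcol, hflag, hend⟩, hb, ht2⟩ := Runs.loop_count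
    (b := .and (.le (.reg 34) (.reg 32)) (.lt (.reg 35) (.const 2))) (p := columnStep) 12
    (by decide)
    (fun k σ => ∃ c : ℤ, ColumnData v y z s σ ∧ c = c₀ + N - k ∧ k ≤ N ∧ σ.reg 34 = c ∧
      ColumnFlag v y z c₀ c σ ∧ (k = 0 → σ.reg 35 = 2 ∨ s.reg 32 < c)) T (by linarith)
    (fun k σ hI hb => by
      obtain ⟨c, hd, hck, hkN, hcol, hflag, hend⟩ := hI
      simp [hcol, hd.hi] at hb
      have hk : k ≠ 0 := by
        rintro rfl
        rcases hend rfl with h | h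
        · linarith [hb.2]
        · linarith [hb.1]
      obtain ⟨tm, σ', hr, hd', hcol', hflag', hpair, htm⟩ := runs_columnStep hn hv hs hy hz hdet hcap
        hlow hhigh (c₀ := c₀) (c := c) (by omega) (by omega) hd hcol hflag hb.2
      refine ⟨tm, σ', k - 1, hr, ⟨c + 1, hd', by omega, by omega, hcol', hflag', fun h => ?_⟩,
        by omega, htm⟩
      rcases hN with hN | hN
      · right
        by_contra hc
        have := hN (c + 1) (not_lt.1 hc)
        omega
      · left
        apply hpair
        have : c = c₀ + N - 1 := by omega
        rw [this]; exact hN) (k := N) (s := s1)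
    ⟨c₀, hstart, by omega, le_rfl, by rw [e1]; simp [Program.exec, hc₀, Int.floor_neg],
      Or.inl ⟨by rw [e1]; simp [Program.exec], fun x hx => Int.ceil_le.2 (hlo x hx)⟩, by omega⟩
  refine ⟨_, s2, .seq r1 r2, hd.agree, ?_, ?_⟩
  · simp [hcol, hd.hi] at hb
    rcases hflag with ⟨f0, hall⟩ | ⟨f1, p, hp, hpS, -, hpc, hall⟩ | h
    · have hc : s.reg 32 < c := by
        by_contra hc
        have := hb (not_lt.1 hc)
        rw [f0] at this; norm_num at this
      refine Or.inl ⟨f0, Set.eq_empty_iff_forall_notMem.2 fun x hx => ?_⟩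
      have h1 := hhi x hx
      have h2 : (c : ℝ) ≤ (dot y x : ℤ) := by exact_mod_cast hall x hx
      linarith
    · have hc : s.reg 32 < c := by
        by_contra hc
        have := hb (not_lt.1 hc)
        rw [f1] at this; norm_num at this
      refine Or.inr (Or.inl ⟨f1, p, hp, Set.eq_singleton_iff_unique_mem.2 ⟨hpS, fun x hx => ?_⟩⟩)
      rcases hall x hx with h1 | h1
      · exact h1
      · have h1' := hhi x hx
        have h2 : (c : ℝ) ≤ (dot y x : ℤ) := by exact_mod_cast h1
        linarith
    · exact Or.inr (Or.inr h)
  · have a1 : (t1 : ℝ) ≤ 10 := by exact_mod_cast ht1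
    have a2 : (N : ℝ) ≤ 200 := by exact_mod_cast hN2
    have a3 : (N : ℝ) * (T + 12) ≤ 200 * (T + 12) := by gcongr
    push_cast at ht2 ⊢
    linarith

end LatticeHull

/-! ## The discrete hull -/

namespace LatticeHull

open RealRAM

variable {n : ℕ} {v : Fin n → Plane}

/-- An inverse of j modulo h, reduced to 0 ≤ a < h when h is positive. The bound 200 on h allows it
to be found by trial in constant time. -/
theorem exists_inverse {h j : ℤ} (h0 : 0 ≤ h) (h1 : h ≤ 200) (hcop : IsCoprime h j)
    (hj : h = 0 → j = 1) : ∃ a : ℕ, a ≤ 200 ∧ ∃ b : ℤ, j * a - h * b = 1 := by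
  rcases eq_or_lt_of_le h0 with h2 | h2
  · exact ⟨1, by norm_num, 0, by rw [hj h2.symm]; norm_num⟩
  · obtain ⟨a, b, hab⟩ := hcop
    have e1 := Int.emod_nonneg b h2.ne'
    have e2 := Int.emod_lt_of_pos b h2
    have e3 := Int.emod_add_mul_ediv b h
    refine ⟨(b % h).toNat, by omega, -a - j * (b / h), ?_⟩
    rw [Int.toNat_of_nonneg e1]
    linear_combination hab + j * e3

/-! ### Completing a primitive vector to a basis, and the output. -/

def complementStart : Program :=
  .assign 37 (.const 0 - (.reg 14 * .reg 22 + .reg 15 * .reg 23)) ;;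
  .assign 38 (.const 0 - (.reg 16 * .reg 22 + .reg 17 * .reg 23)) ;; .assign 39 (.const 0)

def complementEnd : Program :=
  .assign 40 (.floor ((.reg 38 * .reg 39 - .const 1) / .reg 37)) ;;
  .assign 24 (.reg 39 * .reg 17 - .reg 40 * .reg 15) ;;
  .assign 25 (.reg 40 * .reg 14 - .reg 39 * .reg 16)

/-- Complete the vector in the registers `22`, `23` to a positive basis. -/
def complement : Program :=
  complementStart ;;
  .loop (.not (.eq (.floor ((.reg 38 * .reg 39 - .const 1) / .reg 37) * .reg 37)
      (.reg 38 * .reg 39 - .const 1)))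
    (.assign 39 (.reg 39 + .const 1)) ;;
  complementEnd

theorem runs_complement {s : State} {y z d : ℤ × ℤ} (hy : HasVec s 14 y) (hz : HasVec s 16 z)
    (hd : HasVec s 22 d) (hdet : cross y z = 1) (h0 : dot y d ≤ 0) (h1 : -200 ≤ dot y d)
    (h2 : dot y d = 0 → dot z d = -1) (hcop : IsCoprime (dot y d) (dot z d)) :
    ∃ tm s' e, Runs complement s tm s' ∧ Agree 24 s s' ∧ HasVec s' 24 e ∧ cross d e = 1 ∧
      (tm : ℝ) ≤ 10000 := by
  obtain ⟨y1, y2⟩ := hy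
  obtain ⟨z1, z2⟩ := hz
  obtain ⟨d1, d2⟩ := hd
  norm_num at y2 z2 d2
  set h : ℤ := -dot y d with hh
  set j : ℤ := -dot z d with hj
  obtain ⟨a, ha, b, hab⟩ := exists_inverse (h := h) (j := j) (by omega) (by omega)
    (by rw [hh, hj]; exact hcop.neg_neg) (fun h => by rw [hj, h2 (by omega)]; norm_num)
  obtain ⟨t1, s1, r1, ht1, e1⟩ := Program.runs_block (p := complementStart) 24 s
    (by decide) (by decide)
  have a1 : Agree 24 s s1 := r1.agree 24 (by decide)
  have h37 : s1.reg 37 = h := by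
    rw [e1]
    simp [complementStart, Program.exec, y1, y2, d1, d2, hh, dot]
  have h38 : s1.reg 38 = j := by
    rw [e1]
    simp [complementStart, Program.exec, z1, z2, d1, d2, hj, dot]
  have h39 : s1.reg 39 = (0 : ℕ) := by
    rw [e1]; simp [complementStart, Program.exec]
  obtain ⟨t2, s2, k, r2, ⟨c, i37, i38, i39, hck, ag⟩, hb, ht2⟩ := Runs.loop_count
    (b := .not (.eq (.floor ((.reg 38 * .reg 39 - .const 1) / .reg 37) * .reg 37)
      (.reg 38 * .reg 39 - .const 1))) (p := .assign 39 (.reg 39 + .const 1)) 40 (by decide)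
    (fun k σ => ∃ c : ℕ, σ.reg 37 = h ∧ σ.reg 38 = j ∧ σ.reg 39 = c ∧ c + k = a ∧
      Agree 24 s σ) 4 (by norm_num)
    (fun k σ hI hb => by
      obtain ⟨c, i37, i38, i39, hck, ag⟩ := hI
      have hk : k ≠ 0 := by
        rintro rfl
        apply hb
        have hca : c = a := by omega
        have e : (j : ℝ) * c - 1 = b * h := by
          rw [hca]
          have : (j : ℝ) * a - h * b = 1 := by exact_mod_cast hab
          linarith
        simp [i37, i38, i39, e]
        -- For h = 0 the quotient is 0 by the convention on division, and the test reads j c = 1,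
        -- which is what is needed.
        rcases eq_or_ne h 0 with h0 | h0
        · simp [h0]
        · rw [mul_div_cancel_right₀ _ (by exact_mod_cast h0)]; simp
      obtain ⟨u, σ', q, hu, d⟩ := Program.runs_block (p := .assign 39 (.reg 39 + .const 1)) 4 σ
        (by decide) (by decide)
      refine ⟨u, σ', k - 1, q, ⟨c + 1, ?_, ?_, ?_, by omega,
        ag.trans (k' := 24) (q.agree 24 (by decide)) le_rfl⟩, by omega, by exact_mod_cast hu⟩
      · rw [d]; simpa [Program.exec] using i37
      · rw [d]; simpa [Program.exec] using i38
      · rw [d]; simp [Program.exec, i39]) (k := a) (s := s1)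
    ⟨0, h37, h38, h39, by omega, a1⟩
  obtain ⟨t3, s3, r3, ht3, e3⟩ := Program.runs_block (p := complementEnd) 30 s2
    (by decide) (by decide)
  set β : ℤ := ⌊((j : ℝ) * c - 1) / h⌋ with hβ
  have hβ1 : j * c - β * h = 1 := by
    simp [i37, i38, i39] at hb
    rw [← hβ] at hb
    have : (j : ℝ) * c - β * h = 1 := by linarith
    exact_mod_cast this
  refine ⟨_, s3, colPoint y z c β, .seq r1 (.seq r2 r3),
    ag.trans (k' := 24) (r3.agree 24 (by decide)) le_rfl, ?_, ?_, ?_⟩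
  · have g14 := (ag.1 14 (by norm_num)).trans y1
    have g15 := (ag.1 15 (by norm_num)).trans y2
    have g16 := (ag.1 16 (by norm_num)).trans z1
    have g17 := (ag.1 17 (by norm_num)).trans z2
    rw [e3]
    constructor <;>
      simp [complementEnd, Program.exec, i37, i38, i39, g14, g15, g16, g17, colPoint, ← hβ]
  · have hd := colPoint_dot hdet d
    rw [show dot y d = -h by omega, show dot z d = -j by omega] at hd
    rw [← hd]
    simp only [cross, colPoint] at hdet ⊢
    linear_combination hβ1 + (j * c - β * h) * hdet
  · have b1 : (t1 : ℝ) ≤ 24 := by exact_mod_cast ht1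
    have b3 : (t3 : ℝ) ≤ 30 := by exact_mod_cast ht3
    have b2 : (a : ℝ) ≤ 200 := by exact_mod_cast ha
    push_cast at ht2 ⊢
    linarith

/-- Output the hull, when the result of the search for the first column is known. -/
def finish : Program :=
  .ite (.eq (.reg 35) (.const 0)) (.assign 0 (.const 0))
    (.ite (.eq (.reg 35) (.const 1))
      (.write 2 (.const 0) (.reg 20) ;; .write 3 (.const 0) (.reg 21) ;; .assign 0 (.const 1))
      (complement ;; walk))

theorem runs_finish (hn : 3 ≤ n) (hv : IsCounterclockwise v) {s : State}
    (hs : HoldsPolygon v s) {G : ℝ} (hG : Bounds v s G) {y z : ℤ × ℤ} (hy : HasVec s 14 y)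
    (hz : HasVec s 16 z) (hdet : cross y z = 1)
    (h : (s.reg 35 = 0 ∧ latticePoints v = ∅) ∨
      (s.reg 35 = 1 ∧ ∃ p, HasVec s 20 p ∧ latticePoints v = {p}) ∨
      (s.reg 35 = 2 ∧ FoundPair v y z s)) :
    ∃ tm s' m, ∃ w : Fin m → Plane, Runs finish s tm s' ∧ s'.Outputs w ∧
      IsVertexList w (latticeHull v) ∧ (tm : ℝ) ≤ (numVertices (latticeHull v) + 1) *
        (30000 * depth n * searchDepth (s.reg 2) + 100) + 11000 := by
  have hT : (0 : ℝ) ≤ (numVertices (latticeHull v) + 1) *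
      (30000 * depth n * searchDepth (s.reg 2) + 100) := by positivity
  have c0 : ((Cond.eq (.reg 35) (.const 0)).cost : ℝ) ≤ 8 := by
    exact_mod_cast (by decide : (Cond.eq (.reg 35) (.const 0)).cost ≤ 8)
  have c1 : ((Cond.eq (.reg 35) (.const 1)).cost : ℝ) ≤ 8 := by
    exact_mod_cast (by decide : (Cond.eq (.reg 35) (.const 1)).cost ≤ 8)
  rcases h with ⟨h35, hS⟩ | ⟨h35, p, ⟨p1, p2⟩, hS⟩ | ⟨h35, p, d, hp, hd, hpS, hdS, hpt, h0, h1, h2, hc⟩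
  · obtain ⟨t, s', r, ht, e⟩ := Program.runs_block (p := .assign 0 (.const 0)) 2 s
      (by decide) (by decide)
    have a1 : (t : ℝ) ≤ 2 := by exact_mod_cast ht
    refine ⟨_, s', 0, Fin.elim0, .ite_true (by simp [h35]) r, ⟨by rw [e]; simp [Program.exec],
      fun i => i.elim0⟩, ⟨fun i => i.elim0, ?_, fun i => i.elim0⟩, by push_cast; linarith⟩
    simp [latticeHull, hS]
  · norm_num at p2
    obtain ⟨t, s', r, ht, e⟩ := Program.runs_block
      (p := .write 2 (.const 0) (.reg 20) ;; .write 3 (.const 0) (.reg 21) ;;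
        .assign 0 (.const 1)) 8 s (by decide) (by decide)
    have a1 : (t : ℝ) ≤ 8 := by exact_mod_cast ht
    refine ⟨_, s', 1, fun _ => toPlane p, .ite_false (by simp [h35]) (.ite_true (by simp [h35]) r),
      ⟨by rw [e]; simp [Program.exec], fun i => ?_⟩,
      ⟨Function.injective_of_subsingleton _, ?_, fun i j k hij => by omega⟩, by push_cast; linarith⟩
    · rw [e]; simp [Program.exec, State.arr_setArr, p1, p2]
    · simp [latticeHull, hS, Set.range_const]
  · obtain ⟨t1, s1, e, r1, a1, he, hde, ht1⟩ := runs_complement hy hz hd hdet h0 h1 h2 hc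
    have hne : (y.2, -y.1) ≠ 0 := by
      intro h
      simp only [Prod.mk_eq_zero, neg_eq_zero] at h
      simp [cross, h.1, h.2] at hdet
    obtain ⟨t2, s2, m, w, r2, ho, hw, ht2⟩ := runs_walk hn hv (hs.mono (by norm_num) a1)
      (hG.congr a1 (by norm_num)) (p := p) (d := d) (e := e) (f := (y.2, -y.1))
      ⟨hp.congr a1 (by norm_num), hd.congr a1 (by norm_num), he, hpS, hde, hdS, hne, hpt⟩
    rw [a1.1 2 (by norm_num)] at ht2
    exact ⟨_, s2, m, w, .ite_false (by simp [h35]) (.ite_false (by simp [h35]) (.seq r1 r2)), ho, hw,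
      by push_cast; linarith⟩

/-- The program that computes the discrete hull. -/
def hullProgram : Program := setup ;; gauss ;; range ;; columns ;; finish

theorem runs_hullProgram (hn : 3 ≤ n) (hv : IsCounterclockwise v) :
    ∃ t s m, ∃ (w : Fin m → Plane) (R : ℝ), Runs hullProgram (inputState v) t s ∧ s.Outputs w ∧
      IsVertexList w (latticeHull v) ∧ 0 ≤ R ∧ R ≤ Metric.diam (polygon v) ^ 2 ∧
      (t : ℝ) ≤ 204 * n + (numVertices (latticeHull v) + 1) *
        (600000 * depth n * searchDepth (40 * (R + 1) ^ 3)) + 15000 := by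
  obtain ⟨t1, s1, r1, hW, h2, hG, ht1⟩ := runs_setup (v := v) hn
  set R := s1.reg 4 with hR
  have hR0 : 0 ≤ R := by rw [hR, hW.far.val]; positivity
  have hcap : 40 * (R + 1) ≤ s1.reg 2 := by
    rw [h2]
    nlinarith [mul_nonneg hR0 hR0, mul_nonneg (mul_nonneg hR0 hR0) hR0]
  have hU : s1.reg 5 ^ 2 + s1.reg 6 ^ 2 = R := hW.far.val.symm
  have hV : s1.reg 7 ^ 2 + s1.reg 8 ^ 2 ≤ R := by
    obtain ⟨j, hj, h7, h8⟩ := hW.mem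
    rw [h7, h8]; exact hW.far.max j hj
  -- The coordinate functionals have extent at most |u|² + |w|² ≤ 2R, so 2R bounds the extents
  -- throughout the reduction.
  obtain ⟨t2, s2, y, z, r2, hB, hred, ht2⟩ := runs_gauss (hW.det_ne_zero hn hv) (B := 2 * R)
    (by simp [extent]; nlinarith [sq_nonneg (s1.reg 6), sq_nonneg (s1.reg 8)])
    (by simp [extent]; nlinarith [sq_nonneg (s1.reg 5), sq_nonneg (s1.reg 7)])
    (k := searchDepth (s1.reg 2)) (by
      have h3 := Nat.lt_pow_succ_log_self (b := 2) (by norm_num) ⌈s1.reg 2⌉₊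
      have h4 : (⌈s1.reg 2⌉₊ : ℝ) < 2 ^ searchDepth (s1.reg 2) := by exact_mod_cast h3
      have h5 := Nat.le_ceil (s1.reg 2)
      linarith)
  have hp2 : HoldsPolygon v s2 := hW.far.poly.mono (by norm_num) hB.agree
  obtain ⟨t3, s3, r3, a3, hr, ht3⟩ := runs_range hn hp2 hB.fst hB.snd
  have hp3 : HoldsPolygon v s3 := hp2.mono (by norm_num) a3
  have a13 : Agree 14 s1 s3 := hB.agree.trans a3 (by norm_num)
  have g2 : s3.reg 2 = s1.reg 2 := a13.1 2 (by norm_num)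
  have hlo : ∀ x ∈ latticePoints v, s3.reg 31 ≤ (dot y x : ℤ) := by
    intro x hx
    rw [← level_toPlane]
    have := polygon_le (v := v) (a := -y.1) (b := -y.2) (c := -s3.reg 31)
      (fun i hi => by have := hr.min_le i hi; simp only [level] at this; linarith) _ hx
    simp only [level]; linarith
  have hhi : ∀ x ∈ latticePoints v, (dot y x : ℤ) ≤ s3.reg 32 := by
    intro x hx
    rw [← level_toPlane]
    exact polygon_le (fun i hi => hr.le_max i hi) _ hx
  have hlow : ∀ x ∈ latticePoints v, s3.reg 33 ≤ (dot z x : ℤ) := by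
    intro x hx
    rw [← level_toPlane]
    have := polygon_le (v := v) (a := -z.1) (b := -z.2) (c := -s3.reg 33)
      (fun i hi => by have := hr.low_le i hi; simp only [level] at this; linarith) _ hx
    simp only [level]; linarith
  have hhigh : ∀ x ∈ latticePoints v, (dot z x : ℤ) + 3 ≤ s3.reg 33 + s3.reg 2 := by
    intro x hx
    rw [← level_toPlane]
    have := polygon_le (v := v) (a := z.1) (b := z.2) (c := s3.reg 33 + s3.reg 2 - 3) (fun i hi => by
      obtain ⟨j, hj, ej⟩ := hr.low_eq
      have h5 := level_range_sq_le (hW.level_sub_le hn hv z hi) (hW.level_sub_le hn hv z hj)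
      rw [← ej] at h5
      have h6 := hB.snd_le
      -- The squared range of z is at most 36 · 2R, which is less than (18R + 4)². Adding the margin
      -- 3 stays below the cap, which is at least 40(R + 1).
      have h7 : level z (vertex v i) - s3.reg 33 ≤ 18 * R + 4 := by
        by_contra hc
        nlinarith
      simp only [level] at h7
      rw [g2]
      linarith) _ hx
    simp only [level]; linarith
  obtain ⟨t4, s4, r4, a4, h4, ht4⟩ := runs_columns hn hv hp3 (hB.fst.congr a3 (by norm_num))
    (hB.snd.congr a3 (by norm_num)) hB.det (by rw [g2]; linarith) hlow hhigh hlo hhi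
    (fun c₀ h5 h6 => exists_column_bound hn hv hW hB.det hred hr h5 h6)
  have a14 : Agree 14 s1 s4 := a13.trans a4 (by norm_num)
  obtain ⟨t5, s5, m, w, r5, ho, hw, ht5⟩ := runs_finish hn hv (hp3.mono (by norm_num) a4)
    (hG.congr a14 (by norm_num)) ((hB.fst.congr a3 (by norm_num)).congr a4 (by norm_num))
    ((hB.snd.congr a3 (by norm_num)).congr a4 (by norm_num)) hB.det h4
  refine ⟨_, s5, m, w, R, .seq r1 (.seq r2 (.seq r3 (.seq r4 r5))), ho, hw, hR0,
    hW.far.le_diam hn, ?_⟩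
  rw [a14.1 2 (by norm_num), h2] at ht5
  rw [g2, h2] at ht4
  rw [h2] at ht2
  set D := ((depth n : ℕ) : ℝ) with hD
  set L := ((searchDepth (40 * (R + 1) ^ 3) : ℕ) : ℝ) with hL
  set V := ((numVertices (latticeHull v) : ℕ) : ℝ) with hV'
  have hD1 : 1 ≤ D := by simp [hD, depth]
  have hL1 : 1 ≤ L := by simp [hL, searchDepth]
  have hV0 : 0 ≤ V := Nat.cast_nonneg _
  have hDL : L ≤ D * L := by nlinarith
  have hVDL : 0 ≤ V * (D * L) := by positivity
  have hVDL' : V ≤ V * (D * L) := by nlinarith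
  push_cast
  linarith

/-! ### The running time -/

theorem depth_le (hn : 3 ≤ n) : (depth n : ℝ) ≤ 3 * Real.log n ∧ 1 ≤ Real.log n := by
  have h3 : (3 : ℝ) ≤ n := by exact_mod_cast hn
  have h1 : 1 ≤ Real.log n := by
    rw [Real.le_log_iff_exp_le (by linarith)]
    linarith [Real.exp_one_lt_d9]
  have h2 := natLog_le_logb (t := n)
  have h4 := Real.log_two_gt_d9
  have h5 : Real.logb 2 n ≤ 2 * Real.log n := by
    rw [Real.logb, div_le_iff₀ (by linarith)]
    nlinarith
  refine ⟨?_, h1⟩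
  simp only [depth]
  push_cast
  linarith

/-- The cap is a polynomial in δ, so its logarithm is O(log δ). The summand 1 in R + 1 keeps it
bounded when δ is small, where the maximum with 1 takes over. -/
theorem searchDepth_le {R δ : ℝ} (hR : 0 ≤ R) (hRδ : R ≤ δ ^ 2) (hδ : 0 ≤ δ) :
    (searchDepth (40 * (R + 1) ^ 3) : ℝ) ≤ 40 * max 1 (Real.log δ) := by
  set Λ := max 1 (Real.log δ) with hΛ
  have hΛ1 : 1 ≤ Λ := le_max_left _ _
  have h2 := Real.log_two_gt_d9
  have h2' := Real.log_two_lt_d9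
  have hG1 : 1 ≤ (R + 1) ^ 3 := one_le_pow₀ (by linarith)
  have hG : Real.log (R + 1) ≤ 3 * Λ := by
    rcases le_or_gt δ 1 with h | h
    · have : R + 1 ≤ 2 := by nlinarith
      have := Real.log_le_log (by linarith) this
      linarith
    · have h3 : R + 1 ≤ 2 * δ ^ 2 := by nlinarith
      have h4 := Real.log_le_log (by linarith) h3
      rw [Real.log_mul (by norm_num) (by positivity), Real.log_pow] at h4
      have : Real.log δ ≤ Λ := le_max_right _ _
      push_cast at h4
      linarith
  have h3 : (⌈40 * (R + 1) ^ 3⌉₊ : ℝ) ≤ 2 ^ 7 * (R + 1) ^ 3 := by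
    have := Nat.ceil_lt_add_one (a := 40 * (R + 1) ^ 3) (by linarith)
    linarith
  have hpos : (0 : ℝ) < (⌈40 * (R + 1) ^ 3⌉₊ : ℝ) := by
    have := Nat.le_ceil (40 * (R + 1) ^ 3)
    linarith
  have h4 := Real.log_le_log hpos h3
  rw [Real.log_mul (by norm_num) (by positivity), Real.log_pow, Real.log_pow] at h4
  push_cast at h4
  have h5 := natLog_le_logb (t := ⌈40 * (R + 1) ^ 3⌉₊)
  have h6 : Real.logb 2 (⌈40 * (R + 1) ^ 3⌉₊ : ℝ) ≤ 2 * (14 * Λ) := by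
    rw [Real.logb, div_le_iff₀ (by linarith)]
    nlinarith
  simp only [searchDepth]
  push_cast
  linarith

theorem discreteHull_eq : discreteHull (polygon v) = latticeHull v := by
  rw [discreteHull, latticeHull]
  congr 1
  ext p
  constructor
  · rintro ⟨hp, a, b, rfl⟩
    exact ⟨(a, b), hp, rfl⟩
  · rintro ⟨z, hz, rfl⟩
    exact ⟨hz, z.1, z.2, rfl⟩

end LatticeHull

theorem mainTheorem8 :
    ∃ (A : RealRAM.Program) (K : ℝ), ∀ (n : ℕ) (v : Fin n → Plane),
      3 ≤ n → IsCounterclockwise v →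
      ∃ (t : ℕ) (s : RealRAM.State) (m : ℕ) (w : Fin m → Plane),
        RealRAM.Runs A (RealRAM.inputState v) t s ∧
        s.Outputs w ∧
        IsVertexList w (discreteHull (polygon v)) ∧
        (t : ℝ) ≤ K * ((n : ℝ) +
          max 1 (numVertices (discreteHull (polygon v)) : ℝ) *
            max 1 (Real.log (Metric.diam (polygon v))) * Real.log n) := by
  -- The main term needs 2 · 600000 · 3 · 40 < 10⁹; the factor 2 comes from replacing the number of
  -- vertices plus 1 by twice its maximum with 1.
  refine ⟨LatticeHull.hullProgram, 10 ^ 9, fun n v hn hv => ?_⟩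
  obtain ⟨t, s, m, w, R, hr, ho, hw, hR, hRδ, ht⟩ := LatticeHull.runs_hullProgram hn hv
  rw [LatticeHull.discreteHull_eq]
  refine ⟨t, s, m, w, hr, ho, hw, ?_⟩
  obtain ⟨hD, hlog⟩ := LatticeHull.depth_le hn
  have hL := LatticeHull.searchDepth_le hR hRδ Metric.diam_nonneg
  set V : ℝ := max 1 (numVertices (LatticeHull.latticeHull v) : ℝ) with hV
  set Λ := max 1 (Real.log (Metric.diam (polygon v))) with hΛ
  have hV1 : 1 ≤ V := le_max_left _ _
  have hV2 : (numVertices (LatticeHull.latticeHull v) : ℝ) + 1 ≤ 2 * V := by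
    have : (numVertices (LatticeHull.latticeHull v) : ℝ) ≤ V := le_max_right _ _
    linarith
  have hΛ1 : 1 ≤ Λ := le_max_left _ _
  have h1 : (600000 : ℝ) * LatticeHull.depth n * LatticeHull.searchDepth (40 * (R + 1) ^ 3) ≤
      600000 * (3 * Real.log n) * (40 * Λ) := by gcongr
  have h2 : ((numVertices (LatticeHull.latticeHull v) : ℝ) + 1) *
      (600000 * LatticeHull.depth n * LatticeHull.searchDepth (40 * (R + 1) ^ 3)) ≤
      2 * V * (600000 * (3 * Real.log n) * (40 * Λ)) := by gcongr
  have h3 : 0 ≤ V * Λ * Real.log n := by positivity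
  have hn' : (3 : ℝ) ≤ n := by exact_mod_cast hn
  linarith
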